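/- Let $N\ge 3$ be an integer, $B$ the open unit ball of $\mathbb{R}^N$, $p>p_S:=\frac{N+2}{N-2}$, $f(U):=-U+U^p$, $\theta:=\frac{2}{p-1}$ and $A(p,N):=\{\theta(N-2-\theta)\}^{1/(p-1)}$. For $\lambda>0$ consider the radial Neumann problem $$U''+\frac{N-1}{r}U'+\lambda f(U)=0\ \ (0<r<1),\qquad U'(1)=0,\qquad U>0\ \ (0<r\le 1),$$ where $U'(1)$ is the one-sided derivative. A singular solution is a pair $(\lambda,U)$ with $\lambda>0$ and $U\in C^2(0,1)\cap C^0(0,1]$ that solves this problem and satisfies $U(r)\to\infty$ as $r\downarrow 0$. There are infinitely many singular solutions $(\lambda_n^*,U_n^*)$, $n=1,2,\dots$, with $\lambda_1^*<\lambda_2^*<\cdots\to\infty$, such that the radial function $x\mapsto U_n^*(|x|)$ belongs to $H^1(B)$ and (i) $U_n^*(r)=A(p,N)(\sqrt{\lambda_n^*}\,r)^{-\theta}(1+o(1))$ as $r\downarrow 0$; (ii) $U_n^*-1$ has exactly $n$ zeros in $(0,1]$; (iii) $U_n^*(r)>0$ for $0<r\le 1$. Moreover, for each $n\ge 1$ the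 singular solution is unique: if $(\tilde\lambda,\tilde U)$ is a singular solution such that (i) (with $\tilde\lambda,\tilde U$ in place of $\lambda_n^*,U_n^*$) and (ii) (for $\tilde U$) hold, then $\tilde\lambda=\lambda_n^*$ and $\tilde U=U_n^*$ on $(0,1]$. Finally, there is exactly one positive function $u^*\in C^2(0,\infty)$ with $u''+\frac{N-1}{s}u'+f(u)=0$ on $(0,\infty)$ and $u(s)=A(p,N)s^{-\theta}(1+o(1))$ (hence $u(s)\to\infty$) as $s\downarrow 0$. Its positive critical points form an increasing sequence $s_1^*<s_2^*<\cdots$, and $\sqrt{\lambda_n^*}=s_n^*$ for every $n\ge 1$. -/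

import Mathlib

open Set Filter Topology MeasureTheory
open scoped ContDiff

noncomputable section

namespace SupercriticalNeumann

/-- The critical Sobolev exponent `p_S = (N + 2) / (N - 2)`, used for `N ≥ 3`. -/
def pS (N : ℕ) : ℝ := ((N : ℝ) + 2) / ((N : ℝ) - 2)

/-- The exponent `θ = 2 / (p - 1)`. -/
def theta (p : ℝ) : ℝ := 2 / (p - 1)

/-- The constant `A(p, N) = (θ (N - 2 - θ)) ^ (1 / (p - 1))`. -/
def ampl (p : ℝ) (N : ℕ) : ℝ :=
  (theta p * ((N : ℝ) - 2 - theta p)) ^ (1 / (p - 1))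

/-- The nonlinearity `f(u) = -u + u ^ p`. -/
def nonlin (p u : ℝ) : ℝ := -u + u ^ p

/-- The point `r` satisfies `u'' + ((N - 1) / r) u' + lam f(u) = 0`. -/
def RadialODEAt (N : ℕ) (p lam : ℝ) (u : ℝ → ℝ) (r : ℝ) : Prop :=
  deriv (deriv u) r + ((N : ℝ) - 1) / r * deriv u r + lam * nonlin p (u r) = 0

/-- `(lam, U)` is a singular solution of the radial Neumann problem on the unit ball:
`lam > 0`, `U ∈ C²(0,1) ∩ C⁰(0,1]` is positive on `(0,1]`, solves the equation on `(0,1)`, has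
one-sided derivative `0` at `1`, and tends to infinity at the origin. -/
structure IsSingularNeumannSolution (N : ℕ) (p lam : ℝ) (U : ℝ → ℝ) : Prop where
  lam_pos : 0 < lam
  contDiffOn : ContDiffOn ℝ 2 U (Ioo 0 1)
  continuousOn : ContinuousOn U (Ioc 0 1)
  ode : ∀ r ∈ Ioo (0 : ℝ) 1, RadialODEAt N p lam U r
  neumann : HasDerivWithinAt U 0 (Iic 1) 1
  pos : ∀ r ∈ Ioc (0 : ℝ) 1, 0 < U r
  singular : Tendsto U (𝓝[>] 0) atTop

/-- `U(r) = A(p, N) (√lam r) ^ (-θ) (1 + o(1))` as `r ↓ 0`. -/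
def HasSingularProfile (N : ℕ) (p lam : ℝ) (U : ℝ → ℝ) : Prop :=
  Asymptotics.IsEquivalent (𝓝[>] 0) U (fun r => ampl p N * (√lam * r) ^ (-theta p))

/-- `u` is a positive singular solution of `u'' + ((N - 1) / s) u' + f(u) = 0` on `(0,∞)` with
`u(s) = A(p, N) s ^ (-θ) (1 + o(1))` as `s ↓ 0`. -/
structure IsEntireSingularSolution (N : ℕ) (p : ℝ) (u : ℝ → ℝ) : Prop where
  contDiffOn : ContDiffOn ℝ 2 u (Ioi 0)
  ode : ∀ s ∈ Ioi (0 : ℝ), RadialODEAt N p 1 u s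
  pos : ∀ s ∈ Ioi (0 : ℝ), 0 < u s
  singular : Tendsto u (𝓝[>] 0) atTop
  profile : Asymptotics.IsEquivalent (𝓝[>] 0) u (fun s => ampl p N * s ^ (-theta p))

/-- `s 1 < s 2 < ⋯` are all the positive critical points of `u`; the value `s 0` is not used. -/
structure EnumeratesCriticalPoints (u : ℝ → ℝ) (s : ℕ → ℝ) : Prop where
  strictMonoOn : StrictMonoOn s (Ici 1)
  image_eq : s '' Ici 1 = {t : ℝ | 0 < t ∧ deriv u t = 0}

/-- `g` is a weak gradient of `f` on the set `Ω` (meant to be open). -/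
def IsWeakGradient {N : ℕ} (Ω : Set (EuclideanSpace ℝ (Fin N)))
    (f : EuclideanSpace ℝ (Fin N) → ℝ)
    (g : EuclideanSpace ℝ (Fin N) → EuclideanSpace ℝ (Fin N)) : Prop :=
  ∀ φ : EuclideanSpace ℝ (Fin N) → ℝ, ContDiff ℝ ∞ φ → HasCompactSupport φ → tsupport φ ⊆ Ω →
    ∀ i : Fin N, ∫ x in Ω, f x * fderiv ℝ φ x (EuclideanSpace.single i 1)
      = - ∫ x in Ω, g x i * φ x

/-- `f ∈ H¹(Ω)`: `f` is in `L²(Ω)` and has a weak gradient in `L²(Ω)`. -/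
def MemH1 {N : ℕ} (Ω : Set (EuclideanSpace ℝ (Fin N)))
    (f : EuclideanSpace ℝ (Fin N) → ℝ) : Prop :=
  MemLp f 2 (volume.restrict Ω) ∧
    ∃ g : EuclideanSpace ℝ (Fin N) → EuclideanSpace ℝ (Fin N),
      MemLp g 2 (volume.restrict Ω) ∧ IsWeakGradient Ω f g

/-- The radial function `x ↦ U(|x|)` belongs to `H¹(B)`, where `B` is the open unit ball of
`ℝ^N`. -/
def RadialMemH1Ball (N : ℕ) (U : ℝ → ℝ) : Prop :=
  MemH1 (Metric.ball (0 : EuclideanSpace ℝ (Fin N)) 1) (fun x => U ‖x‖)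

/-- The number of zeros of `U - 1` in `(0,1]`. -/
def zeroCount (U : ℝ → ℝ) : ℕ∞ := {r : ℝ | r ∈ Ioc (0 : ℝ) 1 ∧ U r - 1 = 0}.encard

end SupercriticalNeumann

end

/-! Everything reduces to one function. The substitution `s = √lam * r` turns a singular solution on
the ball into a solution `u` of the equation with parameter 1, and the Neumann condition says that
`√lam` is a critical point of `u`. If `u` is the only solution with the profile `A s ^ (-θ)`, then
the singular solutions with that profile are exactly the rescalings of `u` at its critical points,
and they are told apart by how often `u` has crossed the level 1.

Near the origin, `x(t) = exp(θ t) u(exp t) - A` solves a damped oscillator on a half line towards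
`-∞`, forced by `exp(2t) (A + x)` and a superlinear remainder. Supercriticality is equivalent to
positive damping `N - 2 - 2θ`. Damping forwards in time means that the difference of two solutions
bounded near `-∞` has decayed for an infinite time, so it vanishes
(`eq_zero_of_bounded_oscillator`). It also means that solutions started at rest at times going to
`-∞` form a Cauchy sequence (`exists_decaying_oscillator`).

The solution continues to all `s > 0` because the decreasing energy bounds `u` and `u'`, while the
Pohozaev functional is negative near the origin and nonincreasing; it is nonnegative where `u = 0`,
so `u` stays positive.

Oscillation about 1 comes from a Sturm argument (`not_forall_pos_of_radial_sturm`). The one escape,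
monotone decay to 0, would be exponential and would drive the Pohozaev functional to a nonnegative
limit (`IsRadialSol.not_decreasing_to_zero`). As `s ^ (N - 1) u'` is monotone while `u - 1` keeps
its sign, exactly one crossing lies between consecutive critical points. Membership in `H¹` again
uses positive damping, in the form `2 (θ + 1) < N`. -/

noncomputable section

namespace SupercriticalNeumann

/-! ### Generic facts about planar differential equations -/

/-- Coordinatewise projection of the plane onto the box `[a₁, b₁] × [a₂, b₂]`. -/
def clampBox (a₁ b₁ a₂ b₂ : ℝ) (x : ℝ × ℝ) : ℝ × ℝ :=
  (max a₁ (min b₁ x.1), max a₂ (min b₂ x.2))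

lemma clampBox_mem {a₁ b₁ a₂ b₂ : ℝ} (h₁ : a₁ ≤ b₁) (h₂ : a₂ ≤ b₂) (x : ℝ × ℝ) :
    clampBox a₁ b₁ a₂ b₂ x ∈ Icc a₁ b₁ ×ˢ Icc a₂ b₂ := by
  simp [clampBox, h₁, h₂]

lemma clampBox_of_mem {a₁ b₁ a₂ b₂ : ℝ} {x : ℝ × ℝ} (hx : x ∈ Icc a₁ b₁ ×ˢ Icc a₂ b₂) :
    clampBox a₁ b₁ a₂ b₂ x = x := by
  obtain ⟨⟨h1, h2⟩, h3, h4⟩ := hx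
  simp [clampBox, h1, h2, h3, h4]

lemma lipschitzWith_clampBox (a₁ b₁ a₂ b₂ : ℝ) : LipschitzWith 1 (clampBox a₁ b₁ a₂ b₂) := by
  have h1 : LipschitzWith 1 (fun x : ℝ × ℝ => max a₁ (min b₁ x.1)) :=
    (LipschitzWith.prod_fst.const_min b₁).const_max a₁
  have h2 : LipschitzWith 1 (fun x : ℝ × ℝ => max a₂ (min b₂ x.2)) :=
    (LipschitzWith.prod_snd.const_min b₂).const_max a₂
  have h := h1.prodMk h2
  rw [max_self] at h
  exact h

/-- A planar differential equation whose solutions cannot touch the boundary of a box has a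
solution on the whole time interval that stays in the box. -/
theorem exists_solution_mem_box {f : ℝ → ℝ × ℝ → ℝ × ℝ} {t₀ t₁ a₁ b₁ a₂ b₂ : ℝ} {L : NNReal}
    {x₀ : ℝ × ℝ} (ht : t₀ ≤ t₁)
    (hlip : ∀ t ∈ Icc t₀ t₁, LipschitzOnWith L (f t) (Icc a₁ b₁ ×ˢ Icc a₂ b₂))
    (hcont : ContinuousOn (Function.uncurry f) (Icc t₀ t₁ ×ˢ (Icc a₁ b₁ ×ˢ Icc a₂ b₂)))
    (hx₀ : x₀ ∈ Icc a₁ b₁ ×ˢ Icc a₂ b₂)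
    (hpriori : ∀ τ ∈ Icc t₀ t₁, ∀ X : ℝ → ℝ × ℝ, X t₀ = x₀ →
      (∀ t ∈ Icc t₀ τ, HasDerivWithinAt X (f t (X t)) (Icc t₀ τ) t) →
      (∀ t ∈ Icc t₀ τ, X t ∈ Icc a₁ b₁ ×ˢ Icc a₂ b₂) → X τ ∈ Ioo a₁ b₁ ×ˢ Ioo a₂ b₂) :
    ∃ X : ℝ → ℝ × ℝ, X t₀ = x₀ ∧
      ∀ t ∈ Icc t₀ t₁, HasDerivWithinAt X (f t (X t)) (Icc t₀ t₁) t ∧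
        X t ∈ Icc a₁ b₁ ×ˢ Icc a₂ b₂ := by
  have h₁ : a₁ ≤ b₁ := hx₀.1.1.trans hx₀.1.2
  have h₂ : a₂ ≤ b₂ := hx₀.2.1.trans hx₀.2.2
  set K : Set (ℝ × ℝ) := Icc a₁ b₁ ×ˢ Icc a₂ b₂ with hK
  have hKc : IsCompact K := isCompact_Icc.prod isCompact_Icc
  obtain ⟨C, hC⟩ := (isCompact_Icc.prod hKc).exists_bound_of_continuousOn hcont
  -- Projecting onto the box before applying the field makes it bounded and Lipschitz on the whole
  -- plane, so no smallness of the time interval is needed: `C * (t₁ - t₀)` serves as the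
  -- Picard–Lindelöf radius. The projection is invisible as long as the solution stays in the box.
  set c := clampBox a₁ b₁ a₂ b₂ with hc
  have hcm : ∀ x, c x ∈ K := clampBox_mem h₁ h₂
  have hPL : IsPicardLindelof (fun t x => f t (c x)) (⟨t₀, left_mem_Icc.2 ht⟩ : Icc t₀ t₁) x₀
      (C.toNNReal * (t₁ - t₀).toNNReal) 0 C.toNNReal L := by
    constructor
    · intro t htt
      have := (hlip t htt).comp (lipschitzWith_clampBox a₁ b₁ a₂ b₂).lipschitzOnWith
        (s := univ) (fun x _ => hcm x)
      rw [mul_one] at this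
      exact this.mono (subset_univ _)
    · intro x _
      exact hcont.comp (f := fun t : ℝ => (t, c x)) (by fun_prop) fun t htt => ⟨htt, hcm x⟩
    · intro t htt x _
      exact (hC (t, c x) ⟨htt, hcm x⟩).trans (Real.le_coe_toNNReal C)
    · simp [sub_nonneg.2 ht]
  obtain ⟨X, hX0, hX⟩ := hPL.exists_eq_forall_mem_Icc_hasDerivWithinAt₀
  simp only at hX0
  have hXc : ContinuousOn X (Icc t₀ t₁) := fun t htt => (hX t htt).continuousWithinAt
  have key : ∀ τ ∈ Icc t₀ t₁, (∀ t ∈ Icc t₀ τ, X t ∈ K) → X τ ∈ Ioo a₁ b₁ ×ˢ Ioo a₂ b₂ := by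
    intro τ hτ hm
    refine hpriori τ hτ X hX0 (fun t htt => ?_) hm
    have := (hX t ⟨htt.1, htt.2.trans hτ.2⟩).mono (Icc_subset_Icc_right hτ.2)
    rwa [hc, clampBox_of_mem (hm t htt)] at this
  set S : Set ℝ := {t | ∀ τ ∈ Icc t₀ t, X τ ∈ K}
  have hcl : IsClosed (S ∩ Icc t₀ t₁) := by
    rw [← closure_subset_iff_isClosed]
    intro t hcl
    have htI : t ∈ Icc t₀ t₁ := closure_minimal inter_subset_right isClosed_Icc hcl
    refine ⟨fun τ hτ => ?_, htI⟩
    have hlt : ∀ σ ∈ Ico t₀ t, X σ ∈ K := by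
      intro σ hσ
      obtain ⟨y, hy1, hy2⟩ := mem_closure_iff.1 hcl (Ioi σ) isOpen_Ioi hσ.2
      exact hy2.1 σ ⟨hσ.1, le_of_lt hy1⟩
    rcases hτ.2.lt_or_eq with h | rfl
    · exact hlt τ ⟨hτ.1, h⟩
    · rcases hτ.1.lt_or_eq with h | rfl
      · have hne : (𝓝[Ico t₀ τ] τ).NeBot := by
          rw [← mem_closure_iff_nhdsWithin_neBot, closure_Ico h.ne]
          exact right_mem_Icc.2 h.le
        have := (hXc τ htI).mono (s := Ico t₀ τ) fun σ hσ => ⟨hσ.1, hσ.2.le.trans htI.2⟩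
        exact hKc.isClosed.mem_of_tendsto this (eventually_mem_nhdsWithin.mono hlt)
      · rw [hX0]; exact hx₀
  -- Continuous induction: `S` is closed in the interval, and a solution that has stayed in the box
  -- so far is in its interior, so it stays a little longer.
  have hmem : t₁ ∈ S := by
    refine hcl.mem_of_ge_of_forall_exists_gt ?_ ht ?_
    · intro τ hτ
      obtain rfl : τ = t₀ := le_antisymm hτ.2 hτ.1
      rw [hX0]; exact hx₀
    · rintro t ⟨htS, htI⟩
      have hin := key t (Ico_subset_Icc_self htI) htS
      have hopen : IsOpen (Ioo a₁ b₁ ×ˢ Ioo a₂ b₂) := isOpen_Ioo.prod isOpen_Ioo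
      have h1 : ∀ᶠ s in 𝓝[Icc t₀ t₁] t, X s ∈ Ioo a₁ b₁ ×ˢ Ioo a₂ b₂ :=
        (hXc t (Ico_subset_Icc_self htI)) (hopen.mem_nhds hin)
      rw [eventually_nhdsWithin_iff, Metric.eventually_nhds_iff] at h1
      obtain ⟨ε, hε, h1⟩ := h1
      refine ⟨min t₁ (t + ε / 2), ?_, lt_min htI.2 (by linarith), min_le_left _ _⟩
      intro τ hτ
      rcases le_or_gt τ t with h | h
      · exact htS τ ⟨hτ.1, h⟩
      · have := h1 (y := τ) (by
          rw [Real.dist_eq, abs_of_pos (by linarith)]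
          have := hτ.2.trans (min_le_right _ _); linarith) ⟨hτ.1, hτ.2.trans (min_le_left _ _)⟩
        exact ⟨Ioo_subset_Icc_self this.1, Ioo_subset_Icc_self this.2⟩
  refine ⟨X, hX0, fun t htt => ⟨?_, hmem t htt⟩⟩
  have := hX t htt
  rwa [hc, clampBox_of_mem (hmem t htt)] at this

lemma hasDerivAt_fst_of_prod {X : ℝ → ℝ × ℝ} {X' : ℝ × ℝ} {t : ℝ} (h : HasDerivAt X X' t) :
    HasDerivAt (fun t => (X t).1) X'.1 t := h.fst

lemma hasDerivAt_snd_of_prod {X : ℝ → ℝ × ℝ} {X' : ℝ × ℝ} {t : ℝ} (h : HasDerivAt X X' t) :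
    HasDerivAt (fun t => (X t).2) X'.2 t := h.snd

/-- The first zero of a continuous function that changes sign. -/
theorem exists_first_zero {φ : ℝ → ℝ} {a b : ℝ} (hab : a ≤ b) (hφ : ContinuousOn φ (Icc a b))
    (ha : 0 < φ a) (hb : φ b ≤ 0) :
    ∃ t ∈ Ioc a b, φ t = 0 ∧ ∀ s ∈ Ico a t, 0 < φ s := by
  have hcl : IsCompact {s ∈ Icc a b | φ s ≤ 0} := by
    refine isCompact_Icc.of_isClosed_subset ?_ (sep_subset _ _)
    exact hφ.preimage_isClosed_of_isClosed isClosed_Icc isClosed_Iic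
  obtain ⟨t, ⟨htI, ht0⟩, htl⟩ := hcl.exists_isLeast ⟨b, right_mem_Icc.2 hab, hb⟩
  have hpos : ∀ s ∈ Ico a t, 0 < φ s := by
    intro s hs
    by_contra h
    exact absurd (htl ⟨⟨hs.1, hs.2.le.trans htI.2⟩, not_lt.1 h⟩) (not_le.2 hs.2)
  have hat : a < t := htI.1.lt_of_ne fun h => by subst h; linarith
  refine ⟨t, ⟨hat, htI.2⟩, le_antisymm ht0 ?_, hpos⟩
  have hne : (𝓝[Ico a t] t).NeBot := by
    rw [← mem_closure_iff_nhdsWithin_neBot, closure_Ico hat.ne]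
    exact right_mem_Icc.2 hat.le
  have := (hφ t htI).mono (s := Ico a t) fun σ hσ => ⟨hσ.1, hσ.2.le.trans htI.2⟩
  exact ge_of_tendsto this (eventually_mem_nhdsWithin.mono fun s hs => (hpos s hs).le)

/-- A function with nonpositive derivative inside an interval is antitone. -/
theorem antitoneOn_of_hasDerivAt_nonpos {D : Set ℝ} (hD : Convex ℝ D) {φ φ' : ℝ → ℝ}
    (hc : ContinuousOn φ D) (h : ∀ x ∈ interior D, HasDerivAt φ (φ' x) x)
    (h' : ∀ x ∈ interior D, φ' x ≤ 0) : AntitoneOn φ D :=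
  antitoneOn_of_deriv_nonpos hD hc (fun x hx => (h x hx).differentiableAt.differentiableWithinAt)
    fun x hx => by rw [(h x hx).deriv]; exact h' x hx

/-- A function with negative derivative inside an interval is strictly antitone. -/
theorem strictAntiOn_of_hasDerivAt_neg {D : Set ℝ} (hD : Convex ℝ D) {φ φ' : ℝ → ℝ}
    (hc : ContinuousOn φ D) (h : ∀ x ∈ interior D, HasDerivAt φ (φ' x) x)
    (h' : ∀ x ∈ interior D, φ' x < 0) : StrictAntiOn φ D :=
  strictAntiOn_of_deriv_neg hD hc fun x hx => by rw [(h x hx).deriv]; exact h' x hx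

/-! ### Damped oscillators on a half line unbounded to the left -/

/-- A Lyapunov function of the damped oscillator `x'' + a x' + k x = 0`. -/
def lyap (a k x y : ℝ) : ℝ := y ^ 2 + a * x * y + (k + a ^ 2 / 2) * x ^ 2

lemma sq_add_sq_le_lyap {a k : ℝ} (hk : 0 < k) (x y : ℝ) :
    x ^ 2 + y ^ 2 ≤ (2 + (1 + a ^ 2 / 2) / k) * lyap a k x y := by
  have h1 : lyap a k x y = (y + a * x / 2) ^ 2 + (k + a ^ 2 / 4) * x ^ 2 := by
    unfold lyap; ring
  have h2 : (1 + a ^ 2 / 2) / k * (k * x ^ 2) = (1 + a ^ 2 / 2) * x ^ 2 := by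
    field_simp
  have h3 : 0 ≤ (1 + a ^ 2 / 2) / k := by positivity
  have h4 : k * x ^ 2 ≤ lyap a k x y := by
    rw [h1]; nlinarith [sq_nonneg (y + a * x / 2), sq_nonneg (a * x)]
  have h5 := mul_le_mul_of_nonneg_left h4 h3
  have h6 : y ^ 2 ≤ 2 * (y + a * x / 2) ^ 2 + a ^ 2 / 2 * x ^ 2 := by
    nlinarith [sq_nonneg (y + a * x)]
  have h7 : 2 * (y + a * x / 2) ^ 2 ≤ 2 * lyap a k x y := by
    rw [h1]; nlinarith [sq_nonneg x, sq_nonneg (a * x)]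
  linarith

lemma lyap_le {a k : ℝ} (x y : ℝ) :
    lyap a k x y ≤ 3 / 2 * y ^ 2 + (k + a ^ 2) * x ^ 2 := by
  unfold lyap
  nlinarith [sq_nonneg (y - a * x)]

lemma lyap_nonneg {a k : ℝ} (hk : 0 < k) (x y : ℝ) : 0 ≤ lyap a k x y := by
  have h1 : lyap a k x y = (y + a * x / 2) ^ 2 + (k + a ^ 2 / 4) * x ^ 2 := by
    unfold lyap; ring
  rw [h1]; positivity

/-- Dissipation of the Lyapunov function under a small Lipschitz perturbation and a forcing. -/
lemma exists_lyap_dissipation {a k : ℝ} (ha : 0 < a) (hk : 0 < k) :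
    ∃ ε > 0, ∃ μ > 0, ∃ C > 0, ∀ x y g₁ g₂ : ℝ, |g₁| ≤ ε * |x| →
      -a * y ^ 2 - a * k * x ^ 2 + (2 * y + a * x) * (g₁ + g₂)
        ≤ -μ * lyap a k x y + C * g₂ ^ 2 := by
  -- Budget for the dissipated terms `a y²` and `a k x²`: a quarter of each absorbs `g₁`, a further
  -- quarter of each absorbs the products with `g₂`, and the remaining half dominates `μ * lyap`
  -- through `lyap_le`.
  refine ⟨min (a / 4) (a * k / (4 * (1 + a))), by positivity,
    min (a / 3) (a * k / (2 * (k + a ^ 2))), by positivity, 4 / a + a / k, by positivity, ?_⟩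
  intro x y g₁ g₂ hg
  set ε := min (a / 4) (a * k / (4 * (1 + a))) with hε
  set μ := min (a / 3) (a * k / (2 * (k + a ^ 2))) with hμ
  have hε0 : 0 < ε := by positivity
  have hμ0 : 0 < μ := by positivity
  have e1 : ε ≤ a / 4 := min_le_left _ _
  have e2 : ε * (1 + a) ≤ a * k / 4 := by
    have : ε ≤ a * k / (4 * (1 + a)) := min_le_right _ _
    rw [le_div_iff₀ (by positivity)] at this; linarith
  have m1 : μ ≤ a / 3 := min_le_left _ _
  have m2 : μ * (k + a ^ 2) ≤ a * k / 2 := by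
    have : μ ≤ a * k / (2 * (k + a ^ 2)) := min_le_right _ _
    rw [le_div_iff₀ (by positivity)] at this; linarith
  have t1 : (2 * y + a * x) * g₁ ≤ ε * (y ^ 2 + (1 + a) * x ^ 2) := by
    calc (2 * y + a * x) * g₁ ≤ |(2 * y + a * x) * g₁| := le_abs_self _
      _ = |2 * y + a * x| * |g₁| := abs_mul _ _
      _ ≤ (2 * |y| + a * |x|) * (ε * |x|) := by
          gcongr
          calc |2 * y + a * x| ≤ |2 * y| + |a * x| := abs_add_le _ _
            _ = _ := by rw [abs_mul, abs_mul, abs_of_pos ha, abs_two]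
      _ ≤ ε * (y ^ 2 + (1 + a) * x ^ 2) := by
          rw [← sq_abs y, ← sq_abs x]
          nlinarith [mul_nonneg hε0.le (sq_nonneg (|y| - |x|))]
  have t2 : 2 * y * g₂ ≤ a / 4 * y ^ 2 + 4 / a * g₂ ^ 2 := by
    have : a / 4 * y ^ 2 + 4 / a * g₂ ^ 2 - 2 * y * g₂ = (a * y - 4 * g₂) ^ 2 / (4 * a) := by
      field_simp; ring
    have h : 0 ≤ (a * y - 4 * g₂) ^ 2 / (4 * a) := by positivity
    linarith
  have t3 : a * x * g₂ ≤ a * k / 4 * x ^ 2 + a / k * g₂ ^ 2 := by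
    have : a * k / 4 * x ^ 2 + a / k * g₂ ^ 2 - a * x * g₂
        = a * (k * x - 2 * g₂) ^ 2 / (4 * k) := by
      field_simp; ring
    have h : 0 ≤ a * (k * x - 2 * g₂) ^ 2 / (4 * k) := by positivity
    linarith
  have t4 := mul_le_mul_of_nonneg_left (lyap_le (a := a) (k := k) x y) hμ0.le
  have y2 := sq_nonneg y
  have x2 := sq_nonneg x
  nlinarith [mul_le_mul_of_nonneg_right e1 y2, mul_le_mul_of_nonneg_right e2 x2,
    mul_le_mul_of_nonneg_right m1 y2, mul_le_mul_of_nonneg_right m2 x2]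

/-- The plain energy dissipates only `y²`; the cross term `a x y` adds dissipation of `x²`, and the
coefficient `k + a² / 2` is the one that cancels all mixed products. -/
lemma hasDerivAt_lyap {a k : ℝ} {x y : ℝ → ℝ} {t g : ℝ} (hx : HasDerivAt x (y t) t)
    (hy : HasDerivAt y (-a * y t - k * x t + g) t) :
    HasDerivAt (fun t => lyap a k (x t) (y t))
      (-a * y t ^ 2 - a * k * x t ^ 2 + (2 * y t + a * x t) * g) t := by
  unfold lyap
  refine (((hy.pow 2).add ((hx.const_mul a).mul hy)).add
    ((hx.pow 2).const_mul (k + a ^ 2 / 2))).congr_deriv ?_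
  push_cast
  ring

/-- Gronwall's argument with the particular solution `C / (μ + 4) * exp (4 t)` subtracted. The
exponent 4 is that of the square of a forcing of size `exp (2 t)`. -/
lemma exp_decay_of_deriv_le {Q Q' : ℝ → ℝ} {μ C t₀ t₁ : ℝ} (hμ : 0 < μ) (hC : 0 ≤ C)
    (hc : ContinuousOn Q (Icc t₀ t₁)) (hd : ∀ t ∈ Ioo t₀ t₁, HasDerivAt Q (Q' t) t)
    (h : ∀ t ∈ Ioo t₀ t₁, Q' t ≤ -μ * Q t + C * Real.exp (4 * t)) :
    ∀ t ∈ Icc t₀ t₁,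
      Q t ≤ Real.exp (-μ * (t - t₀)) * Q t₀ + C / (μ + 4) * Real.exp (4 * t) := by
  intro t ht
  have hanti := antitoneOn_of_hasDerivAt_nonpos (convex_Icc t₀ t₁)
    (φ := fun t => Real.exp (μ * t) * (Q t - C / (μ + 4) * Real.exp (4 * t)))
    (φ' := fun t => Real.exp (μ * t) * (μ * Q t + Q' t - C * Real.exp (4 * t)))
    (by fun_prop)
    (by
      intro x hx
      rw [interior_Icc] at hx
      have h1 : HasDerivAt (fun t => Real.exp (μ * t)) (Real.exp (μ * x) * μ) x := by
        simpa using ((hasDerivAt_id x).const_mul μ).exp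
      have h2 : HasDerivAt (fun t => Real.exp (4 * t)) (Real.exp (4 * x) * 4) x := by
        simpa using ((hasDerivAt_id x).const_mul (4 : ℝ)).exp
      refine (h1.mul ((hd x hx).sub (h2.const_mul (C / (μ + 4))))).congr_deriv ?_
      have : μ + 4 ≠ 0 := by positivity
      simp only [Pi.sub_apply]
      field_simp
      ring)
    (by
      intro x hx
      rw [interior_Icc] at hx
      have := h x hx
      exact mul_nonpos_of_nonneg_of_nonpos (Real.exp_pos _).le (by linarith))
  have h0 := hanti (left_mem_Icc.2 (ht.1.trans ht.2)) ht ht.1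
  simp only at h0
  have e1 : Real.exp (-μ * (t - t₀)) = Real.exp (μ * t₀) * Real.exp (-(μ * t)) := by
    rw [← Real.exp_add]; ring_nf
  have e2 : Real.exp (μ * t) * Real.exp (-(μ * t)) = 1 := by
    rw [← Real.exp_add]; simp
  have h1 := mul_le_mul_of_nonneg_right h0 (Real.exp_pos (-(μ * t))).le
  have e3 : 0 ≤ Real.exp (μ * t₀) * (C / (μ + 4) * Real.exp (4 * t₀)) * Real.exp (-(μ * t)) := by
    positivity
  rw [e1]
  have e4 : Real.exp (μ * t) * (Q t - C / (μ + 4) * Real.exp (4 * t)) * Real.exp (-(μ * t))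
      = Q t - C / (μ + 4) * Real.exp (4 * t) := by
    rw [mul_right_comm, e2, one_mul]
  rw [e4] at h1
  linarith

/-- A perturbed damped oscillator has no nontrivial solution that is bounded near `-∞`. -/
theorem eq_zero_of_bounded_oscillator {a k ε μ C M T : ℝ} {x y g : ℝ → ℝ} (hk : 0 < k)
    (hμ : 0 < μ)
    (hdis : ∀ x y g₁ g₂ : ℝ, |g₁| ≤ ε * |x| →
      -a * y ^ 2 - a * k * x ^ 2 + (2 * y + a * x) * (g₁ + g₂)
        ≤ -μ * lyap a k x y + C * g₂ ^ 2)
    (hx : ∀ t < T, HasDerivAt x (y t) t)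
    (hy : ∀ t < T, HasDerivAt y (-a * y t - k * x t + g t) t)
    (hg : ∀ t < T, |g t| ≤ ε * |x t|) (hM : ∀ t < T, |x t| ≤ M) :
    ∀ t < T, x t = 0 := by
  intro t ht
  -- Only `x` is assumed bounded. The mean value theorem bounds `y` at one time in each unit
  -- interval, which is enough to start the decay of the Lyapunov function arbitrarily early.
  have hbd : ∀ n : ℕ, ∃ τ ∈ Ioo (t - n - 1) (t - n), |y τ| ≤ 2 * M := by
    intro n
    have hn : (0 : ℝ) ≤ n := n.cast_nonneg
    obtain ⟨τ, hτ, h⟩ := exists_hasDerivAt_eq_slope x y (a := t - n - 1) (b := t - n) (by linarith)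
      (fun s hs => (hx s (by linarith [hs.2])).continuousAt.continuousWithinAt)
      (fun s hs => hx s (by linarith [hs.2]))
    refine ⟨τ, hτ, ?_⟩
    rw [h, show t - (n : ℝ) - (t - n - 1) = 1 by ring, div_one]
    calc |x (t - n) - x (t - n - 1)| ≤ |x (t - n)| + |x (t - n - 1)| := abs_sub _ _
      _ ≤ 2 * M := by
        have := hM (t - n) (by linarith); have := hM (t - n - 1) (by linarith); linarith
  have hM0 : 0 ≤ M := (abs_nonneg _).trans (hM t ht)
  have hQ : ∀ n : ℕ, lyap a k (x t) (y t)
      ≤ Real.exp (-μ * n) * (3 / 2 * (2 * M) ^ 2 + (k + a ^ 2) * M ^ 2) := by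
    intro n
    have hn : (0 : ℝ) ≤ n := n.cast_nonneg
    obtain ⟨τ, hτ, h⟩ := hbd n
    have hd : ∀ s < T, HasDerivAt (fun t => lyap a k (x t) (y t))
      (-a * y s ^ 2 - a * k * x s ^ 2 + (2 * y s + a * x s) * g s) s :=
      fun s hs => hasDerivAt_lyap (hx s hs) (hy s hs)
    have := exp_decay_of_deriv_le (t₀ := τ) (t₁ := t) hμ le_rfl
      (fun s hs => (hd s (by linarith [hs.2])).continuousAt.continuousWithinAt)
      (fun s hs => hd s (by linarith [hs.2]))
      (fun s hs => by
        have := hdis (x s) (y s) (g s) 0 (hg s (by linarith [hs.2]))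
        simpa using this) t (right_mem_Icc.2 (by linarith [hτ.2]))
    simp only [zero_div, zero_mul, add_zero] at this
    refine this.trans ?_
    have h1 : lyap a k (x τ) (y τ) ≤ 3 / 2 * (2 * M) ^ 2 + (k + a ^ 2) * M ^ 2 := by
      refine (lyap_le _ _).trans ?_
      rw [← sq_abs (y τ), ← sq_abs (x τ)]
      have := hM τ (by linarith [hτ.2])
      gcongr
    have h2 : Real.exp (-μ * (t - τ)) ≤ Real.exp (-μ * n) := by
      apply Real.exp_le_exp.2
      nlinarith [hτ.2]
    exact mul_le_mul h2 h1 (lyap_nonneg hk _ _) (Real.exp_pos _).le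
  have hlim : Tendsto (fun n : ℕ => Real.exp (-μ * n) *
      (3 / 2 * (2 * M) ^ 2 + (k + a ^ 2) * M ^ 2)) atTop (𝓝 0) := by
    have h1 : Tendsto (fun n : ℕ => -μ * (n : ℝ)) atTop atBot :=
      tendsto_natCast_atTop_atTop.const_mul_atTop_of_neg (by linarith)
    simpa using (Real.tendsto_exp_atBot.comp h1).mul_const
      (3 / 2 * (2 * M) ^ 2 + (k + a ^ 2) * M ^ 2)
  have h0 : lyap a k (x t) (y t) ≤ 0 := ge_of_tendsto' hlim hQ
  have h1 := sq_add_sq_le_lyap (a := a) hk (x t) (y t)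
  have h2 : 0 ≤ 2 + (1 + a ^ 2 / 2) / k := by positivity
  have h3 := mul_nonpos_of_nonneg_of_nonpos h2 h0
  have h4 : x t ^ 2 ≤ 0 := by nlinarith [sq_nonneg (y t)]
  exact pow_eq_zero_iff two_ne_zero |>.1 (le_antisymm h4 (sq_nonneg _))

/-- The vector field of the perturbed damped oscillator. -/
def oscField (a k : ℝ) (g : ℝ → ℝ → ℝ) (t : ℝ) (X : ℝ × ℝ) : ℝ × ℝ :=
  (X.2, -a * X.2 - k * X.1 + g t X.1)

lemma lipschitzOnWith_oscField {a k ε δ : ℝ} {g : ℝ → ℝ → ℝ} {t : ℝ} (ha : 0 < a) (hk : 0 < k)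
    (hε : 0 < ε)
    (hg : ∀ x ∈ Icc (-δ) δ, ∀ y ∈ Icc (-δ) δ, |g t x - g t y| ≤ ε * |x - y|) :
    LipschitzOnWith (1 + a + k + ε).toNNReal (oscField a k g t)
      (Icc (-δ) δ ×ˢ Icc (-δ) δ) := by
  refine LipschitzOnWith.of_dist_le_mul fun X hX Y hY => ?_
  rw [Real.coe_toNNReal _ (by positivity)]
  have h1 : |X.1 - Y.1| ≤ dist X Y := by
    rw [← Real.dist_eq, Prod.dist_eq]; exact le_max_left _ _
  have h2 : |X.2 - Y.2| ≤ dist X Y := by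
    rw [← Real.dist_eq X.2, Prod.dist_eq]; exact le_max_right _ _
  have hD : 0 ≤ dist X Y := dist_nonneg
  rw [Prod.dist_eq (x := oscField a k g t X)]
  refine max_le ?_ ?_
  · simp only [oscField, Real.dist_eq]
    nlinarith
  · simp only [oscField, Real.dist_eq]
    have h3 := (hg X.1 hX.1 Y.1 hY.1).trans (mul_le_mul_of_nonneg_left h1 hε.le)
    calc |-a * X.2 - k * X.1 + g t X.1 - (-a * Y.2 - k * Y.1 + g t Y.1)|
        = |-a * (X.2 - Y.2) + -k * (X.1 - Y.1) + (g t X.1 - g t Y.1)| := by ring_nf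
      _ ≤ |-a * (X.2 - Y.2)| + |-k * (X.1 - Y.1)| + |g t X.1 - g t Y.1| := abs_add_three _ _ _
      _ ≤ a * dist X Y + k * dist X Y + ε * dist X Y := by
          rw [abs_mul, abs_mul, abs_neg, abs_neg, abs_of_pos ha, abs_of_pos hk]
          gcongr
      _ ≤ (1 + a + k + ε) * dist X Y := by nlinarith

/-! ### Bounded solutions of the forced oscillator on a left half line -/

section existence

variable {a k ε μ C δ T C₀ : ℝ} {g : ℝ → ℝ → ℝ}

/-- Solutions of the perturbed oscillator that start at rest. -/
lemma exists_oscillator_from_rest (ha : 0 < a) (hk : 0 < k) (hε : 0 < ε)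
    (hμ : 0 < μ) (hC : 0 < C)
    (hdis : ∀ x y g₁ g₂ : ℝ, |g₁| ≤ ε * |x| →
      -a * y ^ 2 - a * k * x ^ 2 + (2 * y + a * x) * (g₁ + g₂)
        ≤ -μ * lyap a k x y + C * g₂ ^ 2)
    (hδ : 0 < δ)
    (hg : ∀ t ≤ T, ∀ x ∈ Icc (-δ) δ, ∀ y ∈ Icc (-δ) δ, |g t x - g t y| ≤ ε * |x - y|)
    (hg0 : ∀ t ≤ T, |g t 0| ≤ C₀ * Real.exp (2 * t))
    (hgc : ContinuousOn (Function.uncurry g) (Iic T ×ˢ Icc (-δ) δ))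
    (hT : (2 + (1 + a ^ 2 / 2) / k) * (C * C₀ ^ 2 / (μ + 4)) * Real.exp (4 * T) < δ ^ 2)
    {t₀ : ℝ} (ht₀ : t₀ ≤ T) :
    ∃ X : ℝ → ℝ × ℝ, X t₀ = 0 ∧
      ∀ t ∈ Icc t₀ T, HasDerivWithinAt X (oscField a k g t (X t)) (Icc t₀ T) t ∧
        X t ∈ Icc (-δ) δ ×ˢ Icc (-δ) δ ∧
        (X t).1 ^ 2 + (X t).2 ^ 2 ≤
          (2 + (1 + a ^ 2 / 2) / k) * (C * C₀ ^ 2 / (μ + 4)) * Real.exp (4 * t) := by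
  -- Split `g t x` into `g t x - g t 0`, a small Lipschitz perturbation, and the forcing `g t 0`.
  -- The Lyapunov function vanishes at `t₀`, so the bound does not depend on `t₀`.
  have hbound : ∀ τ ∈ Icc t₀ T, ∀ X : ℝ → ℝ × ℝ, X t₀ = 0 →
      (∀ t ∈ Icc t₀ τ, HasDerivWithinAt X (oscField a k g t (X t)) (Icc t₀ τ) t) →
      (∀ t ∈ Icc t₀ τ, X t ∈ Icc (-δ) δ ×ˢ Icc (-δ) δ) →
      (X τ).1 ^ 2 + (X τ).2 ^ 2 ≤
          (2 + (1 + a ^ 2 / 2) / k) * (C * C₀ ^ 2 / (μ + 4)) * Real.exp (4 * τ) := by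
    intro τ hτ X hX0 hX hXm
    have hXc : ContinuousOn X (Icc t₀ τ) := fun t ht => (hX t ht).continuousWithinAt
    have hXd : ∀ t ∈ Ioo t₀ τ, HasDerivAt X (oscField a k g t (X t)) t := fun t ht =>
      (hX t (Ioo_subset_Icc_self ht)).hasDerivAt (Icc_mem_nhds ht.1 ht.2)
    have h := exp_decay_of_deriv_le (Q := fun t => lyap a k (X t).1 (X t).2)
      (Q' := fun t => -a * (X t).2 ^ 2 - a * k * (X t).1 ^ 2
        + (2 * (X t).2 + a * (X t).1) * g t (X t).1)
      (μ := μ) (C := C * C₀ ^ 2) (t₀ := t₀) (t₁ := τ) hμ (by positivity)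
      (by unfold lyap; fun_prop)
      (fun t ht => hasDerivAt_lyap (x := fun t => (X t).1) (y := fun t => (X t).2)
        (hasDerivAt_fst_of_prod (hXd t ht)) (hasDerivAt_snd_of_prod (hXd t ht)))
      (by
        intro t ht
        have htT : t ≤ T := ht.2.le.trans hτ.2
        have h1 := hdis (X t).1 (X t).2 (g t (X t).1 - g t 0) (g t 0) (by
          simpa using hg t htT _ (hXm t (Ioo_subset_Icc_self ht)).1 0 ⟨by linarith, hδ.le⟩)
        rw [sub_add_cancel] at h1
        refine h1.trans ?_
        have h2 : g t 0 ^ 2 ≤ C₀ ^ 2 * Real.exp (4 * t) := by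
          have h3 : Real.exp (4 * t) = Real.exp (2 * t) ^ 2 := by
            rw [← Real.exp_nat_mul]; push_cast; ring_nf
          rw [← sq_abs (g t 0), h3, ← mul_pow]
          have := hg0 t htT
          gcongr
        have := mul_le_mul_of_nonneg_left h2 hC.le
        linarith) τ (right_mem_Icc.2 hτ.1)
    have h0 : lyap a k (X t₀).1 (X t₀).2 = 0 := by rw [hX0]; simp [lyap]
    simp only [h0, mul_zero, zero_add] at h
    refine (sq_add_sq_le_lyap (a := a) hk _ _).trans ?_
    rw [mul_assoc]
    exact mul_le_mul_of_nonneg_left h (by positivity)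
  have hsmall : ∀ τ ≤ T, ∀ x y : ℝ, x ^ 2 + y ^ 2 ≤
      (2 + (1 + a ^ 2 / 2) / k) * (C * C₀ ^ 2 / (μ + 4)) * Real.exp (4 * τ) →
      x ∈ Ioo (-δ) δ ∧ y ∈ Ioo (-δ) δ := by
    intro τ hτ x y hxy
    have h1 : x ^ 2 + y ^ 2 < δ ^ 2 := by
      refine lt_of_le_of_lt (hxy.trans ?_) hT
      gcongr
    exact ⟨abs_lt.1 (abs_lt_of_sq_lt_sq (by nlinarith [sq_nonneg y]) hδ.le),
      abs_lt.1 (abs_lt_of_sq_lt_sq (by nlinarith [sq_nonneg x]) hδ.le)⟩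
  obtain ⟨X, hX0, hX⟩ := exists_solution_mem_box (f := oscField a k g) (x₀ := 0) ht₀
    (fun t ht => lipschitzOnWith_oscField ha hk hε (hg t ht.2))
    (by
      have hg' : ContinuousOn (fun q : ℝ × ℝ × ℝ => g q.1 q.2.1)
          (Icc t₀ T ×ˢ (Icc (-δ) δ ×ˢ Icc (-δ) δ)) :=
        hgc.comp (f := fun q : ℝ × ℝ × ℝ => (q.1, q.2.1)) (by fun_prop)
          fun q hq => ⟨hq.1.2, hq.2.1⟩
      have h2 : Continuous fun q : ℝ × ℝ × ℝ => q.2.2 := by fun_prop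
      have h3 : Continuous fun q : ℝ × ℝ × ℝ => -a * q.2.2 - k * q.2.1 := by fun_prop
      exact h2.continuousOn.prodMk (h3.continuousOn.add hg'))
    ⟨⟨by simpa using hδ.le, hδ.le⟩, ⟨by simpa using hδ.le, hδ.le⟩⟩
    (fun τ hτ X h0 hX hXm => hsmall τ hτ.2 _ _ (hbound τ hτ X h0 hX hXm))
  refine ⟨X, hX0, fun t ht => ⟨(hX t ht).1, (hX t ht).2, ?_⟩⟩
  have hsub : Icc t₀ t ⊆ Icc t₀ T := Icc_subset_Icc_right ht.2
  exact hbound t ht X hX0 (fun s hs => (hX s (hsub hs)).1.mono hsub)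
    fun s hs => (hX s (hsub hs)).2

/-- The forced oscillator has a solution on a left half line that decays at `-∞`. -/
theorem exists_decaying_oscillator (ha : 0 < a) (hk : 0 < k) (hε : 0 < ε)
    (hμ : 0 < μ) (hC : 0 < C)
    (hdis : ∀ x y g₁ g₂ : ℝ, |g₁| ≤ ε * |x| →
      -a * y ^ 2 - a * k * x ^ 2 + (2 * y + a * x) * (g₁ + g₂)
        ≤ -μ * lyap a k x y + C * g₂ ^ 2)
    (hδ : 0 < δ)
    (hg : ∀ t ≤ T, ∀ x ∈ Icc (-δ) δ, ∀ y ∈ Icc (-δ) δ, |g t x - g t y| ≤ ε * |x - y|)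
    (hg0 : ∀ t ≤ T, |g t 0| ≤ C₀ * Real.exp (2 * t))
    (hgc : ContinuousOn (Function.uncurry g) (Iic T ×ˢ Icc (-δ) δ))
    (hT : (2 + (1 + a ^ 2 / 2) / k) * (C * C₀ ^ 2 / (μ + 4)) * Real.exp (4 * T) < δ ^ 2) :
    ∃ x y : ℝ → ℝ, ∀ t < T, HasDerivAt x (y t) t ∧
      HasDerivAt y (-a * y t - k * x t + g t (x t)) t ∧ x t ∈ Icc (-δ) δ ∧
      x t ^ 2 + y t ^ 2 ≤
        (2 + (1 + a ^ 2 / 2) / k) * (C * C₀ ^ 2 / (μ + 4)) * Real.exp (4 * t) := by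
  -- The solution sought is the limit of the solutions `X n` that start at rest at time `T - n`.
  have hex := fun n : ℕ => exists_oscillator_from_rest ha hk hε hμ hC hdis hδ hg hg0 hgc hT
    (t₀ := T - n) (by linarith [(Nat.cast_nonneg n : (0 : ℝ) ≤ n)])
  choose X hX0 hX using hex
  set D : ℝ := (2 + (1 + a ^ 2 / 2) / k) * (3 / 2 * (2 * δ) ^ 2 + (k + a ^ 2) * (2 * δ) ^ 2)
    with hD
  have hD0 : 0 < D := by positivity
  -- The forcing cancels in the difference of two such solutions, so its Lyapunov function, bounded
  -- at `T - n` by the size of the box, decays from there on. This gives a Cauchy estimate uniform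
  -- on intervals bounded below.
  have hdiff : ∀ n m : ℕ, n ≤ m → ∀ t ∈ Icc (T - n) T,
      dist (X n t) (X m t) ≤ √(D * Real.exp (-μ * (t - (T - n)))) := by
    intro n m hnm t ht
    have hnm' : (n : ℝ) ≤ m := Nat.cast_le.2 hnm
    have hsub : Icc (T - n) T ⊆ Icc (T - m) T := Icc_subset_Icc_left (by linarith)
    have hcn : ContinuousOn (X n) (Icc (T - n) T) :=
      fun t ht => (hX n t ht).1.continuousWithinAt
    have hcm : ContinuousOn (X m) (Icc (T - n) T) :=
      fun t ht => ((hX m t (hsub ht)).1.mono hsub).continuousWithinAt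
    have hdn : ∀ t ∈ Ioo (T - n) T, HasDerivAt (X n) (oscField a k g t (X n t)) t := fun t ht =>
      (hX n t (Ioo_subset_Icc_self ht)).1.hasDerivAt (Icc_mem_nhds ht.1 ht.2)
    have hdm : ∀ t ∈ Ioo (T - n) T, HasDerivAt (X m) (oscField a k g t (X m t)) t := fun t ht =>
      ((hX m t (hsub (Ioo_subset_Icc_self ht))).1.mono hsub).hasDerivAt (Icc_mem_nhds ht.1 ht.2)
    have h := exp_decay_of_deriv_le
      (Q := fun t => lyap a k ((X n t).1 - (X m t).1) ((X n t).2 - (X m t).2))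
      (Q' := fun t => -a * ((X n t).2 - (X m t).2) ^ 2 - a * k * ((X n t).1 - (X m t).1) ^ 2
        + (2 * ((X n t).2 - (X m t).2) + a * ((X n t).1 - (X m t).1))
          * (g t (X n t).1 - g t (X m t).1))
      (μ := μ) (C := 0) (t₀ := T - n) (t₁ := T) hμ le_rfl
      (by unfold lyap; fun_prop)
      (fun t ht => hasDerivAt_lyap (x := fun t => (X n t).1 - (X m t).1)
        (y := fun t => (X n t).2 - (X m t).2)
        ((hasDerivAt_fst_of_prod (hdn t ht)).sub (hasDerivAt_fst_of_prod (hdm t ht)))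
        (((hasDerivAt_snd_of_prod (hdn t ht)).sub (hasDerivAt_snd_of_prod (hdm t ht))).congr_deriv
          (by simp only [oscField]; ring)))
      (by
        intro t ht
        have ht' := Ioo_subset_Icc_self ht
        have h1 := hdis ((X n t).1 - (X m t).1) ((X n t).2 - (X m t).2)
          (g t (X n t).1 - g t (X m t).1) 0
          (hg t ht.2.le _ (hX n t ht').2.1.1 _ (hX m t (hsub ht')).2.1.1)
        simpa using h1) t ht
    simp only [zero_div, zero_mul, add_zero] at h
    have hn0 : (T - n) ∈ Icc (T - n) T :=
      left_mem_Icc.2 (by linarith [(Nat.cast_nonneg n : (0 : ℝ) ≤ n)])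
    have hb : ∀ p q : ℝ, p ∈ Icc (-δ) δ → q ∈ Icc (-δ) δ → (p - q) ^ 2 ≤ (2 * δ) ^ 2 := by
      intro p q hp hq
      exact sq_le_sq' (by linarith [hp.1, hq.2]) (by linarith [hp.2, hq.1])
    have h0 : lyap a k ((X n (T - n)).1 - (X m (T - n)).1) ((X n (T - n)).2 - (X m (T - n)).2)
        ≤ 3 / 2 * (2 * δ) ^ 2 + (k + a ^ 2) * (2 * δ) ^ 2 := by
      refine (lyap_le _ _).trans ?_
      have h1 := hb _ _ (hX n _ hn0).2.1.1 (hX m _ (hsub hn0)).2.1.1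
      have h2 := hb _ _ (hX n _ hn0).2.1.2 (hX m _ (hsub hn0)).2.1.2
      gcongr
    have h1 := sq_add_sq_le_lyap (a := a) hk ((X n t).1 - (X m t).1) ((X n t).2 - (X m t).2)
    have h2 : ((X n t).1 - (X m t).1) ^ 2 + ((X n t).2 - (X m t).2) ^ 2
        ≤ D * Real.exp (-μ * (t - (T - n))) := by
      refine h1.trans ?_
      rw [hD, mul_assoc]
      refine mul_le_mul_of_nonneg_left (h.trans ?_) (by positivity)
      rw [mul_comm]
      exact mul_le_mul_of_nonneg_right h0 (Real.exp_pos _).le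
    rw [Prod.dist_eq, Real.dist_eq, Real.dist_eq]
    refine max_le (Real.abs_le_sqrt ?_) (Real.abs_le_sqrt ?_)
    · nlinarith [sq_nonneg ((X n t).2 - (X m t).2)]
    · nlinarith [sq_nonneg ((X n t).1 - (X m t).1)]
  have hrate : ∀ b : ℝ, Tendsto (fun n : ℕ => √(D * Real.exp (-μ * (b - (T - n))))) atTop
      (𝓝 0) := by
    intro b
    have h1 : Tendsto (fun n : ℕ => -μ * (b - (T - (n : ℝ)))) atTop atBot := by
      refine Tendsto.const_mul_atTop_of_neg (by linarith) ?_
      have : (fun n : ℕ => b - (T - (n : ℝ))) = fun n : ℕ => (n : ℝ) + (b - T) := by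
        ext n; ring
      rw [this]
      exact tendsto_atTop_add_const_right _ _ tendsto_natCast_atTop_atTop
    have h2 := ((Real.tendsto_exp_atBot.comp h1).const_mul D).sqrt
    simpa using h2
  -- The value for `t ≥ T` is arbitrary; it only makes the limit a total function.
  have hlim : ∀ t, ∃ Y : ℝ × ℝ, t < T → Tendsto (fun n => X n t) atTop (𝓝 Y) := by
    intro t
    by_cases ht : t < T
    · obtain ⟨n₀, hn₀⟩ := exists_nat_ge (T - t)
      have hcau : CauchySeq (fun n => X (n + n₀) t) := by
        refine cauchySeq_of_le_tendsto_0'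
          (fun n : ℕ => √(D * Real.exp (-μ * (t - (T - ((n + n₀ : ℕ) : ℝ)))))) ?_
          ((hrate t).comp (tendsto_add_atTop_nat n₀))
        intro n m hnm
        refine hdiff _ _ (by omega) t ⟨?_, ht.le⟩
        push_cast
        linarith [(Nat.cast_nonneg n : (0 : ℝ) ≤ n)]
      obtain ⟨Y, hY⟩ := cauchySeq_tendsto_of_complete hcau
      exact ⟨Y, fun _ => (tendsto_add_atTop_iff_nat n₀).1 hY⟩
    · exact ⟨0, fun h => absurd h ht⟩
  choose Y hY using hlim
  have hev : ∀ t < T, ∀ᶠ n : ℕ in atTop, t ∈ Icc (T - n) T := by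
    intro t ht
    obtain ⟨n₀, hn₀⟩ := exists_nat_ge (T - t)
    filter_upwards [eventually_ge_atTop n₀] with n hn
    have : (n₀ : ℝ) ≤ n := Nat.cast_le.2 hn
    exact ⟨by linarith, ht.le⟩
  have hYm : ∀ t < T, Y t ∈ Icc (-δ) δ ×ˢ Icc (-δ) δ := fun t ht =>
    (isClosed_Icc.prod isClosed_Icc).mem_of_tendsto (hY t ht)
      ((hev t ht).mono fun n hn => (hX n t hn).2.1)
  have hYd : ∀ n : ℕ, ∀ t ∈ Ico (T - n) T,
      dist (X n t) (Y t) ≤ √(D * Real.exp (-μ * (t - (T - n)))) := by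
    intro n t ht
    refine le_of_tendsto (tendsto_const_nhds.dist (hY t ht.2)) ?_
    filter_upwards [eventually_ge_atTop n] with m hm
    exact hdiff n m hm t ⟨ht.1, ht.2.le⟩
  have hYder : ∀ t < T, HasDerivAt Y (oscField a k g t (Y t)) t := by
    intro t ht
    obtain ⟨b, hb⟩ := exists_lt t
    refine hasDerivAt_of_tendstoUniformlyOn (s := Ioo b T) isOpen_Ioo (l := atTop)
      (f := X) (f' := fun n s => oscField a k g s (X n s))
      (g' := fun s => oscField a k g s (Y s)) ?_ ?_ (fun s hs => hY s hs.2) ⟨hb, ht⟩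
    · rw [Metric.tendstoUniformlyOn_iff]
      intro e he
      have h1 := (hrate b).const_mul (1 + a + k + ε)
      rw [mul_zero] at h1
      filter_upwards [h1.eventually (gt_mem_nhds he), hev b (hb.trans ht)] with n hn hbn s hs
      have hs' : s ∈ Ico (T - n) T := ⟨hbn.1.trans hs.1.le, hs.2⟩
      have h2 := (lipschitzOnWith_oscField ha hk hε (hg s hs.2.le)).dist_le_mul _
        (hYm s hs.2) _ (hX n s (Ico_subset_Icc_self hs')).2.1
      rw [Real.coe_toNNReal _ (by positivity)] at h2
      refine lt_of_le_of_lt h2 (lt_of_le_of_lt ?_ hn)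
      refine mul_le_mul_of_nonneg_left ?_ (by positivity)
      rw [dist_comm]
      refine (hYd n s hs').trans (Real.sqrt_le_sqrt ?_)
      refine mul_le_mul_of_nonneg_left (Real.exp_le_exp.2 ?_) hD0.le
      nlinarith [hs.1]
    · filter_upwards [hev b (hb.trans ht)] with n hbn s hs
      have hs' : s ∈ Ioo (T - n) T := ⟨hbn.1.trans_lt hs.1, hs.2⟩
      exact (hX n s (Ioo_subset_Icc_self hs')).1.hasDerivAt (Icc_mem_nhds hs'.1 hs'.2)
  refine ⟨fun t => (Y t).1, fun t => (Y t).2, fun t ht =>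
    ⟨hasDerivAt_fst_of_prod (hYder t ht), hasDerivAt_snd_of_prod (hYder t ht), (hYm t ht).1, ?_⟩⟩
  have hc := ((continuous_fst.tendsto (Y t)).comp (hY t ht)).pow 2 |>.add
    (((continuous_snd.tendsto (Y t)).comp (hY t ht)).pow 2)
  exact le_of_tendsto hc ((hev t ht).mono fun n hn => (hX n t hn).2.2)

end existence

/-! ### Consequences of supercriticality for the parameters -/

section parameters

variable {N : ℕ} {p : ℝ}

lemma one_lt_of_pS_lt (hN : 3 ≤ N) (hp : pS N < p) : 1 < p := by
  have hN' : (3 : ℝ) ≤ N := by exact_mod_cast hN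
  refine lt_trans ?_ hp
  rw [pS, lt_div_iff₀ (by linarith)]
  linarith

lemma theta_pos (hp : 1 < p) : 0 < theta p := div_pos two_pos (by linarith)

lemma theta_mul_sub_one (hp : 1 < p) : theta p * (p - 1) = 2 :=
  div_mul_cancel₀ _ (by linarith)

/-- The inequality `θ < (N - 2) / 2` is a restatement of `p > pS N`. It supplies the damping in
Emden–Fowler variables and, later, the square integrability of the gradient. -/
lemma damping_pos (hN : 3 ≤ N) (hp : pS N < p) : 0 < (N : ℝ) - 2 - 2 * theta p := by
  have hN' : (3 : ℝ) ≤ N := by exact_mod_cast hN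
  have h1 := one_lt_of_pS_lt hN hp
  rw [pS, div_lt_iff₀ (by linarith)] at hp
  have h2 : theta p < ((N : ℝ) - 2) / 2 := by
    rw [theta, div_lt_div_iff₀ (by linarith) two_pos]
    nlinarith
  linarith

lemma sub_theta_pos (hN : 3 ≤ N) (hp : pS N < p) : 0 < (N : ℝ) - 2 - theta p := by
  have := damping_pos hN hp
  have := theta_pos (one_lt_of_pS_lt hN hp)
  linarith

/-- This spring constant is `p * A ^ (p - 1) - θ (N - 2 - θ)`, the linearization at the equilibrium
`A`. -/
lemma stiffness_pos (hN : 3 ≤ N) (hp : pS N < p) :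
    0 < (p - 1) * (theta p * ((N : ℝ) - 2 - theta p)) :=
  mul_pos (by linarith [one_lt_of_pS_lt hN hp])
    (mul_pos (theta_pos (one_lt_of_pS_lt hN hp)) (sub_theta_pos hN hp))

lemma ampl_pos (hN : 3 ≤ N) (hp : pS N < p) : 0 < ampl p N :=
  Real.rpow_pos_of_pos
    (mul_pos (theta_pos (one_lt_of_pS_lt hN hp)) (sub_theta_pos hN hp)) _

/-- This is the condition for `A s ^ (-θ)` to solve the equation with the linear term removed. -/
lemma ampl_rpow_sub_one (hN : 3 ≤ N) (hp : pS N < p) :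
    ampl p N ^ (p - 1) = theta p * ((N : ℝ) - 2 - theta p) := by
  have h1 := one_lt_of_pS_lt hN hp
  have h2 := mul_pos (theta_pos h1) (sub_theta_pos hN hp)
  rw [ampl, ← Real.rpow_mul h2.le, one_div_mul_cancel (by linarith), Real.rpow_one]

lemma ampl_rpow (hN : 3 ≤ N) (hp : pS N < p) :
    ampl p N ^ p = theta p * ((N : ℝ) - 2 - theta p) * ampl p N := by
  rw [← ampl_rpow_sub_one hN hp, ← Real.rpow_add_one (ampl_pos hN hp).ne']
  ring_nf

end parameters

/-! ### The radial equation as a planar system -/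

/-- `(u, v)` solves `u' = v`, `v' = -((N - 1) / s) v - f(u)` at the points of `I`. -/
def IsRadialSol (N : ℕ) (p : ℝ) (u v : ℝ → ℝ) (I : Set ℝ) : Prop :=
  ∀ s ∈ I, HasDerivAt u (v s) s ∧
    HasDerivAt v (-(((N : ℝ) - 1) / s * v s) - nonlin p (u s)) s

lemma IsRadialSol.mono {N : ℕ} {p : ℝ} {u v : ℝ → ℝ} {I J : Set ℝ} (h : IsRadialSol N p u v I)
    (hJ : J ⊆ I) : IsRadialSol N p u v J := fun s hs => h s (hJ hs)

lemma IsRadialSol.congr {N : ℕ} {p : ℝ} {u v u' v' : ℝ → ℝ} {I : Set ℝ}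
    (h : IsRadialSol N p u v I) (hI : IsOpen I) (hu : EqOn u' u I) (hv : EqOn v' v I) :
    IsRadialSol N p u' v' I := by
  intro s hs
  have hn := hI.mem_nhds hs
  have e1 : u' =ᶠ[𝓝 s] u := hu.eventuallyEq_of_mem hn
  have e2 : v' =ᶠ[𝓝 s] v := hv.eventuallyEq_of_mem hn
  rw [hu hs, hv hs]
  exact ⟨(h s hs).1.congr_of_eventuallyEq e1, (h s hs).2.congr_of_eventuallyEq e2⟩

/-- The vector field of the radial equation. -/
def radialField (N : ℕ) (p s : ℝ) (X : ℝ × ℝ) : ℝ × ℝ :=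
  (X.2, -(((N : ℝ) - 1) / s * X.2) - nonlin p X.1)

lemma contDiff_nonlin {p : ℝ} (hp : 1 < p) : ContDiff ℝ 1 (nonlin p) := by
  unfold nonlin
  exact contDiff_neg.add (Real.contDiff_rpow_const_of_le (by simpa using hp.le))

lemma continuous_nonlin {p : ℝ} (hp : 1 < p) : Continuous (nonlin p) :=
  (contDiff_nonlin hp).continuous

/-- The field is affine in the second variable, so only the first one has to be confined to a
compact interval; keeping `s ≥ c` controls the singular coefficient. -/
lemma exists_lipschitzOnWith_radialField {p : ℝ} (N : ℕ) (hp : 1 < p) (M : ℝ) {c : ℝ}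
    (hc : 0 < c) :
    ∃ L : NNReal, ∀ s, c ≤ s →
      LipschitzOnWith L (radialField N p s) (Icc 0 M ×ˢ univ) := by
  obtain ⟨L, hL⟩ := (contDiff_nonlin hp).contDiffOn.exists_lipschitzOnWith (s := Icc 0 M)
    one_ne_zero (convex_Icc 0 M) isCompact_Icc
  refine ⟨1 + (|(N : ℝ) - 1| / c).toNNReal + L, fun s hs => ?_⟩
  refine LipschitzOnWith.of_dist_le_mul fun X hX Y hY => ?_
  have h1 : |X.1 - Y.1| ≤ dist X Y := by
    rw [← Real.dist_eq, Prod.dist_eq]; exact le_max_left _ _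
  have h2 : |X.2 - Y.2| ≤ dist X Y := by
    rw [← Real.dist_eq X.2, Prod.dist_eq]; exact le_max_right _ _
  have hD : 0 ≤ dist X Y := dist_nonneg
  have hs0 : 0 < s := hc.trans_le hs
  have hq : 0 ≤ |(N : ℝ) - 1| / c := by positivity
  have hL0 : (0 : ℝ) ≤ L := L.2
  push_cast
  rw [Real.coe_toNNReal _ hq, Prod.dist_eq (x := radialField N p s X)]
  refine max_le ?_ ?_
  · simp only [radialField, Real.dist_eq]
    nlinarith [mul_nonneg hq hD, mul_nonneg hL0 hD]
  · simp only [radialField, Real.dist_eq]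
    have h3 := hL.dist_le_mul X.1 hX.1 Y.1 hY.1
    rw [Real.dist_eq, Real.dist_eq] at h3
    have h4 : |((N : ℝ) - 1) / s * (X.2 - Y.2)| ≤ |(N : ℝ) - 1| / c * dist X Y := by
      rw [abs_mul, abs_div, abs_of_pos hs0]
      gcongr
    have h5 : |nonlin p X.1 - nonlin p Y.1| ≤ L * dist X Y :=
      h3.trans (mul_le_mul_of_nonneg_left h1 hL0)
    calc |-(((N : ℝ) - 1) / s * X.2) - nonlin p X.1
            - (-(((N : ℝ) - 1) / s * Y.2) - nonlin p Y.1)|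
        = |-(((N : ℝ) - 1) / s * (X.2 - Y.2)) - (nonlin p X.1 - nonlin p Y.1)| := by ring_nf
      _ ≤ |-(((N : ℝ) - 1) / s * (X.2 - Y.2))| + |nonlin p X.1 - nonlin p Y.1| := abs_sub _ _
      _ ≤ _ := by rw [abs_neg]; nlinarith

/-- Two nonnegative solutions of the radial equation with the same data at one point agree. -/
theorem IsRadialSol.eqOn {N : ℕ} {p : ℝ} (hp : 1 < p) {u₁ v₁ u₂ v₂ : ℝ → ℝ} {a b t₀ : ℝ}
    (ha : 0 ≤ a) (h₁ : IsRadialSol N p u₁ v₁ (Ioo a b)) (h₂ : IsRadialSol N p u₂ v₂ (Ioo a b))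
    (hu₁ : ∀ s ∈ Ioo a b, 0 ≤ u₁ s) (hu₂ : ∀ s ∈ Ioo a b, 0 ≤ u₂ s) (ht₀ : t₀ ∈ Ioo a b)
    (hu : u₁ t₀ = u₂ t₀) (hv : v₁ t₀ = v₂ t₀) :
    EqOn u₁ u₂ (Ioo a b) ∧ EqOn v₁ v₂ (Ioo a b) := by
  have key : ∀ t ∈ Ioo a b, u₁ t = u₂ t ∧ v₁ t = v₂ t := by
    intro t ht
    -- A compact interval around `t` and `t₀` inside `(a, b)` is bounded away from 0 and bounds both
    -- solutions, so one Lipschitz constant applies.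
    obtain ⟨c, hc1, hc2⟩ := exists_between (lt_min ht.1 ht₀.1)
    obtain ⟨d, hd1, hd2⟩ := exists_between (max_lt ht.2 ht₀.2)
    rw [lt_min_iff] at hc2
    rw [max_lt_iff] at hd1
    have hsub : Icc c d ⊆ Ioo a b := fun s hs => ⟨hc1.trans_le hs.1, hs.2.trans_lt hd2⟩
    have hcont : ∀ {u v}, IsRadialSol N p u v (Ioo a b) → ContinuousOn u (Icc c d) :=
      fun h s hs => (h s (hsub hs)).1.continuousAt.continuousWithinAt
    obtain ⟨M₁, hM₁⟩ := isCompact_Icc.bddAbove_image (hcont h₁)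
    obtain ⟨M₂, hM₂⟩ := isCompact_Icc.bddAbove_image (hcont h₂)
    obtain ⟨L, hL⟩ := exists_lipschitzOnWith_radialField N hp (max M₁ M₂) (ha.trans_lt hc1)
    have hsub' : Ioo c d ⊆ Icc c d := Ioo_subset_Icc_self
    have := ODE_solution_unique_of_mem_Ioo (v := radialField N p)
      (s := fun _ => Icc 0 (max M₁ M₂) ×ˢ univ) (a := c) (b := d) (t₀ := t₀)
      (f := fun s => (u₁ s, v₁ s)) (g := fun s => (u₂ s, v₂ s))
      (fun s hs => hL s hs.1.le) ⟨hc2.2, hd1.2⟩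
      (fun s hs => by
        have hs' := hsub (hsub' hs)
        exact ⟨(h₁ s hs').1.prodMk (h₁ s hs').2, ⟨hu₁ s hs',
          (hM₁ (mem_image_of_mem _ (hsub' hs))).trans (le_max_left _ _)⟩, mem_univ _⟩)
      (fun s hs => by
        have hs' := hsub (hsub' hs)
        exact ⟨(h₂ s hs').1.prodMk (h₂ s hs').2, ⟨hu₂ s hs',
          (hM₂ (mem_image_of_mem _ (hsub' hs))).trans (le_max_right _ _)⟩, mem_univ _⟩)
      (by rw [hu, hv]) (x := t) ⟨hc2.1, hd1.1⟩
    exact Prod.ext_iff.1 this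
  exact ⟨fun t ht => (key t ht).1, fun t ht => (key t ht).2⟩

/-! ### Emden–Fowler variables -/

/-- The remainder `(A + x) ^ p - A ^ p - p A ^ (p - 1) x`. -/
def emdenRemainder (N : ℕ) (p x : ℝ) : ℝ :=
  (ampl p N + x) ^ p - ampl p N ^ p - p * ampl p N ^ (p - 1) * x

/-- The forcing of the damped oscillator satisfied by `x(t) = exp(θ t) u(exp t) - A`. -/
def emdenForcing (N : ℕ) (p t x : ℝ) : ℝ :=
  Real.exp (2 * t) * (ampl p N + x) - emdenRemainder N p x

section emden

variable {N : ℕ} {p : ℝ}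

/-- Strict differentiability of `x ^ p` at `A` is precisely a small Lipschitz constant for the
remainder near 0. Taking `δ < A` keeps `A + x` positive. -/
lemma exists_emdenRemainder_lipschitz (hN : 3 ≤ N) (hp : pS N < p) {ε : ℝ} (hε : 0 < ε) :
    ∃ δ > 0, δ < ampl p N ∧ ∀ x ∈ Icc (-δ) δ, ∀ y ∈ Icc (-δ) δ,
      |emdenRemainder N p x - emdenRemainder N p y| ≤ ε * |x - y| := by
  have hA := ampl_pos hN hp
  have hd : HasStrictDerivAt (fun x : ℝ => x ^ p) (p * ampl p N ^ (p - 1)) (ampl p N) :=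
    Real.hasStrictDerivAt_rpow_const_of_ne hA.ne' p
  rw [hasStrictDerivAt_iff_hasStrictFDerivAt, hasStrictFDerivAt_iff_isLittleO] at hd
  have h1 := hd.def hε
  rw [Metric.eventually_nhds_iff] at h1
  obtain ⟨δ, hδ, h1⟩ := h1
  refine ⟨min δ (ampl p N) / 2, by positivity, ?_, ?_⟩
  · have := min_le_right δ (ampl p N); linarith
  · intro x hx y hy
    have hm : min δ (ampl p N) / 2 < δ := by have := min_le_left δ (ampl p N); linarith
    have hy' : |y| < δ := (abs_le.2 hy).trans_lt hm
    have hx' : |x| < δ := (abs_le.2 hx).trans_lt hm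
    have h2 := h1 (y := (ampl p N + x, ampl p N + y)) (by
      rw [Prod.dist_eq, max_lt_iff, Real.dist_eq, Real.dist_eq]
      simpa using ⟨hx', hy'⟩)
    simp only [add_sub_add_left_eq_sub, ContinuousLinearMap.toSpanSingleton_apply, smul_eq_mul,
      Real.norm_eq_abs] at h2
    refine le_trans (le_of_eq ?_) h2
    congr 1
    unfold emdenRemainder
    ring

lemma emdenRemainder_zero : emdenRemainder N p 0 = 0 := by simp [emdenRemainder]

lemma emdenForcing_lipschitz {ε δ T : ℝ} (hT : Real.exp (2 * T) ≤ ε / 2)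
    (hδ : ∀ x ∈ Icc (-δ) δ, ∀ y ∈ Icc (-δ) δ,
      |emdenRemainder N p x - emdenRemainder N p y| ≤ ε / 2 * |x - y|) :
    ∀ t ≤ T, ∀ x ∈ Icc (-δ) δ, ∀ y ∈ Icc (-δ) δ,
      |emdenForcing N p t x - emdenForcing N p t y| ≤ ε * |x - y| := by
  intro t ht x hx y hy
  have h1 : Real.exp (2 * t) ≤ ε / 2 := le_trans (Real.exp_le_exp.2 (by linarith)) hT
  calc |emdenForcing N p t x - emdenForcing N p t y|
      = |Real.exp (2 * t) * (x - y) - (emdenRemainder N p x - emdenRemainder N p y)| := by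
        unfold emdenForcing; ring_nf
    _ ≤ |Real.exp (2 * t) * (x - y)| + |emdenRemainder N p x - emdenRemainder N p y| :=
        abs_sub _ _
    _ ≤ ε / 2 * |x - y| + ε / 2 * |x - y| := by
        rw [abs_mul, abs_of_pos (Real.exp_pos _)]
        have := hδ x hx y hy
        gcongr
    _ = ε * |x - y| := by ring

/-- A solution of the radial equation in Emden–Fowler variables. -/
lemma IsRadialSol.emden (hN : 3 ≤ N) (hp : pS N < p) {u v : ℝ → ℝ} {t : ℝ}
    (h : IsRadialSol N p u v {Real.exp t}) (hu : 0 < u (Real.exp t)) :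
    HasDerivAt (fun t => Real.exp (theta p * t) * u (Real.exp t) - ampl p N)
      (Real.exp (theta p * t) * (theta p * u (Real.exp t) + Real.exp t * v (Real.exp t))) t ∧
    HasDerivAt
      (fun t => Real.exp (theta p * t) * (theta p * u (Real.exp t) + Real.exp t * v (Real.exp t)))
      (-((N : ℝ) - 2 - 2 * theta p) *
          (Real.exp (theta p * t) * (theta p * u (Real.exp t) + Real.exp t * v (Real.exp t)))
        - (p - 1) * (theta p * ((N : ℝ) - 2 - theta p)) *
          (Real.exp (theta p * t) * u (Real.exp t) - ampl p N)
        + emdenForcing N p t (Real.exp (theta p * t) * u (Real.exp t) - ampl p N)) t := by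
  have hp1 := one_lt_of_pS_lt hN hp
  obtain ⟨h1, h2⟩ := h _ rfl
  have hE : HasDerivAt (fun t => Real.exp (theta p * t))
      (Real.exp (theta p * t) * theta p) t := by
    simpa using ((hasDerivAt_id t).const_mul (theta p)).exp
  have he := Real.hasDerivAt_exp t
  have hu' : HasDerivAt (fun t => u (Real.exp t)) (v (Real.exp t) * Real.exp t) t :=
    h1.comp t he
  have hv' : HasDerivAt (fun t => v (Real.exp t))
    ((-(((N : ℝ) - 1) / Real.exp t * v (Real.exp t)) - nonlin p (u (Real.exp t)))
      * Real.exp t) t := h2.comp t he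
  constructor
  · refine ((hE.mul hu').sub_const _).congr_deriv ?_
    ring
  · refine (hE.mul ((hu'.const_mul (theta p)).add (he.mul hv'))).congr_deriv ?_
    -- This is where the choice of `θ` enters: `θ p = θ + 2`.
    have hpow : (Real.exp (theta p * t) * u (Real.exp t)) ^ p
        = Real.exp (theta p * t) * Real.exp t ^ 2 * u (Real.exp t) ^ p := by
      rw [Real.mul_rpow (Real.exp_pos _).le hu.le, ← Real.exp_mul, ← Real.exp_nat_mul,
        ← Real.exp_add]
      congr 2
      have := theta_mul_sub_one hp1
      push_cast
      linear_combination t * this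
    have h2t : Real.exp (2 * t) = Real.exp t ^ 2 := by
      rw [← Real.exp_nat_mul]; push_cast; ring_nf
    have hcancel : ((N : ℝ) - 1) / Real.exp t * v (Real.exp t) * Real.exp t
        = ((N : ℝ) - 1) * v (Real.exp t) := by
      field_simp
    simp only [emdenForcing, emdenRemainder, add_sub_cancel, hpow, h2t, ampl_rpow hN hp,
      ampl_rpow_sub_one hN hp, nonlin, Pi.add_apply, Pi.mul_apply]
    linear_combination (-Real.exp (theta p * t) * Real.exp t) * hcancel

end emden

/-! ### The singular solution near the origin -/

section singular

variable {N : ℕ} {p : ℝ}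

lemma eventually_atBot_exp_le {ε : ℝ} (c : ℝ) (hc : 0 < c) (hε : 0 < ε) :
    ∀ᶠ t in atBot, Real.exp (c * t) < ε :=
  (Real.tendsto_exp_atBot.comp (tendsto_id.const_mul_atBot hc)).eventually (gt_mem_nhds hε)

/-- Positive solutions near the origin with the singular profile are unique. -/
theorem IsRadialSol.eqOn_of_profile (hN : 3 ≤ N) (hp : pS N < p) {R : ℝ} (hR : 0 < R)
    {u₁ v₁ u₂ v₂ : ℝ → ℝ} (h₁ : IsRadialSol N p u₁ v₁ (Ioo 0 R))
    (h₂ : IsRadialSol N p u₂ v₂ (Ioo 0 R))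
    (hu₁ : ∀ s ∈ Ioo 0 R, 0 < u₁ s) (hu₂ : ∀ s ∈ Ioo 0 R, 0 < u₂ s)
    (hl₁ : Tendsto (fun s => s ^ theta p * u₁ s) (𝓝[>] 0) (𝓝 (ampl p N)))
    (hl₂ : Tendsto (fun s => s ^ theta p * u₂ s) (𝓝[>] 0) (𝓝 (ampl p N))) :
    EqOn u₁ u₂ (Ioo 0 R) ∧ EqOn v₁ v₂ (Ioo 0 R) := by
  obtain ⟨ε, hε, μ, hμ, C, -, hdis⟩ :=
    exists_lyap_dissipation (damping_pos hN hp) (stiffness_pos hN hp)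
  -- Half of `ε` is left for the linear term `exp (2 t) x` of the forcing.
  obtain ⟨δ, hδ, -, hlip⟩ := exists_emdenRemainder_lipschitz hN hp (half_pos hε)
  have hsmall : ∀ u : ℝ → ℝ, Tendsto (fun s => s ^ theta p * u s) (𝓝[>] 0) (𝓝 (ampl p N)) →
      ∀ᶠ t in atBot, Real.exp (theta p * t) * u (Real.exp t) - ampl p N ∈ Icc (-δ) δ := by
    intro u hu
    have h1 := (hu.comp Real.tendsto_exp_atBot_nhdsGT).sub_const (ampl p N)
    rw [sub_self] at h1
    filter_upwards [h1.eventually (Icc_mem_nhds (neg_lt_zero.2 hδ) hδ)] with t ht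
    have : Real.exp t ^ theta p = Real.exp (theta p * t) := by
      rw [← Real.exp_mul, mul_comm]
    simp only [Function.comp, this] at ht
    exact ht
  have hlog : ∀ᶠ t in atBot, Real.exp (1 * t) < R := eventually_atBot_exp_le 1 one_pos hR
  obtain ⟨T, hT⟩ := ((hsmall u₁ hl₁).and ((hsmall u₂ hl₂).and
    ((eventually_atBot_exp_le 2 two_pos (half_pos hε)).and hlog))).exists_forall_of_atBot
  have hI : ∀ t ≤ T, Real.exp t ∈ Ioo 0 R := fun t ht =>
    ⟨Real.exp_pos t, by simpa using (hT t ht).2.2.2⟩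
  -- In the difference of the two solutions the inhomogeneous part `exp (2 t) A` cancels, leaving a
  -- Lipschitz perturbation of the oscillator that is bounded by `2 δ`.
  have hz := eq_zero_of_bounded_oscillator
    (a := (N : ℝ) - 2 - 2 * theta p) (k := (p - 1) * (theta p * ((N : ℝ) - 2 - theta p)))
    (ε := ε) (μ := μ) (C := C) (M := 2 * δ) (T := T)
    (x := fun t => (Real.exp (theta p * t) * u₁ (Real.exp t) - ampl p N)
      - (Real.exp (theta p * t) * u₂ (Real.exp t) - ampl p N))
    (y := fun t =>
      Real.exp (theta p * t) * (theta p * u₁ (Real.exp t) + Real.exp t * v₁ (Real.exp t))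
      - Real.exp (theta p * t) * (theta p * u₂ (Real.exp t) + Real.exp t * v₂ (Real.exp t)))
    (g := fun t => emdenForcing N p t (Real.exp (theta p * t) * u₁ (Real.exp t) - ampl p N)
      - emdenForcing N p t (Real.exp (theta p * t) * u₂ (Real.exp t) - ampl p N))
    (stiffness_pos hN hp) hμ hdis
    (fun t ht => ((h₁.mono (singleton_subset_iff.2 (hI t ht.le))).emden hN hp
        (hu₁ _ (hI t ht.le))).1.sub
      ((h₂.mono (singleton_subset_iff.2 (hI t ht.le))).emden hN hp (hu₂ _ (hI t ht.le))).1)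
    (fun t ht => (((h₁.mono (singleton_subset_iff.2 (hI t ht.le))).emden hN hp
        (hu₁ _ (hI t ht.le))).2.sub
      ((h₂.mono (singleton_subset_iff.2 (hI t ht.le))).emden hN hp
        (hu₂ _ (hI t ht.le))).2).congr_deriv (by ring))
    (fun t ht => emdenForcing_lipschitz (hT T le_rfl).2.2.1.le hlip t ht.le _ (hT t ht.le).1 _
      (hT t ht.le).2.1)
    (fun t ht => by
      obtain ⟨⟨q1, q2⟩, ⟨q3, q4⟩, -⟩ := hT t ht.le
      exact abs_le.2 ⟨by linarith, by linarith⟩)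
  have hueq : ∀ s ∈ Ioo 0 (Real.exp T), u₁ s = u₂ s := by
    intro s hs
    have h := hz (Real.log s) ((Real.log_lt_iff_lt_exp hs.1).2 hs.2)
    simp only [Real.exp_log hs.1] at h
    have hE := (Real.exp_pos (theta p * Real.log s)).ne'
    exact mul_left_cancel₀ hE (by linarith)
  have hT0 := Real.exp_pos T
  -- So far the solutions agree on `(0, exp T)`. At an interior point their derivatives agree too,
  -- and uniqueness for the initial value problem covers the rest of `(0, R)`.
  set t₀ := Real.exp T / 2 with ht₀
  have ht₀' : t₀ ∈ Ioo 0 (Real.exp T) := ⟨by positivity, by linarith⟩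
  have ht₀R : t₀ ∈ Ioo 0 R := ⟨ht₀'.1, ht₀'.2.trans (hI T le_rfl).2⟩
  have hev : u₁ =ᶠ[𝓝 t₀] u₂ := by
    filter_upwards [isOpen_Ioo.mem_nhds ht₀'] with s hs using hueq s hs
  exact IsRadialSol.eqOn (one_lt_of_pS_lt hN hp) le_rfl h₁ h₂ (fun s hs => (hu₁ s hs).le)
    (fun s hs => (hu₂ s hs).le) ht₀R (hueq _ ht₀')
    (((h₁ _ ht₀R).1.congr_of_eventuallyEq hev.symm).unique (h₂ _ ht₀R).1)

/-- From Emden–Fowler variables back to the radial equation. -/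
lemma isRadialSol_of_emden (hN : 3 ≤ N) (hp : pS N < p) {x y : ℝ → ℝ} {T : ℝ}
    (hx : ∀ t < T, HasDerivAt x (y t) t)
    (hy : ∀ t < T, HasDerivAt y (-((N : ℝ) - 2 - 2 * theta p) * y t
      - (p - 1) * (theta p * ((N : ℝ) - 2 - theta p)) * x t + emdenForcing N p t (x t)) t)
    (hpos : ∀ t < T, 0 < ampl p N + x t) :
    IsRadialSol N p (fun s => s ^ (-theta p) * (ampl p N + x (Real.log s)))
      (fun s => s ^ (-theta p) / s * (y (Real.log s) - theta p * (ampl p N + x (Real.log s))))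
      (Ioo 0 (Real.exp T)) := by
  have hp1 := one_lt_of_pS_lt hN hp
  rintro s ⟨hs0, hsT⟩
  have ht : Real.log s < T := (Real.log_lt_iff_lt_exp hs0).2 hsT
  have hlog := Real.hasDerivAt_log hs0.ne'
  have hx' : HasDerivAt (fun s => x (Real.log s)) (y (Real.log s) * s⁻¹) s :=
    (hx _ ht).comp s hlog
  have hy' : HasDerivAt (fun s => y (Real.log s)) ((-((N : ℝ) - 2 - 2 * theta p) * y (Real.log s)
      - (p - 1) * (theta p * ((N : ℝ) - 2 - theta p)) * x (Real.log s)
      + emdenForcing N p (Real.log s) (x (Real.log s))) * s⁻¹) s :=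
    (hy _ ht).comp s hlog
  have hq : HasDerivAt (fun s : ℝ => s ^ (-theta p)) (-theta p * (s ^ (-theta p) / s)) s := by
    refine (Real.hasDerivAt_rpow_const (Or.inl hs0.ne')).congr_deriv ?_
    rw [Real.rpow_sub_one hs0.ne']
  constructor
  · refine (hq.mul (hx'.const_add (ampl p N))).congr_deriv ?_
    field_simp
    ring
  · refine ((hq.div (hasDerivAt_id s) hs0.ne').mul
      (hy'.sub ((hx'.const_add (ampl p N)).const_mul (theta p)))).congr_deriv ?_
    have hpow : (s ^ (-theta p) * (ampl p N + x (Real.log s))) ^ p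
        = s ^ (-theta p) / s ^ 2 * (ampl p N + x (Real.log s)) ^ p := by
      rw [Real.mul_rpow (Real.rpow_pos_of_pos hs0 _).le (hpos _ ht).le, ← Real.rpow_mul hs0.le,
        ← Real.rpow_natCast s 2, ← Real.rpow_sub hs0]
      congr 2
      have := theta_mul_sub_one hp1
      push_cast
      linear_combination -this
    have h2t : Real.exp (2 * Real.log s) = s ^ 2 := by
      rw [two_mul, Real.exp_add, Real.exp_log hs0, sq]
    simp only [emdenForcing, emdenRemainder, hpow, h2t, ampl_rpow hN hp,
      ampl_rpow_sub_one hN hp, nonlin, id, Pi.sub_apply, Pi.div_apply]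
    field_simp
    ring

/-- Existence of a solution with the singular profile near the origin. -/
theorem exists_local_singular (hN : 3 ≤ N) (hp : pS N < p) :
    ∃ R > 0, ∃ u v : ℝ → ℝ, IsRadialSol N p u v (Ioo 0 R) ∧ (∀ s ∈ Ioo 0 R, 0 < u s) ∧
      Tendsto (fun s => s ^ theta p * u s) (𝓝[>] 0) (𝓝 (ampl p N)) ∧
      Tendsto (fun s => s ^ theta p * s * v s) (𝓝[>] 0) (𝓝 (-(theta p * ampl p N))) := by
  obtain ⟨ε, hε, μ, hμ, C, hC, hdis⟩ :=
    exists_lyap_dissipation (damping_pos hN hp) (stiffness_pos hN hp)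
  obtain ⟨δ, hδ, hδA, hlip⟩ := exists_emdenRemainder_lipschitz hN hp (half_pos hε)
  have hA := ampl_pos hN hp
  have hk := stiffness_pos hN hp
  set D := (2 + (1 + ((N : ℝ) - 2 - 2 * theta p) ^ 2 / 2)
    / ((p - 1) * (theta p * ((N : ℝ) - 2 - theta p)))) * (C * ampl p N ^ 2 / (μ + 4)) with hD
  have hD0 : 0 < D := by positivity
  -- The first condition makes the forcing Lipschitz with constant `ε`, the second keeps the
  -- oscillator inside the box of size `δ`.
  obtain ⟨T, hT1, hT2⟩ := ((eventually_atBot_exp_le 2 two_pos (half_pos hε)).and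
    (eventually_atBot_exp_le 4 four_pos (by positivity : 0 < δ ^ 2 / D))).exists
  obtain ⟨x, y, hxy⟩ := exists_decaying_oscillator (g := emdenForcing N p) (C₀ := ampl p N)
    (T := T) (damping_pos hN hp) hk hε hμ hC hdis hδ (emdenForcing_lipschitz hT1.le hlip)
    (fun t _ => by
      rw [emdenForcing, emdenRemainder_zero, add_zero, sub_zero, mul_comm, abs_of_pos]
      positivity)
    (by
      have : Continuous (Function.uncurry (emdenForcing N p)) := by
        have hc : Continuous fun x : ℝ => x ^ p :=
          Real.continuous_rpow_const (by linarith [one_lt_of_pS_lt hN hp])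
        have : Continuous fun q : ℝ × ℝ => (ampl p N + q.2) ^ p := hc.comp (by fun_prop)
        unfold Function.uncurry emdenForcing emdenRemainder
        fun_prop
      exact this.continuousOn)
    (by rw [← hD, mul_comm]; exact (lt_div_iff₀ hD0).1 hT2)
  rw [← hD] at hxy
  have hpos : ∀ t < T, 0 < ampl p N + x t := fun t ht => by
    have := (hxy t ht).2.2.1.1; linarith
  have hsol := isRadialSol_of_emden hN hp (fun t ht => (hxy t ht).1) (fun t ht => (hxy t ht).2.1)
    hpos
  have hto : Tendsto (fun t : ℝ => D * Real.exp (4 * t)) atBot (𝓝 0) := by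
    simpa using (Real.tendsto_exp_atBot.comp
      (tendsto_id.const_mul_atBot (four_pos (α := ℝ)))).const_mul D
  have hsq : ∀ z : ℝ → ℝ, (∀ t < T, z t ^ 2 ≤ D * Real.exp (4 * t)) →
      Tendsto (fun s => z (Real.log s)) (𝓝[>] 0) (𝓝 0) := by
    intro z hz
    have h1 : Tendsto (fun t => z t ^ 2) atBot (𝓝 0) := by
      refine squeeze_zero' (Eventually.of_forall fun t => sq_nonneg _) ?_ hto
      filter_upwards [eventually_lt_atBot T] with t ht using hz t ht
    have h2 : Tendsto z atBot (𝓝 0) := by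
      have h3 := h1.sqrt
      simp only [Real.sqrt_sq_eq_abs, Real.sqrt_zero] at h3
      exact (tendsto_zero_iff_abs_tendsto_zero z).2 h3
    exact h2.comp Real.tendsto_log_nhdsGT_zero
  have hx0 := hsq x fun t ht => by nlinarith [(hxy t ht).2.2.2, sq_nonneg (y t)]
  have hy0 := hsq y fun t ht => by nlinarith [(hxy t ht).2.2.2, sq_nonneg (x t)]
  refine ⟨Real.exp T, Real.exp_pos T, _, _, hsol, ?_, ?_, ?_⟩
  · intro s hs
    exact mul_pos (Real.rpow_pos_of_pos hs.1 _) (hpos _ ((Real.log_lt_iff_lt_exp hs.1).2 hs.2))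
  · have h1 := hx0.const_add (ampl p N)
    rw [add_zero] at h1
    refine h1.congr' ?_
    filter_upwards [self_mem_nhdsWithin] with s hs
    rw [← mul_assoc, ← Real.rpow_add hs, add_neg_cancel, Real.rpow_zero, one_mul]
  · have h1 := hy0.sub ((hx0.const_add (ampl p N)).const_mul (theta p))
    rw [add_zero, zero_sub] at h1
    refine h1.congr' ?_
    filter_upwards [self_mem_nhdsWithin] with s hs
    have h2 : s ^ theta p * s ^ (-theta p) = 1 := by
      rw [← Real.rpow_add hs, add_neg_cancel, Real.rpow_zero]
    have hs0 : s ≠ 0 := (mem_Ioi.1 hs).ne'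
    field_simp
    rw [mul_assoc, h2, mul_one]

end singular

/-! ### Energy and Pohozaev functionals -/

/-- The primitive `F(u) = -u² / 2 + u ^ (p + 1) / (p + 1)` of the nonlinearity. -/
def nonlinPrim (p u : ℝ) : ℝ := -(u ^ 2 / 2) + u ^ (p + 1) / (p + 1)

/-- The energy `v² / 2 + F(u)`. -/
def energy (p u v : ℝ) : ℝ := v ^ 2 / 2 + nonlinPrim p u

/-- The Pohozaev functional `s ^ N (v² / 2 + F(u)) + ((N - 2) / 2) s ^ (N - 1) u v`. -/
def pohozaev (N : ℕ) (p s u v : ℝ) : ℝ :=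
  s ^ (N - 1) * (s * energy p u v + ((N : ℝ) - 2) / 2 * u * v)

section functionals

variable {N : ℕ} {p : ℝ}

lemma hasDerivAt_nonlinPrim (hp : 1 < p) (u : ℝ) :
    HasDerivAt (nonlinPrim p) (nonlin p u) u := by
  have h1 : HasDerivAt (fun u : ℝ => u ^ (p + 1)) ((p + 1) * u ^ (p + 1 - 1)) u :=
    Real.hasDerivAt_rpow_const (Or.inr (by linarith))
  have h2 := ((hasDerivAt_id u).pow 2).div_const 2
  refine (h2.neg.add (h1.div_const (p + 1))).congr_deriv ?_
  have : p + 1 ≠ 0 := by linarith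
  simp only [nonlin, add_sub_cancel_right, id]
  field_simp
  norm_num
  ring

lemma continuous_nonlinPrim (hp : 1 < p) : Continuous (nonlinPrim p) :=
  continuous_iff_continuousAt.2 fun u => (hasDerivAt_nonlinPrim hp u).continuousAt

lemma hasDerivAt_pow_pred (hN : 1 ≤ N) {s : ℝ} (hs : s ≠ 0) :
    HasDerivAt (fun s : ℝ => s ^ (N - 1)) (((N : ℝ) - 1) * s ^ (N - 1) / s) s := by
  refine (hasDerivAt_pow (N - 1) s).congr_deriv ?_
  rw [Nat.cast_sub hN, Nat.cast_one]
  rcases Nat.eq_or_lt_of_le hN with h | h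
  · subst h; simp
  · obtain ⟨k, rfl⟩ : ∃ k, N = k + 2 := ⟨N - 2, by omega⟩
    simp only [show k + 2 - 1 = k + 1 by omega, add_tsub_cancel_right]
    field_simp
    ring

lemma IsRadialSol.hasDerivAt_energy (hp : 1 < p) {u v : ℝ → ℝ} {I : Set ℝ}
    (h : IsRadialSol N p u v I) {s : ℝ} (hs : s ∈ I) :
    HasDerivAt (fun s => energy p (u s) (v s)) (-(((N : ℝ) - 1) / s * v s ^ 2)) s := by
  obtain ⟨h1, h2⟩ := h s hs
  have h3 : HasDerivAt (fun s => nonlinPrim p (u s)) (nonlin p (u s) * v s) s :=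
    (hasDerivAt_nonlinPrim hp (u s)).comp s h1
  refine (((h2.pow 2).div_const 2).add h3).congr_deriv ?_
  push_cast
  ring

lemma IsRadialSol.hasDerivAt_pow_mul (hN : 1 ≤ N) {u v : ℝ → ℝ} {I : Set ℝ}
    (h : IsRadialSol N p u v I) {s : ℝ} (hs : s ∈ I) (hs0 : s ≠ 0) :
    HasDerivAt (fun s => s ^ (N - 1) * v s) (-(s ^ (N - 1) * nonlin p (u s))) s := by
  refine ((hasDerivAt_pow_pred hN hs0).mul (h s hs).2).congr_deriv ?_
  field_simp
  ring

lemma IsRadialSol.hasDerivAt_pohozaev (hN : 1 ≤ N) (hp : 1 < p) {u v : ℝ → ℝ} {I : Set ℝ}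
    (h : IsRadialSol N p u v I) {s : ℝ} (hs : s ∈ I) (hs0 : s ≠ 0) :
    HasDerivAt (fun s => pohozaev N p s (u s) (v s))
      (s ^ (N - 1) * (N * nonlinPrim p (u s) - ((N : ℝ) - 2) / 2 * (u s * nonlin p (u s)))) s := by
  obtain ⟨h1, h2⟩ := h s hs
  have hE := h.hasDerivAt_energy hp hs
  refine ((hasDerivAt_pow_pred hN hs0).mul (((hasDerivAt_id s).mul hE).add
    ((h1.const_mul (((N : ℝ) - 2) / 2)).mul h2))).congr_deriv ?_
  simp only [id, energy, Pi.add_apply, Pi.mul_apply]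
  field_simp
  ring

/-- The coefficient of `u²` is `-1`, and that of `u ^ (p + 1)` is `N / (p + 1) - (N - 2) / 2`, which
is nonpositive because `p` is at least the critical exponent. -/
lemma pohozaev_deriv_nonpos (hN : 3 ≤ N) (hp : pS N < p) {u : ℝ} (hu : 0 ≤ u) :
    N * nonlinPrim p u - ((N : ℝ) - 2) / 2 * (u * nonlin p u) ≤ 0 := by
  have hp1 := one_lt_of_pS_lt hN hp
  have hN' : (3 : ℝ) ≤ N := by exact_mod_cast hN
  have h1 : u * u ^ p = u ^ (p + 1) := by
    rw [Real.rpow_add_one' hu (by linarith), mul_comm]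
  have h2 : (N : ℝ) / (p + 1) ≤ ((N : ℝ) - 2) / 2 := by
    rw [pS, div_lt_iff₀ (by linarith)] at hp
    rw [div_le_div_iff₀ (by linarith) two_pos]
    linarith
  have h3 : 0 ≤ u ^ (p + 1) := Real.rpow_nonneg hu _
  have h4 : N * nonlinPrim p u - ((N : ℝ) - 2) / 2 * (u * nonlin p u)
      = -u ^ 2 + ((N : ℝ) / (p + 1) - ((N : ℝ) - 2) / 2) * u ^ (p + 1) := by
    rw [nonlinPrim, nonlin, ← h1]
    ring
  rw [h4]
  nlinarith [sq_nonneg u, mul_nonneg (sub_nonneg.2 h2) h3]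

/-- Sublevel sets of the energy are bounded. -/
lemma exists_bound_of_energy_le (hp : 1 < p) (E : ℝ) :
    ∃ M > 0, ∀ u v : ℝ, 0 ≤ u → energy p u v ≤ E → u < M ∧ |v| < M := by
  -- Beyond `c` one has `u ^ (p + 1) / (p + 1) ≥ u²`, so the primitive is at least `u² / 2` there.
  set c : ℝ := (p + 1) ^ (1 / (p - 1)) with hc
  have hc0 : 0 < c := Real.rpow_pos_of_pos (by linarith) _
  have key : ∀ u : ℝ, 0 ≤ u → u ^ 2 / 2 - c ^ 2 ≤ nonlinPrim p u := by
    intro u hu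
    have h0 : 0 ≤ u ^ (p + 1) / (p + 1) := div_nonneg (Real.rpow_nonneg hu _) (by linarith)
    rcases le_or_gt u c with h | h
    · have : u ^ 2 ≤ c ^ 2 := by gcongr
      unfold nonlinPrim; linarith
    · have h1 : p + 1 ≤ u ^ (p - 1) := by
        have : c ^ (p - 1) = p + 1 := by
          rw [hc, ← Real.rpow_mul (by linarith), one_div_mul_cancel (by linarith), Real.rpow_one]
        rw [← this]
        exact Real.rpow_le_rpow hc0.le h.le (by linarith)
      have h2 : u ^ (p + 1) = u ^ (p - 1) * u ^ 2 := by
        rw [← Real.rpow_natCast u 2, ← Real.rpow_add (hc0.trans h)]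
        congr 1; push_cast; ring
      have h3 : u ^ 2 ≤ u ^ (p + 1) / (p + 1) := by
        rw [le_div_iff₀ (by linarith), h2, mul_comm]
        gcongr
      unfold nonlinPrim; nlinarith [sq_nonneg c]
  refine ⟨√(2 * (|E| + c ^ 2)) + 1, by positivity, fun u v hu hE => ?_⟩
  have h1 := key u hu
  have h2 : v ^ 2 + u ^ 2 ≤ 2 * (|E| + c ^ 2) := by
    have := le_abs_self E
    unfold energy at hE; linarith
  constructor
  · have := (le_abs_self u).trans (Real.abs_le_sqrt (by linarith [sq_nonneg v] :
      u ^ 2 ≤ 2 * (|E| + c ^ 2)))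
    linarith
  · have := Real.abs_le_sqrt (by linarith [sq_nonneg u] : v ^ 2 ≤ 2 * (|E| + c ^ 2))
    linarith

/-- At `u = 0` the functional reduces to `s ^ N v² / 2 ≥ 0`. This is the barrier that prevents a
solution from reaching zero. -/
lemma pos_of_pohozaev_neg {s u v : ℝ} (hp : 1 < p) (hs : 0 < s) (hu : 0 ≤ u)
    (h : pohozaev N p s u v < 0) : 0 < u := by
  refine hu.lt_of_ne fun h0 => ?_
  subst h0
  have : 0 ≤ pohozaev N p s 0 v := by
    simp only [pohozaev, energy, nonlinPrim, Real.zero_rpow (by linarith : p + 1 ≠ 0)]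
    simp only [mul_zero, zero_mul, add_zero, zero_div, ne_eq, OfNat.ofNat_ne_zero,
      not_false_eq_true, zero_pow, neg_zero]
    positivity
  linarith

/-- The Pohozaev functional of a solution with the singular profile is negative near `0`. -/
lemma eventually_pohozaev_neg (hN : 3 ≤ N) (hp : pS N < p) {u v : ℝ → ℝ}
    (hpos : ∀ᶠ s in 𝓝[>] 0, 0 < u s)
    (hu : Tendsto (fun s => s ^ theta p * u s) (𝓝[>] 0) (𝓝 (ampl p N)))
    (hv : Tendsto (fun s => s ^ theta p * s * v s) (𝓝[>] 0) (𝓝 (-(theta p * ampl p N)))) :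
    ∀ᶠ s in 𝓝[>] 0, pohozaev N p s (u s) (v s) < 0 := by
  have hp1 := one_lt_of_pS_lt hN hp
  have hA := ampl_pos hN hp
  have hs : Tendsto (fun s : ℝ => s) (𝓝[>] 0) (𝓝 0) := tendsto_id.mono_left nhdsWithin_le_nhds
  -- This limit is that of the bracket in `pohozaev` multiplied by the positive factor `s ^ (2 θ) *
  -- s`. It equals `-A² θ (N - 2 - θ) (p - 1) / (2 (p + 1))`.
  have hlim := (((hv.pow 2).div_const 2).sub (((hs.pow 2).mul (hu.pow 2)).div_const 2)).add
    ((hu.rpow_const (p := p + 1) (Or.inr (by linarith))).div_const (p + 1)) |>.add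
    ((hu.const_mul (((N : ℝ) - 2) / 2)).mul hv)
  have hneg : (-(theta p * ampl p N)) ^ 2 / 2 - 0 ^ 2 * ampl p N ^ 2 / 2
      + ampl p N ^ (p + 1) / (p + 1)
      + ((N : ℝ) - 2) / 2 * ampl p N * -(theta p * ampl p N) < 0 := by
    rw [Real.rpow_add_one hA.ne', ampl_rpow hN hp]
    have e : (-(theta p * ampl p N)) ^ 2 / 2 - 0 ^ 2 * ampl p N ^ 2 / 2
      + theta p * ((N : ℝ) - 2 - theta p) * ampl p N * ampl p N / (p + 1)
      + ((N : ℝ) - 2) / 2 * ampl p N * -(theta p * ampl p N)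
      = -(ampl p N ^ 2 * theta p * ((N : ℝ) - 2 - theta p) * ((p - 1) / (2 * (p + 1)))) := by
      have : p + 1 ≠ 0 := by linarith
      field_simp
      ring
    rw [e, neg_lt_zero]
    have h1 := theta_pos hp1
    have h2 := sub_theta_pos hN hp
    have h3 : 0 < (p - 1) / (2 * (p + 1)) := div_pos (by linarith) (by linarith)
    positivity
  filter_upwards [hlim.eventually (gt_mem_nhds hneg), hpos, self_mem_nhdsWithin]
    with s hs1 hs2 hs3
  have hs0 : 0 < s := hs3
  set q := s ^ theta p with hq
  have hq0 : 0 < q := Real.rpow_pos_of_pos hs0 _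
  have hpow : (q * u s) ^ (p + 1) = q ^ 2 * s ^ 2 * u s ^ (p + 1) := by
    rw [Real.mul_rpow hq0.le hs2.le]
    congr 1
    rw [hq, ← Real.rpow_natCast, ← Real.rpow_natCast, ← Real.rpow_mul hs0.le,
      ← Real.rpow_mul hs0.le, ← Real.rpow_add hs0]
    congr 1
    push_cast
    linear_combination theta_mul_sub_one hp1
  rw [hpow] at hs1
  have e : (q * s * v s) ^ 2 / 2 - s ^ 2 * (q * u s) ^ 2 / 2
      + q ^ 2 * s ^ 2 * u s ^ (p + 1) / (p + 1) + ((N : ℝ) - 2) / 2 * (q * u s) * (q * s * v s)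
      = q ^ 2 * s * (s * energy p (u s) (v s) + ((N : ℝ) - 2) / 2 * u s * v s) := by
    simp only [energy, nonlinPrim]
    ring
  rw [e] at hs1
  have h5 := neg_of_mul_neg_right hs1 (by positivity)
  exact mul_neg_of_pos_of_neg (by positivity) h5

end functionals

/-! ### Continuation of the singular solution -/

section continuation

variable {N : ℕ} {p : ℝ}

/-- Continuation of a solution with negative Pohozaev functional. -/
theorem exists_forward_solution (hN : 3 ≤ N) (hp : pS N < p) {s₀ R u₀ v₀ : ℝ} (hs₀ : 0 < s₀)
    (hR : s₀ ≤ R) (hu₀ : 0 < u₀) (hP : pohozaev N p s₀ u₀ v₀ < 0) :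
    ∃ X : ℝ → ℝ × ℝ, X s₀ = (u₀, v₀) ∧ ∀ s ∈ Icc s₀ R,
      HasDerivWithinAt X (radialField N p s (X s)) (Icc s₀ R) s ∧ 0 < (X s).1 := by
  have hp1 := one_lt_of_pS_lt hN hp
  have hN' : (3 : ℝ) ≤ N := by exact_mod_cast hN
  obtain ⟨M, hM, hMb⟩ := exists_bound_of_energy_le hp1 (energy p u₀ v₀)
  -- The energy excludes every side of the box except `u = 0`, and that side is excluded by the
  -- Pohozaev functional.
  have hap : ∀ τ ∈ Icc s₀ R, ∀ X : ℝ → ℝ × ℝ, X s₀ = (u₀, v₀) →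
      (∀ t ∈ Icc s₀ τ, HasDerivWithinAt X (radialField N p t (X t)) (Icc s₀ τ) t) →
      (∀ t ∈ Icc s₀ τ, X t ∈ Icc 0 M ×ˢ Icc (-M) M) → X τ ∈ Ioo 0 M ×ˢ Ioo (-M) M := by
    intro τ hτ X hX0 hX hXm
    have hXc : ContinuousOn X (Icc s₀ τ) := fun t ht => (hX t ht).continuousWithinAt
    have hsol : IsRadialSol N p (fun s => (X s).1) (fun s => (X s).2) (Ioo s₀ τ) := fun t ht =>
      have := (hX t (Ioo_subset_Icc_self ht)).hasDerivAt (Icc_mem_nhds ht.1 ht.2)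
      ⟨hasDerivAt_fst_of_prod this, hasDerivAt_snd_of_prod this⟩
    have hEc : ContinuousOn (fun s => energy p (X s).1 (X s).2) (Icc s₀ τ) := by
      have := (continuous_nonlinPrim hp1).comp_continuousOn
        (continuous_fst.comp_continuousOn hXc)
      have h2 : ContinuousOn (fun s => (X s).2 ^ 2 / 2) (Icc s₀ τ) := by fun_prop
      exact h2.add this
    have hE := antitoneOn_of_hasDerivAt_nonpos (convex_Icc s₀ τ) hEc
      (fun x hx => hsol.hasDerivAt_energy hp1 (by rwa [interior_Icc] at hx))
      (fun x hx => by
        rw [interior_Icc] at hx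
        have h1 : 0 < x := hs₀.trans hx.1
        have h2 : 0 ≤ ((N : ℝ) - 1) / x := div_nonneg (by linarith) h1.le
        exact neg_nonpos.2 (mul_nonneg h2 (sq_nonneg _)))
      (left_mem_Icc.2 hτ.1) (right_mem_Icc.2 hτ.1) hτ.1
    have hPc : ContinuousOn (fun s => pohozaev N p s (X s).1 (X s).2) (Icc s₀ τ) := by
      unfold pohozaev
      fun_prop
    have hPa := antitoneOn_of_hasDerivAt_nonpos (convex_Icc s₀ τ) hPc
      (fun x hx => by
        rw [interior_Icc] at hx
        exact hsol.hasDerivAt_pohozaev (by omega) hp1 hx (hs₀.trans hx.1).ne')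
      (fun x hx => by
        rw [interior_Icc] at hx
        have h1 : 0 < x := hs₀.trans hx.1
        exact mul_nonpos_of_nonneg_of_nonpos (by positivity)
          (pohozaev_deriv_nonpos hN hp (hXm x (Ioo_subset_Icc_self hx)).1.1))
      (left_mem_Icc.2 hτ.1) (right_mem_Icc.2 hτ.1) hτ.1
    simp only [hX0] at hE hPa
    have hu := (hXm τ (right_mem_Icc.2 hτ.1)).1.1
    obtain ⟨h1, h2⟩ := hMb _ _ hu hE
    exact ⟨⟨pos_of_pohozaev_neg hp1 (hs₀.trans_le hτ.1) hu (hPa.trans_lt hP), h1⟩, abs_lt.1 h2⟩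
  obtain ⟨L, hL⟩ := exists_lipschitzOnWith_radialField N hp1 M hs₀
  obtain ⟨h1, h2⟩ := hMb u₀ v₀ hu₀.le le_rfl
  obtain ⟨X, hX0, hX⟩ := exists_solution_mem_box (f := radialField N p) (x₀ := (u₀, v₀)) hR
    (fun s hs => (hL s hs.1).mono (prod_mono_right (subset_univ (Icc (-M) M))))
    (by
      have h3 : Continuous fun q : ℝ × ℝ × ℝ => nonlin p q.2.1 :=
        (continuous_nonlin hp1).comp (by fun_prop)
      have h4 : ContinuousOn (fun q : ℝ × ℝ × ℝ => -(((N : ℝ) - 1) / q.1 * q.2.2))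
          (Icc s₀ R ×ˢ (Icc 0 M ×ˢ Icc (-M) M)) := by
        have h5 : ∀ q ∈ Icc s₀ R ×ˢ (Icc (0 : ℝ) M ×ˢ Icc (-M) M), q.1 ≠ 0 :=
          fun q hq => (hs₀.trans_le hq.1.1).ne'
        fun_prop (disch := assumption)
      have h6 : Continuous fun q : ℝ × ℝ × ℝ => q.2.2 := by fun_prop
      exact h6.continuousOn.prodMk (h4.sub h3.continuousOn))
    ⟨⟨hu₀.le, h1.le⟩, abs_le.1 h2.le⟩ hap
  refine ⟨X, hX0, fun s hs => ⟨(hX s hs).1, ?_⟩⟩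
  have hsub : Icc s₀ s ⊆ Icc s₀ R := Icc_subset_Icc_right hs.2
  exact (hap s hs X hX0 (fun t ht => (hX t (hsub ht)).1.mono hsub)
    fun t ht => (hX t (hsub ht)).2).1.1

/-- The singular solution exists on `(0, R)` for every `R`. -/
theorem exists_singular_on_Ioo (hN : 3 ≤ N) (hp : pS N < p) (R : ℝ) :
    ∃ u v : ℝ → ℝ, IsRadialSol N p u v (Ioo 0 R) ∧ (∀ s ∈ Ioo 0 R, 0 < u s) ∧
      Tendsto (fun s => s ^ theta p * u s) (𝓝[>] 0) (𝓝 (ampl p N)) ∧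
      Tendsto (fun s => s ^ theta p * s * v s) (𝓝[>] 0) (𝓝 (-(theta p * ampl p N))) := by
  have hp1 := one_lt_of_pS_lt hN hp
  obtain ⟨R₀, hR₀, u, v, hsol, hpos, hlu, hlv⟩ := exists_local_singular hN hp
  have hmem : Ioo 0 R₀ ∈ 𝓝[>] (0 : ℝ) := Ioo_mem_nhdsGT hR₀
  obtain ⟨s₀, hs₀P, hs₀⟩ := ((eventually_pohozaev_neg hN hp
    (by filter_upwards [hmem] with s hs using hpos s hs) hlu hlv).and hmem).exists
  set R₁ := max R R₀ with hR₁
  obtain ⟨X, hX0, hX⟩ := exists_forward_solution hN hp (R := R₁) hs₀.1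
    (hs₀.2.le.trans (le_max_right _ _)) (hpos s₀ hs₀) hs₀P
  have hXsol : IsRadialSol N p (fun s => (X s).1) (fun s => (X s).2) (Ioo s₀ R₁) := fun t ht =>
    have := (hX t (Ioo_subset_Icc_self ht)).1.hasDerivAt (Icc_mem_nhds ht.1 ht.2)
    ⟨hasDerivAt_fst_of_prod this, hasDerivAt_snd_of_prod this⟩
  have hXc : ContinuousOn X (Icc s₀ R₁) := fun t ht => (hX t ht).1.continuousWithinAt
  have hagree : ∀ s ∈ Ioo s₀ R₀, (u s, v s) = X s := by
    intro s hs
    have hsub : Icc s₀ s ⊆ Ioo 0 R₀ := fun t ht => ⟨hs₀.1.trans_le ht.1, ht.2.trans_lt hs.2⟩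
    have hsub' : Icc s₀ s ⊆ Icc s₀ R₁ :=
      Icc_subset_Icc_right (hs.2.le.trans (le_max_right _ _))
    have huv : ContinuousOn (fun s => (u s, v s)) (Icc s₀ s) := fun t ht =>
      ((hsol t (hsub ht)).1.prodMk (hsol t (hsub ht)).2).continuousAt.continuousWithinAt
    obtain ⟨M₁, hM₁⟩ := isCompact_Icc.bddAbove_image
      (continuous_fst.comp_continuousOn huv)
    obtain ⟨M₂, hM₂⟩ := isCompact_Icc.bddAbove_image
      (continuous_fst.comp_continuousOn (hXc.mono hsub'))
    obtain ⟨L, hL⟩ := exists_lipschitzOnWith_radialField N hp1 (max M₁ M₂) hs₀.1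
    refine ODE_solution_unique_of_mem_Icc_right (v := radialField N p)
      (s := fun _ => Icc 0 (max M₁ M₂) ×ˢ univ) (fun t ht => hL t ht.1) huv ?_ ?_
      (hXc.mono hsub') ?_ ?_ hX0.symm (right_mem_Icc.2 hs.1.le)
    · intro t ht
      have ht' := hsub (Ico_subset_Icc_self ht)
      exact ((hsol t ht').1.prodMk (hsol t ht').2).hasDerivWithinAt
    · intro t ht
      have ht' := Ico_subset_Icc_self ht
      exact ⟨⟨(hpos t (hsub ht')).le,
        (hM₁ (mem_image_of_mem _ ht')).trans (le_max_left _ _)⟩, mem_univ _⟩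
    · intro t ht
      have ht' := hsub' (Ico_subset_Icc_self ht)
      refine (hX t ht').1.mono_of_mem_nhdsWithin ?_
      exact mem_of_superset (Icc_mem_nhdsGE (ht.2.trans_le (hsub' (right_mem_Icc.2 hs.1.le)).2))
        (Icc_subset_Icc_left ht.1)
    · intro t ht
      have ht' := Ico_subset_Icc_self ht
      exact ⟨⟨(hX t (hsub' ht')).2.le,
        (hM₂ (mem_image_of_mem _ ht')).trans (le_max_right _ _)⟩, mem_univ _⟩
  -- The pieces are glued at a point inside the overlap `(s₀, R₀)`, so that near every point the
  -- result coincides with one of the two solutions.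
  obtain ⟨m, hm1, hm2⟩ := exists_between hs₀.2
  set U : ℝ → ℝ := fun s => if s < m then u s else (X s).1 with hU
  set V : ℝ → ℝ := fun s => if s < m then v s else (X s).2 with hV
  have hl : ∀ s ∈ Ioo 0 R₀, U s = u s ∧ V s = v s := by
    intro s hs
    by_cases h : s < m
    · simp [hU, hV, h]
    · have := hagree s ⟨hm1.trans_le (not_lt.1 h), hs.2⟩
      simp [hU, hV, h, ← this]
  have hr : ∀ s ∈ Ioo s₀ R₁, U s = (X s).1 ∧ V s = (X s).2 := by
    intro s hs
    by_cases h : s < m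
    · have := hagree s ⟨hs.1, h.trans hm2⟩
      simp [hU, hV, h, ← this]
    · simp [hU, hV, h]
  have hcases : ∀ s ∈ Ioo 0 R, s ∈ Ioo 0 R₀ ∨ s ∈ Ioo s₀ R₁ := by
    intro s hs
    rcases lt_or_ge s R₀ with h | h
    · exact Or.inl ⟨hs.1, h⟩
    · exact Or.inr ⟨hs₀.2.trans_le h, hs.2.trans_le (le_max_left _ _)⟩
  have hlsol := hsol.congr isOpen_Ioo (fun s hs => (hl s hs).1) (fun s hs => (hl s hs).2)
  have hrsol := hXsol.congr isOpen_Ioo (fun s hs => (hr s hs).1) (fun s hs => (hr s hs).2)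
  refine ⟨U, V, fun s hs => ?_, fun s hs => ?_, hlu.congr' ?_, hlv.congr' ?_⟩
  · rcases hcases s hs with h | h
    · exact hlsol s h
    · exact hrsol s h
  · rcases hcases s hs with h | h
    · rw [(hl s h).1]; exact hpos s h
    · rw [(hr s h).1]; exact (hX s (Ioo_subset_Icc_self h)).2
  · filter_upwards [hmem] with s hs
    rw [(hl s hs).1]
  · filter_upwards [hmem] with s hs
    rw [(hl s hs).2]

/-- The singular solution on `(0, ∞)`. -/
theorem exists_global_singular (hN : 3 ≤ N) (hp : pS N < p) :
    ∃ u v : ℝ → ℝ, IsRadialSol N p u v (Ioi 0) ∧ (∀ s ∈ Ioi (0 : ℝ), 0 < u s) ∧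
      Tendsto (fun s => s ^ theta p * u s) (𝓝[>] 0) (𝓝 (ampl p N)) ∧
      Tendsto (fun s => s ^ theta p * s * v s) (𝓝[>] 0) (𝓝 (-(theta p * ampl p N))) := by
  choose u v hsol hpos hlu hlv using exists_singular_on_Ioo hN hp
  have hmono : ∀ R R', 0 < R → R ≤ R' →
      EqOn (u R) (u R') (Ioo 0 R) ∧ EqOn (v R) (v R') (Ioo 0 R) := by
    intro R R' hR hRR
    have hsub : Ioo 0 R ⊆ Ioo 0 R' := Ioo_subset_Ioo_right hRR
    exact IsRadialSol.eqOn_of_profile hN hp hR (hsol R) ((hsol R').mono hsub) (hpos R)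
      (fun s hs => hpos R' s (hsub hs)) (hlu R) (hlu R')
  -- By uniqueness the solutions on different intervals are compatible, so the diagonal value `u (s
  -- + 1) s` defines the global solution.
  have heq : ∀ R, ∀ s ∈ Ioo 0 R, u (s + 1) s = u R s ∧ v (s + 1) s = v R s := by
    intro R s hs
    have h1 : s ∈ Ioo 0 (s + 1) := ⟨hs.1, by linarith⟩
    rcases le_total (s + 1) R with h | h
    · have := hmono _ _ (by linarith [hs.1]) h
      exact ⟨this.1 h1, this.2 h1⟩
    · have := hmono _ _ (hs.1.trans hs.2) h
      exact ⟨(this.1 hs).symm, (this.2 hs).symm⟩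
  have hmem : Ioo 0 1 ∈ 𝓝[>] (0 : ℝ) := Ioo_mem_nhdsGT one_pos
  refine ⟨fun s => u (s + 1) s, fun s => v (s + 1) s, fun s hs => ?_,
    fun s hs => hpos (s + 1) s ⟨hs, by linarith⟩, (hlu 1).congr' ?_, (hlv 1).congr' ?_⟩
  · exact (hsol (s + 1)).congr isOpen_Ioo (fun t ht => (heq (s + 1) t ht).1)
      (fun t ht => (heq (s + 1) t ht).2) s ⟨hs, by linarith⟩
  · filter_upwards [hmem] with s hs
    rw [(heq 1 s hs).1]
  · filter_upwards [hmem] with s hs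
    rw [(heq 1 s hs).2]

end continuation

/-! ### Oscillation -/

/-- A solution of `y'' + (n / s) y' + c y ≤ 0` with `c > 0` cannot stay positive. -/
theorem not_forall_pos_of_radial_sturm {y y' y'' : ℝ → ℝ} {n c s₀ : ℝ} (hs₀ : 0 < s₀)
    (hc : 0 < c) (hy : ∀ s ≥ s₀, HasDerivAt y (y' s) s)
    (hy' : ∀ s ≥ s₀, HasDerivAt y' (y'' s) s)
    (hle : ∀ s ≥ s₀, y'' s ≤ -(n / s * y' s) - c * y s) : ¬ ∀ s ≥ s₀, 0 < y s := by
  intro hpos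
  set k := n / 2 with hk
  -- Riccati variable; the shift `k / s` with `k = n / 2` completes the square and removes the
  -- first-order term. For `s ≥ S` the leftover `(k² - k) / s²` is at most `c / 2`, so `h' ≤ -m (1 +
  -- h²)` and `arctan h` falls at rate at least `m`, which a bounded function cannot do forever.
  set h : ℝ → ℝ := fun s => y' s / y s + k / s with hh
  set S := max s₀ (max 1 (2 * (k ^ 2 + |k|) / c)) with hS
  set m := min 1 (c / 2) with hm
  have hm0 : 0 < m := by positivity
  have hderiv : ∀ s ≥ S, HasDerivAt h ((y'' s * y s - y' s * y' s) / y s ^ 2 - k / s ^ 2) s := by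
    intro s hs
    have hss : s ≥ s₀ := (le_max_left _ _).trans hs
    have hs0 : s ≠ 0 := (hs₀.trans_le hss).ne'
    refine (((hy' s hss).div (hy s hss) (hpos s hss).ne').add
      ((hasDerivAt_const s k).div (hasDerivAt_id s) hs0)).congr_deriv ?_
    simp
    ring
  have hbound : ∀ s ≥ S, (y'' s * y s - y' s * y' s) / y s ^ 2 - k / s ^ 2
      ≤ -(m * (1 + h s ^ 2)) := by
    intro s hs
    have hss : s ≥ s₀ := (le_max_left _ _).trans hs
    have hs0 : 0 < s := hs₀.trans_le hss
    have hs1 : 1 ≤ s := (le_max_left _ _).trans ((le_max_right _ _).trans hs)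
    have hs2 : 2 * (k ^ 2 + |k|) / c ≤ s := (le_max_right _ _).trans ((le_max_right _ _).trans hs)
    have hys := hpos s hss
    have e1 : (y'' s * y s - y' s * y' s) / y s ^ 2 = y'' s / y s - (y' s / y s) ^ 2 := by
      field_simp
    have e2 : y'' s / y s ≤ -(n / s * (y' s / y s)) - c := by
      rw [div_le_iff₀ hys]
      refine (hle s hss).trans (le_of_eq ?_)
      field_simp
    have e3 : (k ^ 2 - k) / s ^ 2 ≤ c / 2 := by
      rw [div_le_div_iff₀ (by positivity) two_pos]
      rw [div_le_iff₀ hc] at hs2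
      have h1 := neg_abs_le k
      have h2 : c * s ≤ c * s ^ 2 := by
        nlinarith [mul_nonneg hc.le (mul_nonneg hs0.le (sub_nonneg.2 hs1))]
      linarith
    have e4 : -(n / s * (y' s / y s)) - (y' s / y s) ^ 2 - k / s ^ 2
        = -h s ^ 2 + (k ^ 2 - k) / s ^ 2 := by
      simp only [hh, hk]
      field_simp
      ring
    have h1 : m ≤ 1 := min_le_left _ _
    have h2 : m ≤ c / 2 := min_le_right _ _
    nlinarith [sq_nonneg (h s)]
  have hanti := antitoneOn_of_hasDerivAt_nonpos (convex_Ici S)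
    (φ := fun s => Real.arctan (h s) + m * s)
    (φ' := fun s => 1 / (1 + h s ^ 2) *
      ((y'' s * y s - y' s * y' s) / y s ^ 2 - k / s ^ 2) + m * 1)
    (fun s hs => ((hderiv s hs).arctan.continuousAt.add (by fun_prop)).continuousWithinAt)
    (fun s hs => (hderiv s (interior_subset hs)).arctan.add ((hasDerivAt_id s).const_mul m))
    (fun s hs => by
      have h1 : 0 < 1 + h s ^ 2 := by positivity
      have h2 := hbound s (interior_subset hs)
      have h3 : 1 / (1 + h s ^ 2) *
        ((y'' s * y s - y' s * y' s) / y s ^ 2 - k / s ^ 2) ≤ -m := by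
        rw [one_div, inv_mul_le_iff₀ h1]
        linarith
      linarith)
  have hb : 0 < (Real.pi + 1) / m := div_pos (by linarith [Real.pi_pos]) hm0
  have h1 := hanti (mem_Ici.2 le_rfl) (mem_Ici.2 (by linarith : S ≤ S + (Real.pi + 1) / m))
    (by linarith)
  simp only [mul_add, mul_div_cancel₀ _ hm0.ne'] at h1
  have h2 := Real.neg_pi_div_two_lt_arctan (h (S + (Real.pi + 1) / m))
  have h3 := Real.arctan_lt_pi_div_two (h S)
  linarith

/-! ### Linear bounds for the nonlinearity on both sides of the level 1 -/

section nonlinearity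

variable {p : ℝ}

/-- Bernoulli's inequality, giving the Sturm hypothesis for `u - 1` where `u > 1`. -/
lemma mul_sub_one_le_nonlin (hp : 1 < p) {u : ℝ} (hu : 0 ≤ u) :
    (p - 1) * (u - 1) ≤ nonlin p u := by
  have h := one_add_mul_self_le_rpow_one_add (s := u - 1) (by linarith) hp.le
  rw [add_sub_cancel] at h
  unfold nonlin
  linarith

/-- Write `f(u) = -u (1 - u ^ (p - 1))` and bound the bracket below by `min 1 (p - 1) * (1 - u)`.
The factor `u` is why a lower bound `m` is required: `f` vanishes at 0 as well. -/
lemma exists_nonlin_le_of_le (hp : 1 < p) {m : ℝ} (hm : 0 < m) :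
    ∃ c > 0, ∀ u : ℝ, m ≤ u → u < 1 → nonlin p u ≤ -(c * (1 - u)) := by
  refine ⟨m * min 1 (p - 1), mul_pos hm (lt_min one_pos (by linarith)), fun u hmu hu => ?_⟩
  have hu0 : 0 < u := hm.trans_le hmu
  have h1 : u ^ p = u * u ^ (p - 1) := by
    rw [← Real.rpow_one_add' hu0.le (by linarith)]; ring_nf
  have h2 : min 1 (p - 1) * (1 - u) ≤ 1 - u ^ (p - 1) := by
    rcases le_total 1 (p - 1) with h | h
    · rw [min_eq_left h]
      have := Real.rpow_le_rpow_of_exponent_ge hu0 hu.le h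
      rw [Real.rpow_one] at this
      linarith
    · rw [min_eq_right h]
      have := rpow_one_add_le_one_add_mul_self (s := u - 1) (by linarith) (by linarith) h
      rw [add_sub_cancel] at this
      linarith
  have h3 : 0 ≤ min 1 (p - 1) * (1 - u) :=
    mul_nonneg (le_min zero_le_one (by linarith)) (by linarith)
  have h4 := mul_le_mul hmu h2 h3 hu0.le
  unfold nonlin
  rw [h1]
  linarith

lemma nonlin_one : nonlin p 1 = 0 := by simp [nonlin]

/-- The sign `σ` records the side of the level 1, so that arcs above and below can be treated
together. -/
lemma mul_nonlin_pos (hp : 1 < p) {σ u : ℝ} (hσ : σ = 1 ∨ σ = -1) (hu : 0 < u)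
    (h : 0 < σ * (u - 1)) : 0 < σ * nonlin p u := by
  rcases hσ with rfl | rfl
  · have := mul_sub_one_le_nonlin hp hu.le
    nlinarith
  · obtain ⟨c, hc, h2⟩ := exists_nonlin_le_of_le hp hu
    have := h2 u le_rfl (by linarith)
    nlinarith

end nonlinearity

/-! ### Excluding solutions that stay on one side of the level 1 -/

section oscillation

variable {N : ℕ} {p : ℝ} {u v : ℝ → ℝ}

lemma IsRadialSol.not_forall_one_lt (hp : 1 < p) (hsol : IsRadialSol N p u v (Ioi 0)) {s₀ : ℝ}
    (hs₀ : 0 < s₀) : ¬ ∀ s ≥ s₀, 1 < u s := by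
  intro h
  have hI : ∀ s ≥ s₀, s ∈ Ioi (0 : ℝ) := fun s hs => hs₀.trans_le hs
  refine not_forall_pos_of_radial_sturm (y := fun s => u s - 1) (y' := v) (n := (N : ℝ) - 1)
    (c := p - 1) hs₀ (by linarith) (fun s hs => (hsol s (hI s hs)).1.sub_const 1)
    (fun s hs => (hsol s (hI s hs)).2) (fun s hs => ?_) fun s hs => sub_pos.2 (h s hs)
  have := mul_sub_one_le_nonlin hp (u := u s) (by linarith [h s hs])
  linarith

lemma IsRadialSol.not_forall_lt_one (hp : 1 < p) (hsol : IsRadialSol N p u v (Ioi 0)) {s₀ m : ℝ}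
    (hs₀ : 0 < s₀) (hm : 0 < m) (hmu : ∀ s ≥ s₀, m ≤ u s) : ¬ ∀ s ≥ s₀, u s < 1 := by
  intro h
  have hI : ∀ s ≥ s₀, s ∈ Ioi (0 : ℝ) := fun s hs => hs₀.trans_le hs
  obtain ⟨c, hc, hcu⟩ := exists_nonlin_le_of_le hp hm
  refine not_forall_pos_of_radial_sturm (y := fun s => 1 - u s) (y' := fun s => -v s)
    (n := (N : ℝ) - 1) hs₀ hc (fun s hs => (hsol s (hI s hs)).1.const_sub 1)
    (fun s hs => (hsol s (hI s hs)).2.neg) (fun s hs => ?_) fun s hs => sub_pos.2 (h s hs)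
  have := hcu (u s) (hmu s hs) (h s hs)
  linarith

lemma IsRadialSol.antitoneOn_pohozaev (hN : 3 ≤ N) (hp : pS N < p)
    (hsol : IsRadialSol N p u v (Ioi 0)) (hpos : ∀ s ∈ Ioi (0 : ℝ), 0 < u s) :
    AntitoneOn (fun s => pohozaev N p s (u s) (v s)) (Ioi 0) := by
  have hp1 := one_lt_of_pS_lt hN hp
  have hd := fun s (hs : s ∈ Ioi (0 : ℝ)) =>
    hsol.hasDerivAt_pohozaev (by omega) hp1 hs (mem_Ioi.1 hs).ne'
  refine antitoneOn_of_hasDerivAt_nonpos (convex_Ioi 0)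
    (fun s hs => (hd s hs).continuousAt.continuousWithinAt)
    (fun s hs => hd s (interior_subset hs)) fun s hs => ?_
  have hs0 : 0 < s := interior_subset (s := Ioi (0 : ℝ)) hs
  exact mul_nonpos_of_nonneg_of_nonpos (by positivity)
    (pohozaev_deriv_nonpos hN hp (hpos s hs0).le)

lemma IsRadialSol.antitoneOn_energy (hN : 1 ≤ N) (hp : 1 < p)
    (hsol : IsRadialSol N p u v (Ioi 0)) :
    AntitoneOn (fun s => energy p (u s) (v s)) (Ioi 0) := by
  have hN' : (1 : ℝ) ≤ N := by exact_mod_cast hN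
  have hd := fun s (hs : s ∈ Ioi (0 : ℝ)) => hsol.hasDerivAt_energy hp hs
  refine antitoneOn_of_hasDerivAt_nonpos (convex_Ioi 0)
    (fun s hs => (hd s hs).continuousAt.continuousWithinAt)
    (fun s hs => hd s (interior_subset hs)) fun s hs => ?_
  have hs0 : 0 < s := interior_subset (s := Ioi (0 : ℝ)) hs
  exact neg_nonpos.2 (mul_nonneg (div_nonneg (by linarith) hs0.le) (sq_nonneg _))

/-- A decreasing solution that tends to zero decays exponentially. -/
lemma IsRadialSol.exists_exp_decay (hN : 1 ≤ N) (hp : 1 < p)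
    (hsol : IsRadialSol N p u v (Ioi 0)) (hpos : ∀ s ∈ Ioi (0 : ℝ), 0 < u s) {s₀ : ℝ}
    (hs₀ : 0 < s₀) (hv : ∀ s ≥ s₀, v s < 0) (hsmall : ∀ s ≥ s₀, u s ^ (p - 1) ≤ 1 / 2) :
    ∃ C k : ℝ, 0 < k ∧ ∀ s ≥ s₀, u s ≤ C * Real.exp (-k * s) := by
  have hN' : (1 : ℝ) ≤ N := by exact_mod_cast hN
  -- With `u ^ (p - 1) ≤ 1 / 2` one has `-f(u) ≥ u / 2 = k² u`. Hence `w = v + k u` satisfies `w' ≥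
  -- k w`, and the aim is `w ≤ 0`, which gives decay at rate `k`.
  set k := √(1 / 2) with hk
  have hk0 : 0 < k := Real.sqrt_pos.2 (by norm_num)
  have hk2 : k * k = 1 / 2 := Real.mul_self_sqrt (by norm_num)
  have hI : ∀ s ≥ s₀, s ∈ Ioi (0 : ℝ) := fun s hs => hs₀.trans_le hs
  have hexp : ∀ c s : ℝ, HasDerivAt (fun s => Real.exp (c * s)) (Real.exp (c * s) * c) s := by
    intro c s
    simpa using ((hasDerivAt_id s).const_mul c).exp
  have hua : AntitoneOn u (Ici s₀) := antitoneOn_of_hasDerivAt_nonpos (convex_Ici s₀)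
    (fun s hs => (hsol s (hI s hs)).1.continuousAt.continuousWithinAt)
    (fun s hs => (hsol s (hI s (interior_subset hs))).1)
    fun s hs => (hv s (interior_subset hs)).le
  have hw : AntitoneOn (fun s => Real.exp (-k * s) * -(v s + k * u s)) (Ici s₀) := by
    have hd := fun s (hs : s ≥ s₀) => (hexp (-k) s).mul
      (((hsol s (hI s hs)).2.add ((hsol s (hI s hs)).1.const_mul k)).neg)
    refine antitoneOn_of_hasDerivAt_nonpos (convex_Ici s₀)
      (fun s hs => (hd s hs).continuousAt.continuousWithinAt)
      (fun s hs => hd s (interior_subset hs)) fun s hs => ?_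
    have hs' : s ≥ s₀ := interior_subset hs
    have hs0 : 0 < s := hI s hs'
    have hu0 := hpos s hs0
    have h1 : u s ^ p = u s * u s ^ (p - 1) := by
      rw [← Real.rpow_one_add' hu0.le (by linarith)]; ring_nf
    have h2 : 0 ≤ ((N : ℝ) - 1) / s * -v s :=
      mul_nonneg (div_nonneg (by linarith) hs0.le) (by linarith [hv s hs'])
    have h3 := mul_le_mul_of_nonneg_left (hsmall s hs') hu0.le
    have h4 : k * k * u s = 1 / 2 * u s := by rw [hk2]
    have h5 : -k * -(v s + k * u s)
        - (-(((N : ℝ) - 1) / s * v s) - nonlin p (u s) + k * v s) ≤ 0 := by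
      unfold nonlin
      rw [h1]
      nlinarith
    have h6 := mul_nonpos_of_nonneg_of_nonpos (Real.exp_pos (-k * s)).le h5
    simp only [Pi.add_apply, Pi.neg_apply]
    refine le_trans (le_of_eq ?_) h6
    ring
  have hneg : ∀ s ≥ s₀, v s + k * u s ≤ 0 := by
    intro s hs
    by_contra! hcon
    set w := v s + k * u s with hwdef
    -- If `w > 0` at `s`, then at `s + d` it is at least `w (1 + k d) = w + k u(s)`, whereas `v < 0`
    -- and the monotonicity of `u` force it below `k u(s)`.
    set d := u s / w with hd
    have hs0 := hpos s (hI s hs)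
    have hd0 : 0 < d := div_pos hs0 hcon
    have h1 := hw hs (mem_Ici.2 (by linarith : s₀ ≤ s + d)) (by linarith)
    simp only [← hwdef] at h1
    have h2 : Real.exp (-k * (s + d)) = Real.exp (-k * s) * Real.exp (-(k * d)) := by
      rw [← Real.exp_add]; ring_nf
    rw [h2, mul_assoc] at h1
    have h3 := le_of_mul_le_mul_left h1 (Real.exp_pos _)
    have h4 : Real.exp (-(k * d)) * Real.exp (k * d) = 1 := by rw [← Real.exp_add]; simp
    have h5 : w * Real.exp (k * d) ≤ v (s + d) + k * u (s + d) := by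
      have := mul_le_mul_of_nonneg_right h3 (Real.exp_pos (k * d)).le
      have e : Real.exp (-(k * d)) * -(v (s + d) + k * u (s + d)) * Real.exp (k * d)
          = -(v (s + d) + k * u (s + d)) := by
        rw [mul_right_comm, h4, one_mul]
      rw [e] at this
      linarith
    have h6 := hv (s + d) (by linarith)
    have h7 : u (s + d) ≤ u s :=
      hua hs (mem_Ici.2 (by linarith : s₀ ≤ s + d)) (by linarith)
    have h8 := Real.add_one_le_exp (k * d)
    have h9 : w * d = u s := by rw [hd]; field_simp
    have h10 := mul_le_mul_of_nonneg_left h8 hcon.le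
    have h11 : w * (k * d + 1) = k * u s + w := by rw [← h9]; ring
    have h12 := mul_le_mul_of_nonneg_left h7 hk0.le
    linarith
  have hdec : AntitoneOn (fun s => Real.exp (k * s) * u s) (Ici s₀) := by
    have hd := fun s (hs : s ≥ s₀) => (hexp k s).mul (hsol s (hI s hs)).1
    refine antitoneOn_of_hasDerivAt_nonpos (convex_Ici s₀)
      (fun s hs => (hd s hs).continuousAt.continuousWithinAt)
      (fun s hs => hd s (interior_subset hs)) fun s hs => ?_
    have h1 := mul_nonpos_of_nonneg_of_nonpos (Real.exp_pos (k * s)).le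
      (hneg s (interior_subset hs))
    linarith
  refine ⟨Real.exp (k * s₀) * u s₀, k, hk0, fun s hs => ?_⟩
  have h1 := mul_le_mul_of_nonneg_right (hdec (mem_Ici.2 le_rfl) hs hs) (Real.exp_pos (-k * s)).le
  have h2 : Real.exp (k * s) * u s * Real.exp (-k * s) = u s := by
    rw [mul_right_comm, ← Real.exp_add]; simp
  simpa only [h2] using h1

/-- A solution with negative Pohozaev functional is not eventually decreasing to zero. -/
lemma IsRadialSol.not_decreasing_to_zero (hN : 3 ≤ N) (hp : pS N < p)
    (hsol : IsRadialSol N p u v (Ioi 0)) (hpos : ∀ s ∈ Ioi (0 : ℝ), 0 < u s) {s₀ : ℝ}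
    (hs₀ : 0 < s₀) (hP : pohozaev N p s₀ (u s₀) (v s₀) < 0) (hv : ∀ s ≥ s₀, v s < 0)
    (hsmall : ∀ s ≥ s₀, u s ^ (p - 1) ≤ 1 / 2) : False := by
  have hp1 := one_lt_of_pS_lt hN hp
  have hN' : (3 : ℝ) ≤ N := by exact_mod_cast hN
  obtain ⟨C, k, hk, hdec⟩ := hsol.exists_exp_decay (by omega) hp1 hpos hs₀ hv hsmall
  obtain ⟨M, hM, hMb⟩ := exists_bound_of_energy_le hp1 (energy p (u s₀) (v s₀))
  have hI : ∀ s ≥ s₀, s ∈ Ioi (0 : ℝ) := fun s hs => hs₀.trans_le hs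
  have hb : ∀ s ≥ s₀, u s < M ∧ |v s| < M := fun s hs =>
    hMb _ _ (hpos s (hI s hs)).le (hsol.antitoneOn_energy (by omega) hp1 hs₀ (hI s hs) hs)
  -- Every negative contribution to the functional contains a factor `u`, so exponential decay of
  -- `u` and mere boundedness of `u` and `v` give a lower bound that tends to 0.
  have hlow : ∀ s ≥ s₀, -(C * M / 2 * (s ^ N * Real.exp (-k * s))
      + ((N : ℝ) - 2) / 2 * M * C * (s ^ (N - 1) * Real.exp (-k * s)))
        ≤ pohozaev N p s (u s) (v s) := by
    intro s hs
    have hs0 : 0 < s := hI s hs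
    have hu0 := hpos s hs0
    obtain ⟨h1, h2⟩ := hb s hs
    have h3 : -(u s * M / 2) ≤ energy p (u s) (v s) := by
      have := div_nonneg (Real.rpow_nonneg hu0.le (p + 1)) (by linarith : 0 ≤ p + 1)
      unfold energy nonlinPrim
      nlinarith [sq_nonneg (v s)]
    have h4 : -(u s * M) ≤ u s * v s := by
      have := (abs_lt.1 h2).1
      nlinarith
    have h5 : -(u s * (s * M / 2 + ((N : ℝ) - 2) / 2 * M))
        ≤ s * energy p (u s) (v s) + ((N : ℝ) - 2) / 2 * u s * v s := by
      nlinarith [mul_le_mul_of_nonneg_left h3 hs0.le,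
        mul_le_mul_of_nonneg_left h4 (by linarith : 0 ≤ ((N : ℝ) - 2) / 2)]
    have h6 : 0 ≤ s * M / 2 + ((N : ℝ) - 2) / 2 * M := by
      have : 0 ≤ ((N : ℝ) - 2) / 2 := by linarith
      positivity
    have h7 := mul_le_mul_of_nonneg_right (hdec s hs) h6
    have hpw : 0 < s ^ (N - 1) := by positivity
    have h8 := mul_le_mul_of_nonneg_left
      (le_trans (neg_le_neg h7) h5) hpw.le
    have hsN : s ^ N = s ^ (N - 1) * s := by
      rw [← pow_succ]; congr 1; omega
    unfold pohozaev
    refine le_trans (le_of_eq ?_) h8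
    rw [hsN]
    ring
  have hlim : ∀ j : ℕ, Tendsto (fun s : ℝ => s ^ j * Real.exp (-k * s)) atTop (𝓝 0) := by
    intro j
    have := tendsto_rpow_mul_exp_neg_mul_atTop_nhds_zero j k hk
    simpa only [Real.rpow_natCast] using this
  have hto := (((hlim N).const_mul (C * M / 2)).add
    ((hlim (N - 1)).const_mul (((N : ℝ) - 2) / 2 * M * C))).neg
  simp only [mul_zero, add_zero, neg_zero] at hto
  obtain ⟨s, hs1, hs2⟩ := ((hto.eventually (lt_mem_nhds hP)).and (eventually_ge_atTop s₀)).exists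
  have h1 := hlow s hs2
  have h2 := hsol.antitoneOn_pohozaev hN hp hpos hs₀ (hI s hs2) hs2
  simp only at h2
  linarith

end oscillation

/-! ### Critical points of the singular solution -/

section critical

variable {N : ℕ} {p : ℝ} {u v : ℝ → ℝ}

/-- While `u - 1` keeps its sign, `s ^ (N - 1) v` is strictly monotone. -/
lemma IsRadialSol.strictAntiOn_pow_mul (hN : 1 ≤ N) (hp : 1 < p)
    (hsol : IsRadialSol N p u v (Ioi 0)) (hpos : ∀ s ∈ Ioi (0 : ℝ), 0 < u s) {σ : ℝ}
    (hσ : σ = 1 ∨ σ = -1) {D : Set ℝ} (hD : Convex ℝ D) (hD0 : D ⊆ Ioi 0)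
    (h : ∀ s ∈ interior D, 0 < σ * (u s - 1)) :
    StrictAntiOn (fun s => σ * (s ^ (N - 1) * v s)) D := by
  have hd := fun s (hs : s ∈ D) =>
    (hsol.hasDerivAt_pow_mul hN (hD0 hs) (mem_Ioi.1 (hD0 hs)).ne').const_mul σ
  refine strictAntiOn_of_hasDerivAt_neg hD
    (fun s hs => (hd s hs).continuousAt.continuousWithinAt)
    (fun s hs => hd s (interior_subset hs)) fun s hs => ?_
  have hs0 : 0 < s := hD0 (interior_subset hs)
  have h1 := mul_nonlin_pos hp hσ (hpos s hs0) (h s hs)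
  have h2 : 0 < s ^ (N - 1) * (σ * nonlin p (u s)) := by positivity
  linarith

/-- The weighted derivative starts from 0 at `a` and is strictly monotone, so the solution moves
towards the level 1 throughout the arc. -/
lemma IsRadialSol.mul_neg_of_critical (hN : 1 ≤ N) (hp : 1 < p)
    (hsol : IsRadialSol N p u v (Ioi 0)) (hpos : ∀ s ∈ Ioi (0 : ℝ), 0 < u s) {σ : ℝ}
    (hσ : σ = 1 ∨ σ = -1) {a b : ℝ} (ha : 0 < a) (hva : v a = 0)
    (h : ∀ s ∈ Ioo a b, 0 < σ * (u s - 1)) : ∀ s ∈ Ioc a b, σ * v s < 0 := by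
  intro s hs
  have hanti := hsol.strictAntiOn_pow_mul hN hp hpos hσ (convex_Icc a b)
    (fun t ht => ha.trans_le ht.1) (by rwa [interior_Icc])
  have h1 := hanti (left_mem_Icc.2 (hs.1.le.trans hs.2)) (Ioc_subset_Icc_self hs) hs.1
  simp only [hva, mul_zero] at h1
  have hs0 : 0 < s ^ (N - 1) := pow_pos (ha.trans hs.1) _
  by_contra! hcon
  have := mul_nonneg hs0.le hcon
  linarith

/-- After a critical point the solution returns to the level `1`. -/
lemma IsRadialSol.exists_crossing (hN : 1 ≤ N) (hp : 1 < p)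
    (hsol : IsRadialSol N p u v (Ioi 0)) (hpos : ∀ s ∈ Ioi (0 : ℝ), 0 < u s) {σ : ℝ}
    (hσ : σ = 1 ∨ σ = -1) {a : ℝ} (ha : 0 < a) (hva : v a = 0) (hua : 0 < σ * (u a - 1)) :
    ∃ t > a, u t = 1 ∧ (∀ s ∈ Ico a t, 0 < σ * (u s - 1)) ∧ ∀ s ∈ Ioc a t, σ * v s < 0 := by
  -- Sturm's argument on either side; below the level 1 the solution increases after `a`, so `u a`
  -- is the positive lower bound required.
  have hex : ∃ b ≥ a, σ * (u b - 1) ≤ 0 := by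
    by_contra! hcon
    rcases hσ with rfl | rfl
    · exact hsol.not_forall_one_lt hp ha fun s hs => by linarith [hcon s hs]
    · have hv : ∀ s > a, 0 < v s := fun s hs => by
        have := hsol.mul_neg_of_critical hN hp hpos (Or.inr rfl) ha hva
          (b := s) (fun t ht => hcon t ht.1.le) s ⟨hs, le_rfl⟩
        linarith
      have hmono : MonotoneOn u (Ici a) := by
        refine monotoneOn_of_deriv_nonneg (convex_Ici a)
          (fun s hs => (hsol s (ha.trans_le hs)).1.continuousAt.continuousWithinAt)
          (fun s hs => (hsol s (ha.trans_le
            (interior_subset hs))).1.differentiableAt.differentiableWithinAt) fun s hs => ?_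
        rw [interior_Ici] at hs
        rw [(hsol s (ha.trans hs)).1.deriv]
        exact (hv s hs).le
      exact hsol.not_forall_lt_one hp ha (hpos a ha)
        (fun s hs => hmono (mem_Ici.2 le_rfl) hs hs) fun s hs => by linarith [hcon s hs]
  obtain ⟨b, hab, hb⟩ := hex
  have hc : ContinuousOn (fun s => σ * (u s - 1)) (Icc a b) := fun s hs =>
    (((hsol s (ha.trans_le hs.1)).1.sub_const 1).const_mul σ).continuousAt.continuousWithinAt
  obtain ⟨t, ht, ht0, htpos⟩ := exists_first_zero hab hc hua hb
  refine ⟨t, ht.1, ?_, htpos, hsol.mul_neg_of_critical hN hp hpos hσ ha hva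
    fun s hs => htpos s (Ioo_subset_Ico_self hs)⟩
  rcases hσ with rfl | rfl <;> linarith

/-- After crossing the level `1` the solution has a critical point. -/
lemma IsRadialSol.exists_next_critical (hN : 3 ≤ N) (hp : pS N < p)
    (hsol : IsRadialSol N p u v (Ioi 0)) (hpos : ∀ s ∈ Ioi (0 : ℝ), 0 < u s)
    (hP : ∀ s ∈ Ioi (0 : ℝ), pohozaev N p s (u s) (v s) < 0) {σ : ℝ}
    (hσ : σ = 1 ∨ σ = -1) {t : ℝ} (ht : 0 < t) (hut : u t = 1) (hvt : σ * v t < 0) :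
    ∃ b > t, v b = 0 ∧ (∀ s ∈ Ico t b, σ * v s < 0) ∧ ∀ s ∈ Ioc t b, σ * (u s - 1) < 0 := by
  have hp1 := one_lt_of_pS_lt hN hp
  have hside : ∀ b, (∀ s ∈ Ico t b, σ * v s < 0) → ∀ s ∈ Ioc t b, σ * (u s - 1) < 0 := by
    intro b hb s hs
    have hd : ∀ s ≥ t, HasDerivAt (fun s => σ * (u s - 1)) (σ * v s) s := fun s hs =>
      ((hsol s (ht.trans_le hs)).1.sub_const 1).const_mul σ
    have := strictAntiOn_of_hasDerivAt_neg (convex_Icc t b)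
      (fun s hs => (hd s hs.1).continuousAt.continuousWithinAt)
      (fun s hs => hd s (interior_subset hs).1)
      (fun s hs => by rw [interior_Icc] at hs; exact hb s (Ioo_subset_Ico_self hs))
      (left_mem_Icc.2 (hs.1.le.trans hs.2)) (Ioc_subset_Icc_self hs) hs.1
    simpa [hut] using this
  -- Without a critical point `u` would stay monotone on one side of 1. Sturm's argument excludes
  -- this above 1, and below 1 if `u` stays above the threshold `m`; otherwise `u` falls under `m`,
  -- where `u ^ (p - 1) ≤ 1 / 2`, and the Pohozaev functional excludes it. The start `t + 1` is used
  -- because `u t = 1` is not strictly on one side.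
  have hex : ∃ b ≥ t, 0 ≤ σ * v b := by
    by_contra! hcon
    have hall : ∀ s > t, σ * (u s - 1) < 0 := fun s hs =>
      hside s (fun r hr => hcon r hr.1) s ⟨hs, le_rfl⟩
    rcases hσ with rfl | rfl
    · have hua : AntitoneOn u (Ici t) := antitoneOn_of_hasDerivAt_nonpos (convex_Ici t)
        (fun s hs => (hsol s (ht.trans_le hs)).1.continuousAt.continuousWithinAt)
        (fun s hs => (hsol s (ht.trans_le (interior_subset hs))).1)
        fun s hs => by linarith [hcon s (interior_subset hs)]
      set m : ℝ := (1 / 2) ^ (1 / (p - 1)) with hm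
      have hm0 : 0 < m := Real.rpow_pos_of_pos (by norm_num) _
      by_cases hlow : ∀ s ≥ t + 1, m ≤ u s
      · exact hsol.not_forall_lt_one hp1 (by linarith) hm0 hlow fun s hs => by
          linarith [hall s (by linarith)]
      · push Not at hlow
        obtain ⟨s₀, hs₀, hlt⟩ := hlow
        have hs₀t : t ≤ s₀ := by linarith
        refine hsol.not_decreasing_to_zero hN hp hpos (s₀ := s₀) (ht.trans_le hs₀t)
          (hP s₀ (ht.trans_le hs₀t)) (fun s hs => by linarith [hcon s (hs₀t.trans hs)])
          fun s hs => ?_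
        have h1 : u s ≤ m := (hua hs₀t (hs₀t.trans hs) hs).trans hlt.le
        have h2 : m ^ (p - 1) = 1 / 2 := by
          rw [hm, ← Real.rpow_mul (by norm_num), one_div_mul_cancel (by linarith), Real.rpow_one]
        rw [← h2]
        exact Real.rpow_le_rpow (hpos s (ht.trans_le (hs₀t.trans hs))).le h1 (by linarith)
    · exact hsol.not_forall_one_lt hp1 (s₀ := t + 1) (by linarith) fun s hs => by
        linarith [hall s (by linarith)]
  obtain ⟨b, htb, hb⟩ := hex
  have hc : ContinuousOn (fun s => -(σ * v s)) (Icc t b) := fun s hs =>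
    ((hsol s (ht.trans_le hs.1)).2.const_mul σ).neg.continuousAt.continuousWithinAt
  obtain ⟨c, hc, hc0, hcpos⟩ := exists_first_zero htb hc (by linarith) (by linarith)
  have hneg : ∀ s ∈ Ico t c, σ * v s < 0 := fun s hs => by linarith [hcpos s hs]
  refine ⟨c, hc.1, ?_, hneg, hside c hneg⟩
  rcases hσ with rfl | rfl <;> linarith

/-- A critical point of a nonconstant solution is not at the level `1`. -/
lemma IsRadialSol.ne_one_of_critical (hp : 1 < p)
    (hsol : IsRadialSol N p u v (Ioi 0)) (hpos : ∀ s ∈ Ioi (0 : ℝ), 0 < u s)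
    (hinf : Tendsto u (𝓝[>] 0) atTop) {s : ℝ} (hs : 0 < s) (hv : v s = 0) : u s ≠ 1 := by
  intro hu
  have hconst : IsRadialSol N p (fun _ => 1) (fun _ => 0) (Ioo 0 (s + 1)) := fun t _ =>
    ⟨hasDerivAt_const t 1, by simpa [nonlin_one] using hasDerivAt_const t (0 : ℝ)⟩
  have heq := (IsRadialSol.eqOn hp le_rfl (hsol.mono Ioo_subset_Ioi_self) hconst
    (fun t ht => (hpos t ht.1).le) (fun _ _ => zero_le_one) (t₀ := s) ⟨hs, by linarith⟩ hu hv).1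
  have hmem : Ioo 0 (s + 1) ∈ 𝓝[>] (0 : ℝ) := Ioo_mem_nhdsGT (by linarith)
  obtain ⟨t, ht1, ht2⟩ := ((hinf.eventually_gt_atTop 1).and hmem).exists
  exact ht1.ne' (heq ht2)

/-- From one critical point (or the origin) to the next one. -/
lemma IsRadialSol.exists_next (hN : 3 ≤ N) (hp : pS N < p)
    (hsol : IsRadialSol N p u v (Ioi 0)) (hpos : ∀ s ∈ Ioi (0 : ℝ), 0 < u s)
    (hP : ∀ s ∈ Ioi (0 : ℝ), pohozaev N p s (u s) (v s) < 0)
    (hinf : Tendsto u (𝓝[>] 0) atTop) {a : ℝ} (ha : a = 0 ∨ (0 < a ∧ v a = 0)) :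
    ∃ b > a, v b = 0 ∧ (∀ s ∈ Ioo a b, v s ≠ 0) ∧
      ∃ t ∈ Ioc a b, u t = 1 ∧ ∀ r ∈ Ioc a b, u r = 1 → r = t := by
  have hp1 := one_lt_of_pS_lt hN hp
  have hcross : ∃ σ : ℝ, (σ = 1 ∨ σ = -1) ∧ ∃ t > a, u t = 1 ∧
      (∀ s ∈ Ioo a t, 0 < σ * (u s - 1)) ∧ ∀ s ∈ Ioc a t, σ * v s < 0 := by
    rcases ha with rfl | ⟨ha, hva⟩
    · have hc : ContinuousOn u (Ioi 0) := fun s hs =>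
        (hsol s hs).1.continuousAt.continuousWithinAt
      have hev := hinf.eventually_gt_atTop 1
      rw [eventually_nhdsWithin_iff, Metric.eventually_nhds_iff] at hev
      obtain ⟨ε, hε, hev⟩ := hev
      have hbig : ∀ s ∈ Ioo 0 ε, 1 < u s := fun s hs =>
        hev (by rw [Real.dist_eq, sub_zero, abs_of_pos hs.1]; exact hs.2) hs.1
      have hε2 : ε / 2 ∈ Ioo 0 ε := ⟨by linarith, by linarith⟩
      obtain ⟨b, hb, hub⟩ : ∃ b ≥ ε / 2, u b ≤ 1 := by
        by_contra! hcon
        exact hsol.not_forall_one_lt hp1 hε2.1 hcon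
      obtain ⟨t, ht, hut, htpos⟩ := exists_first_zero (φ := fun s => u s - 1) hb
        ((hc.mono fun s hs => hε2.1.trans_le hs.1).sub continuousOn_const)
        (by linarith [hbig _ hε2]) (by linarith)
      have ht0 : 0 < t := hε2.1.trans ht.1
      have hgt : ∀ s ∈ Ioo 0 t, 0 < 1 * (u s - 1) := by
        intro s hs
        rw [one_mul]
        rcases lt_or_ge s (ε / 2) with h | h
        · linarith [hbig s ⟨hs.1, by linarith⟩]
        · exact htpos s ⟨h, hs.2⟩
      refine ⟨1, Or.inl rfl, t, ht0, by linarith, hgt, fun s hs => ?_⟩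
      -- If `v s ≥ 0`, monotonicity of `r ^ (N - 1) v r` makes `v` positive on all of `(0, s)`; then
      -- `u` increases there, contrary to its blow-up at the origin.
      by_contra! hcon
      have hanti := hsol.strictAntiOn_pow_mul (by omega) hp1 hpos (Or.inl rfl)
        (convex_Ioc 0 t) (fun s hs => hs.1) (by rwa [interior_Ioc])
      have hvpos : ∀ r ∈ Ioo 0 s, 0 < v r := by
        intro r hr
        have h1 := hanti ⟨hr.1, hr.2.le.trans hs.2⟩ hs hr.2
        simp only [one_mul] at h1 hcon
        have h2 : 0 ≤ s ^ (N - 1) * v s := mul_nonneg (pow_nonneg hs.1.le _) hcon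
        exact pos_of_mul_pos_right (h2.trans_lt h1) (pow_nonneg hr.1.le _)
      have hmono : MonotoneOn u (Ioc 0 s) := by
        refine monotoneOn_of_deriv_nonneg (convex_Ioc 0 s) (hc.mono Ioc_subset_Ioi_self)
          (fun r hr => (hsol r
            (interior_subset hr).1).1.differentiableAt.differentiableWithinAt) fun r hr => ?_
        rw [interior_Ioc] at hr
        rw [(hsol r hr.1).1.deriv]
        exact (hvpos r hr).le
      have hmem : Ioo 0 s ∈ 𝓝[>] (0 : ℝ) := Ioo_mem_nhdsGT hs.1
      obtain ⟨r, hr1, hr2⟩ := ((hinf.eventually_gt_atTop (u s)).and hmem).exists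
      exact absurd (hmono ⟨hr2.1, hr2.2.le⟩ ⟨hs.1, le_rfl⟩ hr2.2.le) (not_le.2 hr1)
    · rcases lt_or_gt_of_ne (hsol.ne_one_of_critical hp1 hpos hinf ha hva) with h | h
      · obtain ⟨t, h1, h2, h3, h4⟩ := hsol.exists_crossing (by omega) hp1 hpos
          (σ := -1) (Or.inr rfl) ha hva (by linarith)
        exact ⟨-1, Or.inr rfl, t, h1, h2, fun s hs => h3 s (Ioo_subset_Ico_self hs), h4⟩
      · obtain ⟨t, h1, h2, h3, h4⟩ := hsol.exists_crossing (by omega) hp1 hpos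
          (σ := 1) (Or.inl rfl) ha hva (by linarith)
        exact ⟨1, Or.inl rfl, t, h1, h2, fun s hs => h3 s (Ioo_subset_Ico_self hs), h4⟩
  obtain ⟨σ, hσ, t, hat, hut, hbefore, hvbefore⟩ := hcross
  have ha0 : 0 ≤ a := by rcases ha with rfl | ⟨h, -⟩; exacts [le_rfl, h.le]
  obtain ⟨b, htb, hvb, hvafter, hafter⟩ := hsol.exists_next_critical hN hp hpos hP hσ
    (ha0.trans_lt hat) hut (hvbefore t ⟨hat, le_rfl⟩)
  refine ⟨b, hat.trans htb, hvb, fun s hs h0 => ?_, t, ⟨hat, htb.le⟩, hut, fun r hr hur => ?_⟩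
  · have : σ * v s < 0 := by
      rcases le_or_gt s t with h | h
      · exact hvbefore s ⟨hs.1, h⟩
      · exact hvafter s ⟨h.le, hs.2⟩
    rw [h0, mul_zero] at this
    exact lt_irrefl _ this
  · rcases lt_trichotomy r t with h | h | h
    · have := hbefore r ⟨hr.1, h⟩
      rw [hur, sub_self, mul_zero] at this
      exact absurd this (lt_irrefl _)
    · exact h
    · have := hafter r ⟨h, hr.2⟩
      rw [hur, sub_self, mul_zero] at this
      exact absurd this (lt_irrefl _)

/-- The critical points of the singular solution and the number of crossings of the level `1`
before each of them. -/
theorem IsRadialSol.exists_critical_sequence (hN : 3 ≤ N) (hp : pS N < p)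
    (hsol : IsRadialSol N p u v (Ioi 0)) (hpos : ∀ s ∈ Ioi (0 : ℝ), 0 < u s)
    (hP : ∀ s ∈ Ioi (0 : ℝ), pohozaev N p s (u s) (v s) < 0)
    (hinf : Tendsto u (𝓝[>] 0) atTop) :
    ∃ s : ℕ → ℝ, s 0 = 0 ∧ StrictMono s ∧ Tendsto s atTop atTop ∧
      (∀ n, v (s (n + 1)) = 0) ∧ (∀ t > 0, v t = 0 → ∃ n, s (n + 1) = t) ∧
      ∀ n, {t | t ∈ Ioc 0 (s n) ∧ u t = 1}.encard = n := by
  have hp1 := one_lt_of_pS_lt hN hp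
  have hstep := fun (a : ℝ) (ha : a = 0 ∨ (0 < a ∧ v a = 0)) =>
    hsol.exists_next hN hp hpos hP hinf ha
  choose! next hgt hnext hne t ht hut huniq using hstep
  -- Index 0 is the origin, which is not a critical point; the critical points are `s (n + 1)`.
  set s : ℕ → ℝ := fun n => next^[n] 0 with hs
  have hsucc : ∀ n, s (n + 1) = next (s n) := fun n => Function.iterate_succ_apply' next n 0
  have hvalid : ∀ n, s n = 0 ∨ (0 < s n ∧ v (s n) = 0) := by
    intro n
    induction n with
    | zero => exact Or.inl rfl
    | succ n ih =>
      rw [hsucc]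
      refine Or.inr ⟨lt_of_le_of_lt ?_ (hgt _ ih), hnext _ ih⟩
      rcases ih with h | ⟨h, -⟩
      exacts [h.ge, h.le]
  have hmono : StrictMono s := strictMono_nat_of_lt_succ fun n => by
    rw [hsucc]; exact hgt _ (hvalid n)
  have h0 : s 0 = 0 := rfl
  have hcrit : ∀ n, v (s (n + 1)) = 0 := fun n => by rw [hsucc]; exact hnext _ (hvalid n)
  -- At a finite limit `l` one would have `v l = 0` and `u l ≠ 1`, hence `v' l = -f(u l) ≠ 0`, so
  -- zeros of `v` could not accumulate at `l`.
  have hto : Tendsto s atTop atTop := by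
    rcases tendsto_atTop_of_monotone hmono.monotone with h | ⟨l, hl⟩
    · exact h
    exfalso
    have hlt : ∀ n, s n < l := fun n =>
      (hmono n.lt_succ_self).trans_le (hmono.monotone.ge_of_tendsto hl (n + 1))
    have hl0 : 0 < l := h0 ▸ hlt 0
    obtain ⟨hd1, hd2⟩ := hsol l hl0
    have hl' : Tendsto (fun n => s (n + 1)) atTop (𝓝 l) := hl.comp (tendsto_add_atTop_nat 1)
    have hvl : v l = 0 := by
      have h1 := hd2.continuousAt.tendsto.comp hl'
      have h2 : v ∘ (fun n => s (n + 1)) = fun _ => 0 := funext hcrit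
      rw [h2] at h1
      exact tendsto_nhds_unique h1 tendsto_const_nhds
    have hul := hsol.ne_one_of_critical hp1 hpos hinf hl0 hvl
    have hder : -(((N : ℝ) - 1) / l * v l) - nonlin p (u l) ≠ 0 := by
      rw [hvl, mul_zero, neg_zero, zero_sub, neg_ne_zero]
      rcases lt_or_gt_of_ne hul with h | h
      · have := mul_nonlin_pos hp1 (Or.inr rfl) (hpos l hl0) (σ := -1) (by linarith)
        intro h0
        rw [h0, mul_zero] at this
        exact lt_irrefl _ this
      · have := mul_nonlin_pos hp1 (Or.inl rfl) (hpos l hl0) (σ := 1) (by linarith)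
        intro h0
        rw [h0, mul_zero] at this
        exact lt_irrefl _ this
    have hev := hd2.eventually_ne hder (c := 0)
    have hl'' : Tendsto (fun n => s (n + 1)) atTop (𝓝[≠] l) :=
      tendsto_nhdsWithin_iff.2 ⟨hl', Eventually.of_forall fun n => (hlt (n + 1)).ne⟩
    obtain ⟨n, hn⟩ := (hl''.eventually hev).exists
    exact hn (hcrit n)
  refine ⟨s, h0, hmono, hto, hcrit, fun r hr hvr => ?_, fun n => ?_⟩
  · obtain ⟨n, hn⟩ := ((hto.eventually_ge_atTop r).exists)
    have hex : ∃ n, r ≤ s n := ⟨n, hn⟩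
    classical
    obtain ⟨m, hm⟩ : ∃ m, Nat.find hex = m + 1 := by
      refine Nat.exists_eq_succ_of_ne_zero fun h => ?_
      have := Nat.find_spec hex
      rw [h, h0] at this
      linarith
    have h1 := Nat.find_spec hex
    rw [hm] at h1
    have h2 : s m < r := not_le.1 (Nat.find_min hex (by omega))
    refine ⟨m, ?_⟩
    by_contra hne'
    rw [hsucc] at h1 hne'
    exact hne _ (hvalid m) r ⟨h2, h1.lt_of_ne' hne'⟩ hvr
  · induction n with
    | zero => simp [h0]
    | succ n ih =>
      have hn0 : 0 ≤ s n := h0 ▸ hmono.monotone n.zero_le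
      -- Each interval `(s n, s (n + 1)]` contributes exactly one crossing.
      have hsplit : {t | t ∈ Ioc 0 (s (n + 1)) ∧ u t = 1}
          = insert (t (s n)) {t | t ∈ Ioc 0 (s n) ∧ u t = 1} := by
        ext r
        have htn := ht _ (hvalid n)
        rw [← hsucc] at htn
        constructor
        · rintro ⟨hr, hur⟩
          rcases le_or_gt r (s n) with h | h
          · exact Or.inr ⟨⟨hr.1, h⟩, hur⟩
          · exact Or.inl (huniq _ (hvalid n) r ⟨h, by rw [← hsucc]; exact hr.2⟩ hur)
        · rintro (rfl | ⟨hr, hur⟩)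
          · exact ⟨⟨hn0.trans_lt htn.1, htn.2⟩, hut _ (hvalid n)⟩
          · exact ⟨⟨hr.1, hr.2.trans (hmono n.lt_succ_self).le⟩, hur⟩
      rw [hsplit, encard_insert_of_notMem, ih]
      · push_cast; rfl
      · rintro ⟨hr, -⟩
        exact absurd hr.2 (not_le.2 (ht _ (hvalid n)).1)

end critical

/-! ### Radial functions in `H¹` of the unit ball -/

section sobolev

variable {N : ℕ}

local notation "𝔼" => EuclideanSpace ℝ (Fin N)

/-- In polar coordinates the integrand becomes `r ^ (N - 1 - q)`, with exponent above `-1`. -/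
lemma integrableOn_norm_rpow_neg (hN : 1 ≤ N) {q : ℝ} (hq : q < N) :
    IntegrableOn (fun x : 𝔼 => ‖x‖ ^ (-q)) (Metric.ball 0 1) := by
  have : Nonempty (Fin N) := ⟨⟨0, hN⟩⟩
  rw [integrableOn_fun_norm_addHaar volume (f := fun r : ℝ => r ^ (-q))]
  have h1 : IntegrableOn (fun y : ℝ => y ^ ((N : ℝ) - 1 - q)) (Ioo 0 1) :=
    (intervalIntegral.integrableOn_Ioo_rpow_iff one_pos).2 (by linarith)
  refine h1.congr_fun (fun y hy => ?_) measurableSet_Ioo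
  simp only [finrank_euclideanSpace, Fintype.card_fin, smul_eq_mul]
  rw [← Real.rpow_natCast, ← Real.rpow_add hy.1, Nat.cast_sub hN]
  congr 1
  push_cast
  ring

lemma memLp_two_norm_rpow_neg (hN : 1 ≤ N) {q : ℝ} (hq : 2 * q < N) :
    MemLp (fun x : 𝔼 => ‖x‖ ^ (-q)) 2 (volume.restrict (Metric.ball 0 1)) := by
  rw [memLp_two_iff_integrable_sq
    ((measurable_norm.pow_const (-q)).aestronglyMeasurable)]
  refine (integrableOn_norm_rpow_neg hN hq).congr (Eventually.of_forall fun x => ?_)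
  change ‖x‖ ^ (-(2 * q)) = (‖x‖ ^ (-q)) ^ 2
  rw [← Real.rpow_natCast, ← Real.rpow_mul (norm_nonneg x)]
  congr 1
  push_cast
  ring

lemma ae_ne_zero (hN : 1 ≤ N) {s : Set 𝔼} : ∀ᵐ x ∂volume.restrict s, x ≠ 0 := by
  have : Nonempty (Fin N) := ⟨⟨0, hN⟩⟩
  exact ae_restrict_of_ae (by simp [ae_iff])

lemma aestronglyMeasurable_of_continuousOn_compl_zero {F : Type*} [NormedAddCommGroup F]
    (hN : 1 ≤ N) {f : 𝔼 → F} (hf : ContinuousOn f {0}ᶜ) {s : Set 𝔼} :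
    AEStronglyMeasurable f (volume.restrict s) := by
  have : Nonempty (Fin N) := ⟨⟨0, hN⟩⟩
  have h := hf.aestronglyMeasurable (μ := volume) (measurableSet_singleton (0 : 𝔼)).compl
  rw [restrict_compl_singleton] at h
  exact h.restrict

variable {V V' : ℝ → ℝ} {C θ : ℝ}

/-- The function `x ↦ V(√(|x|² + ε))` regularizes a radial function at the origin. -/
lemma hasFDerivAt_regularized (hV : ∀ r > 0, HasDerivAt V (V' r) r) {ε : ℝ} (hε : 0 < ε) (x : 𝔼) :
    HasFDerivAt (fun x : 𝔼 => V √(‖x‖ ^ 2 + ε))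
      ((V' √(‖x‖ ^ 2 + ε) / √(‖x‖ ^ 2 + ε)) • innerSL ℝ x) x := by
  have hpos : 0 < ‖x‖ ^ 2 + ε := by positivity
  have h1 : HasFDerivAt (fun x : 𝔼 => ‖x‖ ^ 2 + ε) (2 • innerSL ℝ x) x :=
    (hasStrictFDerivAt_norm_sq x).hasFDerivAt.add_const ε
  have h2 := (hV _ (Real.sqrt_pos.2 hpos)).comp_hasFDerivAt x (h1.sqrt hpos.ne')
  refine h2.congr_fderiv ?_
  ext y
  simp
  field_simp

/-- A radial function with controlled singularity at the origin belongs to `H¹` of the ball. -/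
theorem radialMemH1Ball_of_bounds (hN : 1 ≤ N) (hθ : 0 < θ) (hθN : 2 * (θ + 1) < N)
    (hV : ∀ r > 0, HasDerivAt V (V' r) r) (hV' : ContinuousOn V' (Ioi 0))
    (hb : ∀ r ∈ Ioo (0 : ℝ) 2, |V r| ≤ C * r ^ (-θ))
    (hb' : ∀ r ∈ Ioo (0 : ℝ) 2, |V' r| ≤ C * r ^ (-(θ + 1))) : RadialMemH1Ball N V := by
  have hVc : ContinuousOn V (Ioi 0) := fun r hr => (hV r hr).continuousAt.continuousWithinAt
  have hnorm : ∀ x ∈ ({0}ᶜ : Set 𝔼), ‖x‖ ∈ Ioi (0 : ℝ) := fun x hx => norm_pos_iff.2 hx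
  have hfc : ContinuousOn (fun x : 𝔼 => V ‖x‖) {0}ᶜ :=
    hVc.comp continuous_norm.continuousOn hnorm
  have hV'c : ContinuousOn (fun x : 𝔼 => V' ‖x‖) {0}ᶜ :=
    hV'.comp continuous_norm.continuousOn hnorm
  have hgc : ContinuousOn (fun x : 𝔼 => (V' ‖x‖ / ‖x‖) • x) {0}ᶜ :=
    (hV'c.div continuous_norm.continuousOn fun x hx => (hnorm x hx).ne').smul continuousOn_id
  have hball : ∀ᵐ x : 𝔼 ∂volume.restrict (Metric.ball 0 1), ‖x‖ ∈ Ioo (0 : ℝ) 1 := by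
    filter_upwards [ae_ne_zero hN, ae_restrict_mem measurableSet_ball] with x hx1 hx2
    exact ⟨norm_pos_iff.2 hx1, mem_ball_zero_iff.1 hx2⟩
  have hC : 0 ≤ C := by
    have h1 := (abs_nonneg _).trans (hb 1 ⟨one_pos, one_lt_two⟩)
    rwa [Real.one_rpow, mul_one] at h1
  refine ⟨?_, fun x => (V' ‖x‖ / ‖x‖) • x, ?_, ?_⟩
  · refine ((memLp_two_norm_rpow_neg hN (by linarith : 2 * θ < N)).const_mul C).mono'
      (aestronglyMeasurable_of_continuousOn_compl_zero hN hfc) ?_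
    filter_upwards [hball] with x hx
    exact hb _ ⟨hx.1, hx.2.trans one_lt_two⟩
  · refine ((memLp_two_norm_rpow_neg hN hθN).const_mul C).mono'
      (aestronglyMeasurable_of_continuousOn_compl_zero hN hgc) ?_
    filter_upwards [hball] with x hx
    rw [norm_smul, norm_div, norm_norm, div_mul_cancel₀ _ hx.1.ne']
    exact hb' _ ⟨hx.1, hx.2.trans one_lt_two⟩
  intro φ hφ hφc hφs i
  set e : 𝔼 := EuclideanSpace.single i 1 with he
  set ψ : 𝔼 → ℝ := fun x => fderiv ℝ φ x e with hψ
  have hφcont : Continuous φ := hφ.continuous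
  have hψcont : Continuous ψ :=
    (hφ.continuous_fderiv (by simp)).clm_apply continuous_const
  have hψsupp : HasCompactSupport ψ := hφc.fderiv_apply ℝ e
  have hφ0 : ∀ x, x ∉ Metric.ball (0 : 𝔼) 1 → φ x = 0 := fun x hx =>
    image_eq_zero_of_notMem_tsupport fun h => hx (hφs h)
  have hψ0 : ∀ x, x ∉ Metric.ball (0 : 𝔼) 1 → ψ x = 0 := fun x hx => by
    have : fderiv ℝ φ x = 0 := image_eq_zero_of_notMem_tsupport
      fun h => hx (hφs (tsupport_fderiv_subset ℝ h))
    simp [hψ, this]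
  obtain ⟨K₁, hK₁⟩ := hφc.exists_bound_of_continuous hφcont
  obtain ⟨K₂, hK₂⟩ := hψsupp.exists_bound_of_continuous hψcont
  -- Replacing `|x|` by `√(|x|² + ε)` removes the singularity, so the integration by parts is
  -- classical; `ε → 0` is then taken by dominated convergence. Since the regularized radius can
  -- exceed 1, the bounds on `V` and `V'` are required up to radius 2.
  set ε : ℕ → ℝ := fun n => 1 / ((n : ℝ) + 1) with hε
  have hε0 : ∀ n, 0 < ε n := fun n => by positivity
  have hε1 : ∀ n, ε n ≤ 1 := fun n => by
    rw [hε, div_le_one (by positivity)]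
    linarith [(Nat.cast_nonneg n : (0 : ℝ) ≤ n)]
  have hεlim : Tendsto ε atTop (𝓝 0) := tendsto_one_div_add_atTop_nhds_zero_nat
  set ρ : ℕ → 𝔼 → ℝ := fun n x => √(‖x‖ ^ 2 + ε n) with hρ
  have hρpos : ∀ n x, 0 < ρ n x := fun n x =>
    Real.sqrt_pos.2 (by have := hε0 n; positivity)
  have hρge : ∀ n x, ‖x‖ ≤ ρ n x := fun n x =>
    Real.le_sqrt_of_sq_le (by linarith [hε0 n])
  have hρlt : ∀ n, ∀ x : 𝔼, ‖x‖ < 1 → ρ n x < 2 := fun n x hx => by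
    rw [hρ, Real.sqrt_lt' two_pos]
    nlinarith [hε1 n, norm_nonneg x]
  have hρc : ∀ n, Continuous (ρ n) := fun n => by
    simp only [hρ]; fun_prop
  have hρlim : ∀ x : 𝔼, Tendsto (fun n => ρ n x) atTop (𝓝 ‖x‖) := fun x => by
    have := (hεlim.const_add (‖x‖ ^ 2)).sqrt
    simpa [hρ] using this
  have hVρ : ∀ n, Continuous fun x => V (ρ n x) := fun n =>
    hVc.comp_continuous (hρc n) fun x => hρpos n x
  have hV'ρ : ∀ n, Continuous fun x => V' (ρ n x) := fun n =>
    hV'.comp_continuous (hρc n) fun x => hρpos n x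
  have hder : ∀ n x, fderiv ℝ (fun x => V (ρ n x)) x e = V' (ρ n x) / ρ n x * x i := by
    intro n x
    rw [(hasFDerivAt_regularized hV (hε0 n) x).fderiv]
    simp [he, hρ, EuclideanSpace.inner_single_right]
  have hquot : ∀ n, Continuous fun x : 𝔼 => V' (ρ n x) / ρ n x * x i := fun n =>
    ((hV'ρ n).div (hρc n) fun x => (hρpos n x).ne').mul (by fun_prop)
  have hparts : ∀ n, ∫ x in Metric.ball (0 : 𝔼) 1, V (ρ n x) * ψ x
      = -∫ x in Metric.ball (0 : 𝔼) 1, V' (ρ n x) / ρ n x * x i * φ x := by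
    intro n
    rw [setIntegral_eq_integral_of_forall_compl_eq_zero fun x hx => by rw [hψ0 x hx, mul_zero],
      setIntegral_eq_integral_of_forall_compl_eq_zero fun x hx => by rw [hφ0 x hx, mul_zero]]
    have h := integral_mul_fderiv_eq_neg_fderiv_mul_of_integrable (μ := (volume : Measure 𝔼))
      (f := fun x => V (ρ n x)) (g := φ) (v := e) ?_ ?_ ?_
      (fun x _ => (hasFDerivAt_regularized hV (hε0 n) x).differentiableAt)
      (fun x _ => hφ.differentiable (by simp) x)
    · simpa only [hder] using h
    · simp only [hder]
      exact ((hquot n).mul hφcont).integrable_of_hasCompactSupport hφc.mul_left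
    · exact ((hVρ n).mul hψcont).integrable_of_hasCompactSupport hψsupp.mul_left
    · exact ((hVρ n).mul hφcont).integrable_of_hasCompactSupport hφc.mul_left
  have hmono : ∀ q : ℝ, 0 ≤ q → ∀ n, ∀ x : 𝔼, 0 < ‖x‖ → C * ρ n x ^ (-q) ≤ C * ‖x‖ ^ (-q) :=
    fun q hq n x hx => mul_le_mul_of_nonneg_left
      (Real.rpow_le_rpow_of_nonpos hx (hρge n x) (by linarith)) hC
  have hlim₁ : Tendsto (fun n => ∫ x in Metric.ball (0 : 𝔼) 1, V (ρ n x) * ψ x) atTop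
      (𝓝 (∫ x in Metric.ball (0 : 𝔼) 1, V ‖x‖ * ψ x)) := by
    refine tendsto_integral_of_dominated_convergence (fun x => C * ‖x‖ ^ (-θ) * K₂)
      (fun n => ((hVρ n).mul hψcont).aestronglyMeasurable)
      (((integrableOn_norm_rpow_neg hN (by linarith)).const_mul C).mul_const K₂) ?_ ?_
    · intro n
      filter_upwards [hball] with x hx
      rw [norm_mul]
      refine mul_le_mul ?_ (hK₂ x) (norm_nonneg _)
        (mul_nonneg hC (Real.rpow_nonneg (norm_nonneg x) _))
      exact (hb _ ⟨hρpos n x, hρlt n x hx.2⟩).trans (hmono θ hθ.le n x hx.1)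
    · filter_upwards [hball] with x hx
      exact ((hV _ hx.1).continuousAt.tendsto.comp (hρlim x)).mul_const _
  have hlim₂ : Tendsto
      (fun n => -∫ x in Metric.ball (0 : 𝔼) 1, V' (ρ n x) / ρ n x * x i * φ x) atTop
      (𝓝 (-∫ x in Metric.ball (0 : 𝔼) 1, V' ‖x‖ / ‖x‖ * x i * φ x)) := by
    refine (tendsto_integral_of_dominated_convergence (fun x => C * ‖x‖ ^ (-(θ + 1)) * K₁)
      (fun n => ((hquot n).mul hφcont).aestronglyMeasurable)
      (((integrableOn_norm_rpow_neg hN (by linarith)).const_mul C).mul_const K₁) ?_ ?_).neg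
    · intro n
      filter_upwards [hball] with x hx
      rw [Pi.mul_apply, norm_mul]
      refine mul_le_mul ?_ (hK₁ x) (norm_nonneg _)
        (mul_nonneg hC (Real.rpow_nonneg (norm_nonneg x) _))
      have h1 : ‖x i‖ ≤ ρ n x := (PiLp.norm_apply_le x i).trans (hρge n x)
      have h2 := (hb' _ ⟨hρpos n x, hρlt n x hx.2⟩).trans (hmono (θ + 1) (by linarith) n x hx.1)
      refine le_trans ?_ h2
      rw [norm_mul, norm_div, Real.norm_of_nonneg (hρpos n x).le, div_mul_eq_mul_div,
        div_le_iff₀ (hρpos n x)]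
      exact mul_le_mul_of_nonneg_left h1 (norm_nonneg _)
    · filter_upwards [hball] with x hx
      have h1 := ((hV' _ hx.1).continuousAt (Ioi_mem_nhds hx.1)).tendsto.comp (hρlim x)
      exact ((h1.div (hρlim x) hx.1.ne').mul_const _).mul_const _
  have hfinal := tendsto_nhds_unique (hlim₁.congr hparts) hlim₂
  simpa using hfinal

end sobolev

/-! ### Rescaling, regularity and profiles -/

section transfer

variable {N : ℕ} {p : ℝ}

lemma contDiffOn_two_of_hasDerivAt {I : Set ℝ} (hI : IsOpen I) {f f' f'' : ℝ → ℝ}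
    (h₁ : ∀ x ∈ I, HasDerivAt f (f' x) x) (h₂ : ∀ x ∈ I, HasDerivAt f' (f'' x) x)
    (hc : ContinuousOn f'' I) : ContDiffOn ℝ 2 f I := by
  have h1 : ContDiffOn ℝ 1 f' I := by
    rw [show (1 : WithTop ℕ∞) = 0 + 1 by simp, contDiffOn_succ_iff_deriv_of_isOpen hI]
    refine ⟨fun x hx => (h₂ x hx).differentiableAt.differentiableWithinAt, by simp, ?_⟩
    exact contDiffOn_zero.2 (hc.congr fun x hx => (h₂ x hx).deriv)
  rw [show (2 : WithTop ℕ∞) = 1 + 1 by norm_num, contDiffOn_succ_iff_deriv_of_isOpen hI]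
  exact ⟨fun x hx => (h₁ x hx).differentiableAt.differentiableWithinAt, by simp,
    h1.congr fun x hx => (h₁ x hx).deriv⟩

/-- A solution with parameter `lam` becomes a solution with parameter `1` after rescaling. -/
lemma isRadialSol_of_radialODEAt {I : Set ℝ} (hI : IsOpen I) (hI0 : I ⊆ Ioi 0) {lam : ℝ}
    (hlam : 0 < lam) {U : ℝ → ℝ} (hU : ContDiffOn ℝ 2 U I)
    (hode : ∀ r ∈ I, RadialODEAt N p lam U r) :
    IsRadialSol N p (fun s => U (s / √lam)) (fun s => deriv U (s / √lam) / √lam)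
      {s | s / √lam ∈ I} := by
  intro s hs
  have hs : s / √lam ∈ I := hs
  set c := √lam with hc
  have hc0 : 0 < c := Real.sqrt_pos.2 hlam
  have hc2 : c ^ 2 = lam := Real.sq_sqrt hlam.le
  have hr0 : 0 < s / c := hI0 hs
  have hs0 : s ≠ 0 := by rintro rfl; simp at hr0
  rw [show (2 : WithTop ℕ∞) = 1 + 1 by norm_num, contDiffOn_succ_iff_deriv_of_isOpen hI] at hU
  have hn := hI.mem_nhds hs
  have h1 : HasDerivAt U (deriv U (s / c)) (s / c) := (hU.1.differentiableAt hn).hasDerivAt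
  have h2 : HasDerivAt (deriv U) (deriv (deriv U) (s / c)) (s / c) :=
    ((hU.2.2.differentiableOn one_ne_zero).differentiableAt hn).hasDerivAt
  have hd : HasDerivAt (fun s : ℝ => s / c) (1 / c) s := (hasDerivAt_id s).div_const c
  have hode' := hode _ hs
  unfold RadialODEAt at hode'
  constructor
  · refine (h1.comp s hd).congr_deriv ?_
    ring
  · refine ((h2.comp s hd).div_const c).congr_deriv ?_
    rw [← hc2] at hode'
    have e : deriv (deriv U) (s / c) = -(((N : ℝ) - 1) / (s / c) * deriv U (s / c))
        - c ^ 2 * nonlin p (U (s / c)) := by linarith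
    rw [e]
    field_simp

/-- This puts the profile condition into the form used in the Emden–Fowler analysis, with the scale
`c = √lam` kept so that rescaling is a change of variable. -/
lemma isEquivalent_iff_tendsto_profile {A θ c : ℝ} (hA : 0 < A) (hc : 0 < c) {U : ℝ → ℝ} :
    Asymptotics.IsEquivalent (𝓝[>] 0) U (fun r => A * (c * r) ^ (-θ)) ↔
      Tendsto (fun r => (c * r) ^ θ * U r) (𝓝[>] 0) (𝓝 A) := by
  have hne : ∀ᶠ r in 𝓝[>] (0 : ℝ), A * (c * r) ^ (-θ) ≠ 0 := by
    filter_upwards [self_mem_nhdsWithin] with r hr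
    have : 0 < c * r := mul_pos hc hr
    positivity
  rw [Asymptotics.isEquivalent_iff_tendsto_one hne]
  have hev : (U / fun r => A * (c * r) ^ (-θ)) =ᶠ[𝓝[>] 0]
      fun r => ((c * r) ^ θ * U r) * A⁻¹ := by
    filter_upwards [self_mem_nhdsWithin] with r hr
    have hr' : 0 < c * r := mul_pos hc hr
    rw [Pi.div_apply, Real.rpow_neg hr'.le]
    have := (Real.rpow_pos_of_pos hr' θ).ne'
    field_simp
  rw [tendsto_congr' hev]
  constructor
  · intro h
    have := h.mul_const A
    simpa [mul_assoc, hA.ne'] using this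
  · intro h
    have := h.mul_const A⁻¹
    rwa [mul_inv_cancel₀ hA.ne'] at this

lemma tendsto_mul_nhdsGT_zero {c : ℝ} (hc : 0 < c) :
    Tendsto (fun r => c * r) (𝓝[>] 0) (𝓝[>] 0) := by
  refine tendsto_nhdsWithin_iff.2 ⟨?_, ?_⟩
  · have : Tendsto (fun r => c * r) (𝓝 0) (𝓝 (c * 0)) := (continuous_const_mul c).tendsto 0
    rw [mul_zero] at this
    exact this.mono_left nhdsWithin_le_nhds
  · filter_upwards [self_mem_nhdsWithin] with r hr using mul_pos hc hr

lemma tendsto_atTop_of_profile {A θ : ℝ} (hA : 0 < A) (hθ : 0 < θ) {u : ℝ → ℝ}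
    (h : Tendsto (fun s => s ^ θ * u s) (𝓝[>] 0) (𝓝 A)) : Tendsto u (𝓝[>] 0) atTop := by
  refine Tendsto.congr' ?_ ((tendsto_rpow_neg_nhdsGT_zero (neg_lt_zero.2 hθ)).atTop_mul_pos hA h)
  filter_upwards [self_mem_nhdsWithin] with s hs
  rw [← mul_assoc, ← Real.rpow_add hs, neg_add_cancel, Real.rpow_zero, one_mul]

lemma exists_bound_of_tendsto_nhdsGT {φ : ℝ → ℝ} (hc : ContinuousOn φ (Ioi 0)) {L : ℝ}
    (hL : Tendsto φ (𝓝[>] 0) (𝓝 L)) (b : ℝ) : ∃ C, ∀ r ∈ Ioo 0 b, |φ r| ≤ C := by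
  have hev := hL.abs.eventually (gt_mem_nhds (lt_add_one |L|))
  rw [eventually_nhdsWithin_iff, Metric.eventually_nhds_iff] at hev
  obtain ⟨ε, hε, hev⟩ := hev
  obtain ⟨C, hC⟩ := isCompact_Icc.exists_bound_of_continuousOn
    (hc.mono fun r (hr : r ∈ Icc (ε / 2) b) => (half_pos hε).trans_le hr.1)
  refine ⟨max (|L| + 1) C, fun r hr => ?_⟩
  rcases lt_or_ge r ε with h | h
  · exact (hev (by rwa [Real.dist_eq, sub_zero, abs_of_pos hr.1]) hr.1).le.trans (le_max_left _ _)
  · exact (hC r ⟨by linarith, hr.2.le⟩).trans (le_max_right _ _)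

lemma abs_le_mul_rpow_neg {q r y C : ℝ} (hr : 0 < r) (h : |r ^ q * y| ≤ C) :
    |y| ≤ C * r ^ (-q) := by
  have hq := Real.rpow_pos_of_pos hr q
  rw [abs_mul, abs_of_pos hq] at h
  rw [Real.rpow_neg hr.le, ← div_eq_mul_inv, le_div_iff₀ hq]
  linarith

end transfer

/-! ### Neumann solutions as rescalings of the entire solution -/

section singularSolutions

variable {N : ℕ} {p : ℝ} {u v : ℝ → ℝ}

lemma IsRadialSol.hasDerivAt_scaled (hsol : IsRadialSol N p u v (Ioi 0)) {c r : ℝ} (hc : 0 < c)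
    (hr : 0 < r) :
    HasDerivAt (fun r => u (c * r)) (c * v (c * r)) r ∧
      HasDerivAt (fun r => c * v (c * r))
        (c ^ 2 * (-(((N : ℝ) - 1) / (c * r) * v (c * r)) - nonlin p (u (c * r)))) r := by
  obtain ⟨h1, h2⟩ := hsol (c * r) (mul_pos hc hr)
  have hd : HasDerivAt (fun r => c * r) c r := by simpa using (hasDerivAt_id r).const_mul c
  exact ⟨(h1.comp r hd).congr_deriv (by ring),
    ((h2.comp r hd).const_mul c).congr_deriv (by ring)⟩

lemma IsRadialSol.contDiffOn_scaled (hp : 1 < p) (hsol : IsRadialSol N p u v (Ioi 0)) {c : ℝ}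
    (hc : 0 < c) : ContDiffOn ℝ 2 (fun r => u (c * r)) (Ioi 0) := by
  refine contDiffOn_two_of_hasDerivAt isOpen_Ioi
    (fun r hr => (hsol.hasDerivAt_scaled hc hr).1) (fun r hr => (hsol.hasDerivAt_scaled hc hr).2) ?_
  intro r hr
  have hr' : 0 < c * r := mul_pos hc hr
  have h1 := (hsol.hasDerivAt_scaled hc hr).1.continuousAt
  have h2 : ContinuousAt (fun r => v (c * r)) r :=
    (hsol (c * r) hr').2.continuousAt.comp (by fun_prop)
  have h3 : ContinuousAt (fun r => nonlin p (u (c * r))) r :=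
    (continuous_nonlin hp).continuousAt.comp h1
  have h4 : ContinuousAt (fun r => ((N : ℝ) - 1) / (c * r)) r :=
    continuousAt_const.div (by fun_prop) hr'.ne'
  exact (continuousAt_const.mul ((h4.mul h2).neg.sub h3)).continuousWithinAt

lemma IsRadialSol.radialODEAt_scaled (hsol : IsRadialSol N p u v (Ioi 0)) {c r : ℝ} (hc : 0 < c)
    (hr : 0 < r) : RadialODEAt N p (c ^ 2) (fun r => u (c * r)) r := by
  have hev : deriv (fun r => u (c * r)) =ᶠ[𝓝 r] fun r => c * v (c * r) := by
    filter_upwards [Ioi_mem_nhds hr] with t ht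
    exact (hsol.hasDerivAt_scaled hc ht).1.deriv
  unfold RadialODEAt
  rw [hev.deriv_eq, (hsol.hasDerivAt_scaled hc hr).2.deriv, hev.eq_of_nhds]
  field_simp
  ring

lemma tendsto_scaled_profile {A θ c : ℝ} (hc : 0 < c)
    (hlu : Tendsto (fun s => s ^ θ * u s) (𝓝[>] 0) (𝓝 A)) :
    Tendsto (fun r => (c * r) ^ θ * u (c * r)) (𝓝[>] 0) (𝓝 A) :=
  hlu.comp (tendsto_mul_nhdsGT_zero hc)

/-- The two limits at the origin bound `u` and its derivative by multiples of `s ^ (-θ)` and `s ^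
(-(θ + 1))`; the second is square integrable on the ball by `damping_pos`. -/
lemma radialMemH1Ball_scaled (hN : 3 ≤ N) (hp : pS N < p) (hsol : IsRadialSol N p u v (Ioi 0))
    (hlu : Tendsto (fun s => s ^ theta p * u s) (𝓝[>] 0) (𝓝 (ampl p N)))
    (hlv : Tendsto (fun s => s ^ theta p * s * v s) (𝓝[>] 0) (𝓝 (-(theta p * ampl p N))))
    {c : ℝ} (hc : 0 < c) : RadialMemH1Ball N (fun r => u (c * r)) := by
  have hp1 := one_lt_of_pS_lt hN hp
  have huc : ContinuousOn u (Ioi 0) := fun s hs => (hsol s hs).1.continuousAt.continuousWithinAt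
  have hvc : ContinuousOn v (Ioi 0) := fun s hs => (hsol s hs).2.continuousAt.continuousWithinAt
  have hpc : ContinuousOn (fun s : ℝ => s ^ theta p) (Ioi 0) :=
    (Real.continuous_rpow_const (theta_pos hp1).le).continuousOn
  obtain ⟨C₁, hC₁⟩ := exists_bound_of_tendsto_nhdsGT (hpc.mul huc) hlu (c * 2)
  obtain ⟨C₂, hC₂⟩ := exists_bound_of_tendsto_nhdsGT ((hpc.mul continuousOn_id).mul hvc) hlv
    (c * 2)
  have hmem : ∀ r ∈ Ioo (0 : ℝ) 2, c * r ∈ Ioo 0 (c * 2) := fun r hr =>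
    ⟨mul_pos hc hr.1, mul_lt_mul_of_pos_left hr.2 hc⟩
  have hb : ∀ r ∈ Ioo (0 : ℝ) 2, |u (c * r)| ≤ C₁ * c ^ (-theta p) * r ^ (-theta p) := by
    intro r hr
    have h := abs_le_mul_rpow_neg (hmem r hr).1 (hC₁ _ (hmem r hr))
    rwa [Real.mul_rpow hc.le hr.1.le, ← mul_assoc] at h
  have hb' : ∀ r ∈ Ioo (0 : ℝ) 2, |c * v (c * r)|
      ≤ c * (C₂ * c ^ (-(theta p + 1))) * r ^ (-(theta p + 1)) := by
    intro r hr
    have h0 := (hmem r hr).1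
    have h := abs_le_mul_rpow_neg (q := theta p + 1) (y := v (c * r)) h0 (C := C₂) (by
      rw [Real.rpow_add_one h0.ne']; exact hC₂ _ (hmem r hr))
    rw [Real.mul_rpow hc.le hr.1.le, ← mul_assoc] at h
    rw [abs_mul, abs_of_pos hc, mul_assoc]
    exact mul_le_mul_of_nonneg_left h hc.le
  refine radialMemH1Ball_of_bounds (V' := fun r => c * v (c * r)) (θ := theta p)
    (C := max (C₁ * c ^ (-theta p)) (c * (C₂ * c ^ (-(theta p + 1))))) (by omega)
    (theta_pos hp1) (by linarith [damping_pos hN hp])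
    (fun r hr => (hsol.hasDerivAt_scaled hc hr).1)
    (fun r hr => (hsol.hasDerivAt_scaled hc hr).2.continuousAt.continuousWithinAt) ?_ ?_
  · exact fun r hr => (hb r hr).trans
      (mul_le_mul_of_nonneg_right (le_max_left _ _) (Real.rpow_nonneg hr.1.le _))
  · exact fun r hr => (hb' r hr).trans
      (mul_le_mul_of_nonneg_right (le_max_right _ _) (Real.rpow_nonneg hr.1.le _))

lemma zeroCount_scaled {c : ℝ} (hc : 0 < c) :
    zeroCount (fun r => u (c * r)) = {t | t ∈ Ioc 0 c ∧ u t = 1}.encard := by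
  have himg : {t | t ∈ Ioc 0 c ∧ u t = 1}
      = (fun r => c * r) '' {r : ℝ | r ∈ Ioc (0 : ℝ) 1 ∧ u (c * r) - 1 = 0} := by
    ext t
    constructor
    · rintro ⟨ht, hut⟩
      refine ⟨t / c, ⟨⟨div_pos ht.1 hc, (div_le_one hc).2 ht.2⟩, ?_⟩, mul_div_cancel₀ t hc.ne'⟩
      rw [mul_div_cancel₀ t hc.ne', hut, sub_self]
    · rintro ⟨r, ⟨hr, hur⟩, rfl⟩
      exact ⟨⟨mul_pos hc hr.1, mul_le_of_le_one_right hc.le hr.2⟩, by linarith⟩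
  rw [himg, (mul_right_injective₀ hc.ne').encard_image]
  rfl

lemma zeroCount_congr {U₁ U₂ : ℝ → ℝ} (h : EqOn U₁ U₂ (Ioc 0 1)) :
    zeroCount U₁ = zeroCount U₂ := by
  unfold zeroCount
  congr 1
  ext r
  exact and_congr_right fun hr => by rw [h hr]

/-- The rescaling of the entire singular solution at a critical point is a singular solution of
the Neumann problem. -/
lemma isSingularNeumannSolution_scaled (hN : 3 ≤ N) (hp : pS N < p)
    (hsol : IsRadialSol N p u v (Ioi 0)) (hpos : ∀ s ∈ Ioi (0 : ℝ), 0 < u s)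
    (hinf : Tendsto u (𝓝[>] 0) atTop) {c : ℝ} (hc : 0 < c) (hvc : v c = 0) :
    IsSingularNeumannSolution N p (c ^ 2) (fun r => u (c * r)) where
  lam_pos := by positivity
  contDiffOn := (hsol.contDiffOn_scaled (one_lt_of_pS_lt hN hp) hc).mono Ioo_subset_Ioi_self
  continuousOn := (hsol.contDiffOn_scaled (one_lt_of_pS_lt hN hp) hc).continuousOn.mono
    Ioc_subset_Ioi_self
  ode r hr := hsol.radialODEAt_scaled hc hr.1
  neumann := by
    have h := (hsol.hasDerivAt_scaled hc one_pos).1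
    rw [mul_one, hvc, mul_zero] at h
    exact h.hasDerivWithinAt
  pos r hr := hpos _ (mul_pos hc hr.1)
  singular := hinf.comp (tendsto_mul_nhdsGT_zero hc)

/-- Every singular solution of the Neumann problem with the singular profile is the rescaling of
the entire singular solution at one of its critical points. -/
lemma IsSingularNeumannSolution.eqOn_scaled (hN : 3 ≤ N) (hp : pS N < p)
    (hsol : IsRadialSol N p u v (Ioi 0)) (hpos : ∀ s ∈ Ioi (0 : ℝ), 0 < u s)
    (hlu : Tendsto (fun s => s ^ theta p * u s) (𝓝[>] 0) (𝓝 (ampl p N))) {lam : ℝ} {U : ℝ → ℝ}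
    (hU : IsSingularNeumannSolution N p lam U) (hprof : HasSingularProfile N p lam U) :
    EqOn U (fun r => u (√lam * r)) (Ioc 0 1) ∧ v √lam = 0 := by
  have hc : 0 < √lam := Real.sqrt_pos.2 hU.lam_pos
  set c := √lam with hcdef
  have hset : {s | s / c ∈ Ioo (0 : ℝ) 1} = Ioo 0 c := by
    ext s
    simp [div_lt_one hc, div_pos_iff_of_pos_right hc]
  have hsol' := isRadialSol_of_radialODEAt isOpen_Ioo Ioo_subset_Ioi_self hU.lam_pos
    hU.contDiffOn hU.ode
  rw [← hcdef, hset] at hsol'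
  have hprof' := (isEquivalent_iff_tendsto_profile (ampl_pos hN hp) hc).1 hprof
  have hlim : Tendsto (fun s => s ^ theta p * U (s / c)) (𝓝[>] 0) (𝓝 (ampl p N)) := by
    have := hprof'.comp (tendsto_mul_nhdsGT_zero (inv_pos.2 hc))
    refine this.congr fun s => ?_
    simp only [Function.comp]
    rw [mul_inv_cancel_left₀ hc.ne', inv_mul_eq_div]
  have heq := (IsRadialSol.eqOn_of_profile hN hp hc hsol' (hsol.mono Ioo_subset_Ioi_self)
    (fun s hs => hU.pos _ ⟨div_pos hs.1 hc, (div_le_one hc).2 hs.2.le⟩)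
    (fun s hs => hpos s hs.1) hlim hlu).1
  have hIoo : EqOn U (fun r => u (c * r)) (Ioo 0 1) := by
    intro r hr
    have := heq (x := c * r) ⟨mul_pos hc hr.1, mul_lt_of_lt_one_right hc hr.2⟩
    simp only [mul_div_cancel_left₀ r hc.ne'] at this
    exact this
  have hd := (hsol.hasDerivAt_scaled hc one_pos).1
  -- The equation holds only on the open interval, so the endpoint is reached by left continuity;
  -- the one-sided derivative there then gives `c * v c = 0`.
  have hone : U 1 = u (c * 1) := by
    have hne : (𝓝[Ioo (0 : ℝ) 1] 1).NeBot := by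
      rw [← mem_closure_iff_nhdsWithin_neBot, closure_Ioo zero_ne_one]
      exact right_mem_Icc.2 zero_le_one
    have h1 : Tendsto U (𝓝[Ioo (0 : ℝ) 1] 1) (𝓝 (U 1)) :=
      (hU.continuousOn 1 ⟨one_pos, le_rfl⟩).mono Ioo_subset_Ioc_self
    have h2 : Tendsto (fun r => u (c * r)) (𝓝[Ioo (0 : ℝ) 1] 1) (𝓝 (u (c * 1))) :=
      hd.continuousAt.continuousWithinAt
    exact tendsto_nhds_unique (h1.congr' (eventually_mem_nhdsWithin.mono hIoo)) h2
  have hIoc : EqOn U (fun r => u (c * r)) (Ioc 0 1) := by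
    intro r hr
    rcases hr.2.lt_or_eq with h | rfl
    · exact hIoo ⟨hr.1, h⟩
    · exact hone
  refine ⟨hIoc, ?_⟩
  have hev : U =ᶠ[𝓝[≤] 1] fun r => u (c * r) := by
    filter_upwards [Ioc_mem_nhdsLE (zero_lt_one (α := ℝ))] with r hr using hIoc hr
  have h1 : HasDerivWithinAt U (c * v (c * 1)) (Iic 1) 1 :=
    hd.hasDerivWithinAt.congr_of_eventuallyEq hev hone
  have h2 := (uniqueDiffWithinAt_Iic (1 : ℝ)).eq_deriv _ h1 hU.neumann
  rw [mul_one] at h2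
  exact (mul_eq_zero.1 h2).resolve_left hc.ne'

lemma isEntireSingularSolution_of_isRadialSol (hN : 3 ≤ N) (hp : pS N < p)
    (hsol : IsRadialSol N p u v (Ioi 0)) (hpos : ∀ s ∈ Ioi (0 : ℝ), 0 < u s)
    (hlu : Tendsto (fun s => s ^ theta p * u s) (𝓝[>] 0) (𝓝 (ampl p N))) :
    IsEntireSingularSolution N p u where
  contDiffOn := by simpa using hsol.contDiffOn_scaled (one_lt_of_pS_lt hN hp) one_pos
  ode s hs := by simpa using hsol.radialODEAt_scaled one_pos hs
  pos := hpos
  singular := tendsto_atTop_of_profile (ampl_pos hN hp) (theta_pos (one_lt_of_pS_lt hN hp)) hlu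
  profile := by
    have := (isEquivalent_iff_tendsto_profile (θ := theta p) (U := u) (ampl_pos hN hp) one_pos).2
      (by simpa using hlu)
    simpa using this

lemma IsEntireSingularSolution.eqOn (hN : 3 ≤ N) (hp : pS N < p)
    (hsol : IsRadialSol N p u v (Ioi 0)) (hpos : ∀ s ∈ Ioi (0 : ℝ), 0 < u s)
    (hlu : Tendsto (fun s => s ^ theta p * u s) (𝓝[>] 0) (𝓝 (ampl p N))) {w : ℝ → ℝ}
    (hw : IsEntireSingularSolution N p w) : EqOn w u (Ioi 0) := by
  intro s hs
  have hsol' := isRadialSol_of_radialODEAt isOpen_Ioi Subset.rfl one_pos hw.contDiffOn hw.ode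
  simp only [Real.sqrt_one, div_one] at hsol'
  have hprof := (isEquivalent_iff_tendsto_profile (θ := theta p) (U := w)
    (ampl_pos hN hp) one_pos).1 (by simpa using hw.profile)
  simp only [one_mul] at hprof
  have hs0 : 0 < s := hs
  exact (IsRadialSol.eqOn_of_profile hN hp (R := s + 1) (by linarith)
    (hsol'.mono fun t ht => ht.1) (hsol.mono Ioo_subset_Ioi_self)
    (fun t ht => hw.pos t ht.1) (fun t ht => hpos t ht.1) hprof hlu).1 ⟨hs0, by linarith⟩

end singularSolutions

end SupercriticalNeumann

end

theorem theorem1 (N : ℕ) (hN : 3 ≤ N) (p : ℝ) (hp : SupercriticalNeumann.pS N < p) :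
    ∃ (lam : ℕ → ℝ) (U : ℕ → ℝ → ℝ),
      StrictMonoOn lam (Set.Ici 1) ∧
      Filter.Tendsto lam Filter.atTop Filter.atTop ∧
      (∀ n : ℕ, 1 ≤ n →
        SupercriticalNeumann.IsSingularNeumannSolution N p (lam n) (U n) ∧
        SupercriticalNeumann.RadialMemH1Ball N (U n) ∧
        SupercriticalNeumann.HasSingularProfile N p (lam n) (U n) ∧
        SupercriticalNeumann.zeroCount (U n) = n ∧
        (∀ r ∈ Set.Ioc (0 : ℝ) 1, 0 < U n r)) ∧
      (∀ n : ℕ, 1 ≤ n → ∀ (lam' : ℝ) (U' : ℝ → ℝ),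
        SupercriticalNeumann.IsSingularNeumannSolution N p lam' U' →
        SupercriticalNeumann.HasSingularProfile N p lam' U' →
        SupercriticalNeumann.zeroCount U' = n →
        lam' = lam n ∧ Set.EqOn U' (U n) (Set.Ioc 0 1)) ∧
      (∃ (ustar : ℝ → ℝ) (s : ℕ → ℝ),
        SupercriticalNeumann.IsEntireSingularSolution N p ustar ∧
        (∀ v : ℝ → ℝ, SupercriticalNeumann.IsEntireSingularSolution N p v →
          Set.EqOn v ustar (Set.Ioi 0)) ∧
        SupercriticalNeumann.EnumeratesCriticalPoints ustar s ∧
        ∀ n : ℕ, 1 ≤ n → √(lam n) = s n) := by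
  open SupercriticalNeumann in
  have hp1 := one_lt_of_pS_lt hN hp
  obtain ⟨u, v, hsol, hpos, hlu, hlv⟩ := exists_global_singular hN hp
  have hinf := tendsto_atTop_of_profile (ampl_pos hN hp) (theta_pos hp1) hlu
  -- Negativity near the origin spreads to the whole half line by monotonicity.
  have hP : ∀ s ∈ Ioi (0 : ℝ), pohozaev N p s (u s) (v s) < 0 := by
    intro s hs
    obtain ⟨r, hr1, hr2⟩ := ((eventually_pohozaev_neg hN hp
      (eventually_mem_nhdsWithin.mono hpos) hlu hlv).and (Ioo_mem_nhdsGT hs)).exists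
    exact (hsol.antitoneOn_pohozaev hN hp hpos hr2.1 hs hr2.2.le).trans_lt hr1
  obtain ⟨s, hs0, hmono, hto, hcrit, hall, hcount⟩ :=
    hsol.exists_critical_sequence hN hp hpos hP hinf
  have hsn : ∀ n, 0 ≤ s n := fun n => hs0 ▸ hmono.monotone n.zero_le
  have hspos : ∀ n, 1 ≤ n → 0 < s n := fun n hn => hs0 ▸ hmono hn
  have hvs : ∀ n, 1 ≤ n → v (s n) = 0 := fun n hn => by
    obtain ⟨m, rfl⟩ := Nat.exists_eq_add_of_le' hn
    exact hcrit m
  have hsqrt : ∀ n, √(s n ^ 2) = s n := fun n => Real.sqrt_sq (hsn n)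
  refine ⟨fun n => s n ^ 2, fun n r => u (s n * r), ?_, ?_, fun n hn => ?_,
    fun n hn lam' U' hU' hprof hzero => ?_, u, s, ?_, ?_, ⟨hmono.strictMonoOn _, ?_⟩,
    fun n _ => hsqrt n⟩
  · exact fun n _ m _ hnm => pow_lt_pow_left₀ (hmono hnm) (hsn n) two_ne_zero
  · exact (tendsto_pow_atTop two_ne_zero).comp hto
  · refine ⟨isSingularNeumannSolution_scaled hN hp hsol hpos hinf (hspos n hn) (hvs n hn),
      radialMemH1Ball_scaled hN hp hsol hlu hlv (hspos n hn), ?_, ?_,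
      fun r hr => hpos _ (mul_pos (hspos n hn) hr.1)⟩
    · rw [HasSingularProfile, hsqrt,
        isEquivalent_iff_tendsto_profile (ampl_pos hN hp) (hspos n hn)]
      exact tendsto_scaled_profile (hspos n hn) hlu
    · rw [zeroCount_scaled (hspos n hn)]
      exact hcount n
  -- The given solution is the rescaling of `u` at the critical point `√lam'`, and its number of
  -- zeros identifies the index of that point.
  · obtain ⟨heq, hv0⟩ := hU'.eqOn_scaled hN hp hsol hpos hlu hprof
    have hc : 0 < √lam' := Real.sqrt_pos.2 hU'.lam_pos
    obtain ⟨m, hm⟩ := hall _ hc hv0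
    have hz : zeroCount U' = ((m + 1 : ℕ) : ℕ∞) := by
      rw [zeroCount_congr heq, zeroCount_scaled hc, ← hm]
      exact hcount (m + 1)
    have hnm : n = m + 1 := by
      rw [hzero] at hz
      exact_mod_cast hz
    subst hnm
    refine ⟨?_, ?_⟩
    · simp only [hm]
      exact (Real.sq_sqrt hU'.lam_pos.le).symm
    · simp only [hm]
      exact heq
  · exact isEntireSingularSolution_of_isRadialSol hN hp hsol hpos hlu
  · exact fun w hw => hw.eqOn hN hp hsol hpos hlu
  · ext t
    constructor
    · rintro ⟨n, hn, rfl⟩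
      exact ⟨hspos n hn, by rw [(hsol _ (hspos n hn)).1.deriv]; exact hvs n hn⟩
    · rintro ⟨ht, hdt⟩
      rw [(hsol t ht).1.deriv] at hdt
      obtain ⟨n, hn⟩ := hall t ht hdt
      exact ⟨n + 1, Nat.succ_le_succ n.zero_le, hn⟩
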